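/- Given $\delta \in (0,1)$ and $S = (p_1,\dots,p_n) \in [0,1]^n$, a \emph{trace} of $S$ is the random binary string obtained by drawing independent bits $t_1,\dots,t_n$ with $\Pr[t_i = 1] = p_i$, deleting each bit independently with probability $\delta$, and concatenating the bits that were not deleted. \textbf{Theorem.} Let $0 < \delta \le 10^{-7}$ be a constant and let $a \in \mathbb{N}$. There are a deterministic algorithm (a program for a random access machine with unit-cost addition and subtraction) and two polynomials $P, Q$ such that for every $n \ge 1$ and every $\epsilon > 0$, with $k = \lceil 1/\epsilon \rceil$, the following holds. The algorithm gets as input $n$, $k$ and $P(n+k)$ strings over $\{0,1\}$ of length at most $n$; it halts on every such input after at most $Q(n+k)$ steps. (Thus the number of traces and the running time are $\mathrm{poly}(n,1/\epsilon)$.) If $p_1,\dots,p_n$ are drawn independently and uniformly from $[0,1]$ and the input strings are independent traces of $S = (p_1,\dots,p_n)$, then with probability at least $1 - n^{-a}$ over the randomness of $S$ and the traces, the algorithm outputs estimates $\hat p_1,\dots,\hat p_n$ with $\sum_{i=1}^n |\hat p_i - p_i| \le \epsilon$. -/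

import Mathlib

namespace TraceReconstruction

open MeasureTheory ProbabilityTheory
open scoped ENNReal

/-! ### A random access machine with a step count

A deterministic random access machine, programmed in structured form.  The memory consists of
arrays of natural numbers with unlimited indices; a program can name only finitely many of them.
Addition and truncated subtraction are the only arithmetic operations, and every elementary
operation (literal, array read, addition, subtraction, array write, branch or loop test)
costs one step. -/

/-- The memory: `s a i` is the content of cell `i` of array `a`. -/
abbrev Memory : Type := ℕ → ℕ → ℕ

/-- Arithmetic expressions; `get a e` reads the cell of array `a` at the index computed by `e`. -/
inductive Expr : Type
  | lit (v : ℕ) : Expr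
  | get (a : ℕ) (e : Expr) : Expr
  | add (e₁ e₂ : Expr) : Expr
  | sub (e₁ e₂ : Expr) : Expr

namespace Expr

/-- The value of an expression in a memory. -/
def eval (s : Memory) : Expr → ℕ
  | lit v => v
  | get a e => s a (e.eval s)
  | add e₁ e₂ => e₁.eval s + e₂.eval s
  | sub e₁ e₂ => e₁.eval s - e₂.eval s

/-- The number of elementary operations performed to evaluate an expression. -/
def cost : Expr → ℕ
  | lit _ => 1
  | get _ e => e.cost + 1
  | add e₁ e₂ => e₁.cost + e₂.cost + 1
  | sub e₁ e₂ => e₁.cost + e₂.cost + 1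

end Expr

/-- Programs.  A test succeeds when the value of the tested expression is nonzero. -/
inductive Program : Type
  | set (a : ℕ) (i e : Expr) : Program
  | seq (c₁ c₂ : Program) : Program
  | ite (b : Expr) (c₁ c₂ : Program) : Program
  | loop (b : Expr) (c : Program) : Program

/-- The memory `s` after writing `v` into cell `i` of array `a`. -/
def Memory.write (s : Memory) (a i v : ℕ) : Memory :=
  fun a' i' => if a' = a ∧ i' = i then v else s a' i'

/-- `Exec c s u t`: started in memory `s`, the program `c` halts in memory `u` after exactly
`t` steps.  Both `u` and `t` are determined by `c` and `s`. -/
inductive Exec : Program → Memory → Memory → ℕ → Prop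
  | set (a : ℕ) (i e : Expr) (s : Memory) :
      Exec (.set a i e) s (s.write a (i.eval s) (e.eval s)) (i.cost + e.cost + 1)
  | seq {c₁ c₂ : Program} {s₁ s₂ s₃ : Memory} {t₁ t₂ : ℕ} :
      Exec c₁ s₁ s₂ t₁ → Exec c₂ s₂ s₃ t₂ → Exec (.seq c₁ c₂) s₁ s₃ (t₁ + t₂)
  | ite_true {b : Expr} {c₁ c₂ : Program} {s u : Memory} {t : ℕ} :
      b.eval s ≠ 0 → Exec c₁ s u t → Exec (.ite b c₁ c₂) s u (b.cost + 1 + t)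
  | ite_false {b : Expr} {c₁ c₂ : Program} {s u : Memory} {t : ℕ} :
      b.eval s = 0 → Exec c₂ s u t → Exec (.ite b c₁ c₂) s u (b.cost + 1 + t)
  | loop_done {b : Expr} {c : Program} {s : Memory} :
      b.eval s = 0 → Exec (.loop b c) s s (b.cost + 1)
  | loop_step {b : Expr} {c : Program} {s₁ s₂ s₃ : Memory} {t₁ t₂ : ℕ} :
      b.eval s₁ ≠ 0 → Exec c s₁ s₂ t₁ → Exec (.loop b c) s₂ s₃ t₂ →
        Exec (.loop b c) s₁ s₃ (b.cost + 1 + t₁ + t₂)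

/-- The initial memory on input `n` (length of the unknown string), `k` (the accuracy asked for
is `1 / k`) and a list `X` of traces of length at most `n`.
Array `0` holds `n`, `k` and the number of traces; array `1` holds the lengths of the traces;
array `2` holds in cell `n * t + j` the bit number `j` of trace number `t` (everything is counted
from zero).  All other cells are zero. -/
def inputMemory (n k : ℕ) (X : List (List Bool)) : Memory
  | 0, 0 => n
  | 0, 1 => k
  | 0, 2 => X.length
  | 1, t => (X.getD t []).length
  | 2, q => ((X.getD (q / n) []).getD (q % n) false).toNat
  | _, _ => 0

/-- The `i`-th estimate left in a final memory: the fraction with its numerator in array `3` and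
its denominator in array `4` (and the number `0` if the denominator is zero). -/
noncomputable def output (u : Memory) (i : ℕ) : ℝ := (u 3 i : ℝ) / (u 4 i : ℝ)

/-! ### The generalized deletion channel -/

/-- The random choices behind one trace: the string `T` of coin flips, and for every position
whether its bit is deleted. -/
abbrev Flips (n : ℕ) : Type := (Fin n → Bool) × (Fin n → Bool)

/-- The trace: the bits of the string that are not deleted, in their order. -/
def trace {n : ℕ} (x : Flips n) : List Bool :=
  ((List.finRange n).filter fun i => !x.2 i).map x.1

/-- The law of the choices behind one trace of `p` with deletion probability `δ`: all of them are
independent, bit `i` is `1` with probability `p i`, and each bit is deleted with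
probability `δ`. -/
noncomputable def flipLaw (δ : unitInterval) {n : ℕ} (p : Fin n → unitInterval) : Measure (Flips n) :=
  (Measure.pi fun i => bernoulliMeasure true false (p i)).prod
    (Measure.pi fun _ => bernoulliMeasure true false δ)

/-- The law of the choices behind `N` independent traces of `p`. -/
noncomputable def sampleLaw (δ : unitInterval) {n : ℕ} (p : Fin n → unitInterval) (N : ℕ) :
    Measure (Fin N → Flips n) :=
  Measure.pi fun _ => flipLaw δ p

/-- The list of traces of a sample. -/
def traces {n N : ℕ} (ω : Fin N → Flips n) : List (List Bool) :=
  List.ofFn fun t => trace (ω t)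

/-- On input `n`, `k` and the traces `X`, the program halts with estimates of the entries of `p`
whose total error (in `ℓ¹`) is at most `ε`. -/
def Recovers (c : Program) (k : ℕ) (ε : ℝ) {n : ℕ} (p : Fin n → unitInterval) (X : List (List Bool)) :
    Prop :=
  ∃ (u : Memory) (t : ℕ), Exec c (inputMemory n k X) u t ∧
    ∑ i : Fin n, |output u i - (p i : ℝ)| ≤ ε

/-- The probability that the program succeeds when `p` is uniform in `[0,1]ⁿ` and, given `p`,
the program gets `N` independent traces of `p`. -/
noncomputable def successProb (c : Program) (δ : unitInterval) (n k N : ℕ) (ε : ℝ) : ℝ≥0∞ :=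
  ∫⁻ p : Fin n → unitInterval, sampleLaw δ p N {ω | Recovers c k ε p (traces ω)}

end TraceReconstruction

/-! The entries are estimated from left to right. For entry `i`, every trace is searched for bits
preceded by an occurrence of a pattern `A` and followed by an occurrence of a pattern `B`, both of
logarithmic length `h` (shorter for `B` near the end); the estimate is the fraction of ones among
these bits. A pattern records only confident entries: 1 or 0 for an entry close to 1 or 0, and no
demand otherwise (`symbol`). For `i < h` the role of `A` is played by the demand that exactly `i`
bits precede.

Patterns locate places because, with high probability, a random string is `Good`: in every window
the product of the confidences is at least `0.94 ^ h`, and the pattern of a window matches elsewhere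
with probability at most `0.82 ^ h`. For the second claim, the uniform law is invariant under `p ↦ 1
- p`. Averaged over such reflections, a foreign bit is fair and fits the symbol of `y` with
probability `symbolWeight y`, whose mean is 0.81; see `flipMean_matchProb_behind_le` and
`flipMean_matchProb_before_le`. Markov's inequality then gives `volume_not_good_le`.

The pattern `A` is read from the estimates already made. Since these are used only after rounding to
symbols, an error of 1/200 is harmless (`compatible_precedingPattern`) and errors do not accumulate.
The pattern `B` concerns unknown entries, so all candidates are tried, of which there are
polynomially many.

The anchor `A` alone rules out bits that come from an entry before `i` or more than `h` behind it,
but not those slightly behind `i`. Therefore a candidate `B` is accepted only if hits are frequent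
and `stretches`, in which at least one further bit lies between the bit and `B`, are rare. The true
following pattern is accepted (`traceMean_following_pattern`). Conversely, for any accepted `B`,
rare stretches force `B` to be improbable at the wrong places (`matchProb_le_of_stretches`), so
almost all hits stem from entry `i` (`estimate_error`).

Empirical means are controlled by Chebyshev's inequality and a union bound over all entries and
patterns (`sampleLaw_not_typical_le`), so it does not matter that `A` depends on the traces. On the
machine, all loops inside the computation of one estimate run as often as there are traces;
functions computed this way are closed under the needed constructions (`PolyTime`), which yields
`Algorithm.exists_program`. -/

namespace TraceReconstruction

open MeasureTheory ProbabilityTheory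
open scoped ENNReal

/-! ### Expectations over one trace -/

/-- The expectation of `φ` over a trace of the string with entries `ps`. -/
noncomputable def traceMean (δ : ℝ) : List ℝ → (List Bool → ℝ) → ℝ
  | [], φ => φ []
  | p :: ps, φ => δ * traceMean δ ps φ +
      (1 - δ) * (p * traceMean δ ps (fun T => φ (true :: T)) +
        (1 - p) * traceMean δ ps (fun T => φ (false :: T)))

/-- All entries are probabilities. -/
def IsProb (ps : List ℝ) : Prop := ∀ p ∈ ps, 0 ≤ p ∧ p ≤ 1

theorem IsProb.tail {p : ℝ} {ps : List ℝ} (h : IsProb (p :: ps)) : IsProb ps :=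
  fun q hq => h q (List.mem_cons_of_mem _ hq)

theorem IsProb.head {p : ℝ} {ps : List ℝ} (h : IsProb (p :: ps)) : 0 ≤ p ∧ p ≤ 1 :=
  h p List.mem_cons_self

theorem IsProb.drop {ps : List ℝ} (h : IsProb ps) (m : ℕ) : IsProb (ps.drop m) :=
  fun q hq => h q (List.mem_of_mem_drop hq)

theorem IsProb.take {ps : List ℝ} (h : IsProb ps) (m : ℕ) : IsProb (ps.take m) :=
  fun q hq => h q (List.mem_of_mem_take hq)

theorem IsProb.reverse {ps : List ℝ} (h : IsProb ps) : IsProb ps.reverse :=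
  fun q hq => h q (List.mem_reverse.1 hq)

section traceMean

variable {δ : ℝ}

theorem traceMean_const (ps : List ℝ) (x : ℝ) : traceMean δ ps (fun _ => x) = x := by
  induction ps with
  | nil => rfl
  | cons p ps ih => simp only [traceMean, ih]; ring

theorem traceMean_add (ps : List ℝ) (φ ψ : List Bool → ℝ) :
    traceMean δ ps (fun T => φ T + ψ T) = traceMean δ ps φ + traceMean δ ps ψ := by
  induction ps generalizing φ ψ with
  | nil => rfl
  | cons p ps ih => simp only [traceMean, ih]; ring

theorem traceMean_mul_left (ps : List ℝ) (x : ℝ) (φ : List Bool → ℝ) :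
    traceMean δ ps (fun T => x * φ T) = x * traceMean δ ps φ := by
  induction ps generalizing φ with
  | nil => rfl
  | cons p ps ih => simp only [traceMean, ih]; ring

theorem traceMean_sum {ι : Type*} (ps : List ℝ) (s : Finset ι) (φ : ι → List Bool → ℝ) :
    traceMean δ ps (fun T => ∑ j ∈ s, φ j T) = ∑ j ∈ s, traceMean δ ps (φ j) := by
  classical
  induction s using Finset.induction_on with
  | empty => simpa using traceMean_const ps 0
  | insert a s ha ih => simp only [Finset.sum_insert ha, traceMean_add, ih]

theorem traceMean_mono (h0 : 0 ≤ δ) (h1 : δ ≤ 1) {ps : List ℝ} (hps : IsProb ps)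
    {φ ψ : List Bool → ℝ} (h : ∀ T : List Bool, T.length ≤ ps.length → φ T ≤ ψ T) :
    traceMean δ ps φ ≤ traceMean δ ps ψ := by
  induction ps generalizing φ ψ with
  | nil => exact h [] le_rfl
  | cons p ps ih =>
    have hp := hps.head
    have a1 := ih hps.tail (φ := φ) (ψ := ψ) fun T hT => h T (hT.trans (by simp))
    have a2 := ih hps.tail (φ := fun T => φ (true :: T)) (ψ := fun T => ψ (true :: T))
      fun T hT => h _ (by simpa using hT)
    have a3 := ih hps.tail (φ := fun T => φ (false :: T)) (ψ := fun T => ψ (false :: T))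
      fun T hT => h _ (by simpa using hT)
    simp only [traceMean]
    have := mul_le_mul_of_nonneg_left a2 hp.1
    have := mul_le_mul_of_nonneg_left a3 (sub_nonneg.2 hp.2)
    gcongr

theorem traceMean_nonneg (h0 : 0 ≤ δ) (h1 : δ ≤ 1) {ps : List ℝ} (hps : IsProb ps)
    {φ : List Bool → ℝ} (h : ∀ T, 0 ≤ φ T) : 0 ≤ traceMean δ ps φ := by
  simpa [traceMean_const] using
    traceMean_mono (δ := δ) h0 h1 hps (φ := fun _ => 0) (ψ := φ) fun T _ => h T

theorem traceMean_le_one (h0 : 0 ≤ δ) (h1 : δ ≤ 1) {ps : List ℝ} (hps : IsProb ps)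
    {φ : List Bool → ℝ} (h : ∀ T, φ T ≤ 1) : traceMean δ ps φ ≤ 1 := by
  simpa [traceMean_const] using
    traceMean_mono (δ := δ) h0 h1 hps (φ := φ) (ψ := fun _ => 1) fun T _ => h T

theorem traceMean_append_singleton (ps : List ℝ) (p : ℝ) (φ : List Bool → ℝ) :
    traceMean δ (ps ++ [p]) φ = δ * traceMean δ ps φ +
      (1 - δ) * (p * traceMean δ ps (fun T => φ (T ++ [true])) +
        (1 - p) * traceMean δ ps (fun T => φ (T ++ [false]))) := by
  induction ps generalizing φ with
  | nil => rfl
  | cons q ps ih => simp only [List.cons_append, traceMean, ih]; ring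

/-- Independent deletion commutes with reversal. Anchors are patterns read backwards, and this turns
them into patterns at the beginning of a trace of the reversed string. -/
theorem traceMean_reverse (ps : List ℝ) (φ : List Bool → ℝ) :
    traceMean δ ps.reverse φ = traceMean δ ps (fun T => φ T.reverse) := by
  induction ps generalizing φ with
  | nil => rfl
  | cons p ps ih =>
    simp only [List.reverse_cons, traceMean_append_singleton, traceMean, ih]

/-- The sum, over all positions of a string, of the product of a function of what precedes the
position, one of the bit at the position, and one of what follows it. -/
noncomputable def splitSum (α : List Bool → ℝ) (β : Bool → ℝ) (γ : List Bool → ℝ)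
    (T : List Bool) : ℝ :=
  ∑ y ∈ Finset.range T.length, α (T.take y) * β (T.getD y false) * γ (T.drop (y + 1))

theorem splitSum_cons (α : List Bool → ℝ) (β : Bool → ℝ) (γ : List Bool → ℝ) (b : Bool)
    (T : List Bool) :
    splitSum α β γ (b :: T) = α [] * β b * γ T + splitSum (fun T => α (b :: T)) β γ T := by
  simp only [splitSum, List.length_cons, Finset.sum_range_succ', List.take_succ_cons,
    List.getD_cons_succ, List.drop_succ_cons, List.take_zero, List.getD_cons_zero, List.drop_zero]
  ring

/-- Given that entry `c` survives, what precedes its bit, the bit itself and what follows are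
independent. Summing over the entry of origin instead of the place in the trace factorises the mean
of every statistic of the algorithm. -/
theorem traceMean_splitSum (ps : List ℝ) (α : List Bool → ℝ) (β : Bool → ℝ)
    (γ : List Bool → ℝ) :
    traceMean δ ps (splitSum α β γ) = ∑ c ∈ Finset.range ps.length,
      traceMean δ (ps.take c) α * ((1 - δ) * (ps.getD c 0 * β true + (1 - ps.getD c 0) * β false)) *
        traceMean δ (ps.drop (c + 1)) γ := by
  induction ps generalizing α with
  | nil => simp [traceMean, splitSum]
  | cons p ps ih =>
    simp only [traceMean, splitSum_cons, traceMean_add, ih, traceMean_mul_left, List.length_cons,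
      Finset.sum_range_succ', List.take_succ_cons, List.drop_succ_cons, List.getD_cons_succ,
      List.take_zero, List.drop_zero, List.getD_cons_zero]
    simp only [add_mul, Finset.sum_add_distrib, mul_assoc, ← Finset.mul_sum, mul_add]
    ring

/-- The first `d` bits of a trace use up at least `d` entries, so the rest is a mixture of traces of
suffixes `ps.drop c` with `d ≤ c`. -/
theorem traceMean_drop_le (h0 : 0 ≤ δ) (h1 : δ ≤ 1) {ps : List ℝ} (hps : IsProb ps)
    {γ : List Bool → ℝ} {τ : ℝ} (d : ℕ) (h : ∀ c, d ≤ c → traceMean δ (ps.drop c) γ ≤ τ) :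
    traceMean δ ps (fun T => γ (T.drop d)) ≤ τ := by
  induction ps generalizing d with
  | nil => simpa [traceMean] using h d le_rfl
  | cons p ps ih =>
    cases d with
    | zero => simpa using h 0 le_rfl
    | succ d =>
      have a1 := ih hps.tail (d + 1) fun c hc => by
        simpa using h (c + 1) (by omega)
      have a2 := ih hps.tail d fun c hc => by simpa using h (c + 1) (by omega)
      simp only [traceMean, List.drop_succ_cons]
      nlinarith

/-- Only the event that the first `d` entries all survive is kept. -/
theorem le_traceMean_drop (h0 : 0 ≤ δ) (h1 : δ ≤ 1) {ps : List ℝ} (hps : IsProb ps)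
    {γ : List Bool → ℝ} (hγ : ∀ T, 0 ≤ γ T) (d : ℕ) (hd : d ≤ ps.length) :
    (1 - δ) ^ d * traceMean δ (ps.drop d) γ ≤ traceMean δ ps (fun T => γ (T.drop d)) := by
  induction d generalizing ps with
  | zero => simp
  | succ d ih =>
    cases ps with
    | nil => simp at hd
    | cons p ps =>
      have a1 := ih hps.tail (by simpa using hd)
      have a2 := traceMean_nonneg (φ := fun T => γ (T.drop (d + 1))) h0 h1 hps.tail fun T => hγ _
      simp only [traceMean, List.drop_succ_cons, pow_succ]
      have := mul_le_mul_of_nonneg_left a1 (sub_nonneg.2 h1)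
      have := mul_nonneg h0 a2
      nlinarith

/-! ### Patterns -/

/-- A symbol of a pattern: `0` and `1` demand this bit, and every other number fits both bits. -/
def Fits (s : ℕ) (b : Bool) : Prop := s = b.toNat ∨ 2 ≤ s

instance (s : ℕ) (b : Bool) : Decidable (Fits s b) := inferInstanceAs (Decidable (_ ∨ _))

/-- A prefix of the string fits the pattern. -/
def Matches : List ℕ → List Bool → Prop
  | [], _ => True
  | _ :: _, [] => False
  | s :: P, b :: T => Fits s b ∧ Matches P T

instance decidableMatches : (P : List ℕ) → (T : List Bool) → Decidable (Matches P T)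
  | [], _ => inferInstanceAs (Decidable True)
  | _ :: _, [] => inferInstanceAs (Decidable False)
  | s :: P, b :: T =>
    haveI := decidableMatches P T
    inferInstanceAs (Decidable (Fits s b ∧ Matches P T))

theorem matches_iff (P : List ℕ) (T : List Bool) :
    Matches P T ↔ P.length ≤ T.length ∧
      ∀ l < P.length, Fits (P.getD l 0) (T.getD l false) := by
  induction P generalizing T with
  | nil => simp [Matches]
  | cons s P ih =>
    cases T with
    | nil => simp [Matches]
    | cons b T =>
      simp only [Matches, ih, List.length_cons, add_le_add_iff_right]
      constructor
      · rintro ⟨h1, h2, h3⟩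
        refine ⟨h2, fun l hl => ?_⟩
        cases l with
        | zero => simpa using h1
        | succ l => simpa using h3 l (by omega)
      · rintro ⟨h1, h2⟩
        exact ⟨by simpa using h2 0 (by omega), h1, fun l hl => by simpa using h2 (l + 1) (by omega)⟩

/-- The indicator of `Matches`. -/
noncomputable def matchInd (P : List ℕ) (T : List Bool) : ℝ := if Matches P T then 1 else 0

theorem matchInd_nonneg (P : List ℕ) (T : List Bool) : 0 ≤ matchInd P T := by
  unfold matchInd; split_ifs <;> norm_num

theorem matchInd_le_one (P : List ℕ) (T : List Bool) : matchInd P T ≤ 1 := by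
  unfold matchInd; split_ifs <;> norm_num

theorem matchInd_cons (s : ℕ) (P : List ℕ) (b : Bool) (T : List Bool) :
    matchInd (s :: P) (b :: T) = (if Fits s b then 1 else 0) * matchInd P T := by
  by_cases h1 : Fits s b <;> by_cases h2 : Matches P T <;> simp [matchInd, Matches, h1, h2]

/-- The probability that a bit with mean `p` fits the symbol `s`. -/
noncomputable def fitProb (p : ℝ) (s : ℕ) : ℝ :=
  p * (if Fits s true then 1 else 0) + (1 - p) * (if Fits s false then 1 else 0)

theorem fitProb_zero (p : ℝ) : fitProb p 0 = 1 - p := by simp [fitProb, Fits]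

theorem fitProb_one (p : ℝ) : fitProb p 1 = p := by simp [fitProb, Fits]

theorem fitProb_of_two_le (p : ℝ) {s : ℕ} (hs : 2 ≤ s) : fitProb p s = 1 := by
  simp [fitProb, Fits, hs]

theorem fitProb_nonneg {p : ℝ} (hp : 0 ≤ p ∧ p ≤ 1) (s : ℕ) : 0 ≤ fitProb p s := by
  have := sub_nonneg.2 hp.2
  have := hp.1
  unfold fitProb; positivity

theorem fitProb_le_one {p : ℝ} (hp : 0 ≤ p ∧ p ≤ 1) (s : ℕ) : fitProb p s ≤ 1 := by
  have := hp.1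
  unfold fitProb; split_ifs <;> linarith

/-- The probability that the beginning of a trace of `ps` fits a pattern. -/
noncomputable def matchProb (δ : ℝ) : List ℝ → List ℕ → ℝ
  | _, [] => 1
  | [], _ :: _ => 0
  | p :: ps, s :: P => δ * matchProb δ ps (s :: P) + (1 - δ) * (fitProb p s * matchProb δ ps P)

theorem matchProb_nil (ps : List ℝ) : matchProb δ ps [] = 1 := by
  cases ps <;> simp [matchProb]

theorem traceMean_matchInd (ps : List ℝ) (P : List ℕ) :
    traceMean δ ps (matchInd P) = matchProb δ ps P := by
  induction ps generalizing P with
  | nil => cases P <;> simp [traceMean, matchProb, matchInd, Matches]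
  | cons p ps ih =>
    cases P with
    | nil =>
      have : matchInd [] = fun _ => 1 := by funext T; simp [matchInd, Matches]
      rw [this, traceMean_const, matchProb]
    | cons s P =>
      simp only [traceMean, matchProb, matchInd_cons, traceMean_mul_left, ih, fitProb]
      ring

theorem matchProb_nonneg (h0 : 0 ≤ δ) (h1 : δ ≤ 1) {ps : List ℝ} (hps : IsProb ps) (P : List ℕ) :
    0 ≤ matchProb δ ps P :=
  traceMean_matchInd (δ := δ) ps P ▸ traceMean_nonneg h0 h1 hps (matchInd_nonneg P)

theorem matchProb_le_one (h0 : 0 ≤ δ) (h1 : δ ≤ 1) {ps : List ℝ} (hps : IsProb ps) (P : List ℕ) :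
    matchProb δ ps P ≤ 1 :=
  traceMean_matchInd (δ := δ) ps P ▸ traceMean_le_one h0 h1 hps (matchInd_le_one P)

theorem matchProb_eq_zero (ps : List ℝ) (P : List ℕ) (h : ps.length < P.length) :
    matchProb δ ps P = 0 := by
  induction ps generalizing P with
  | nil => cases P with
    | nil => simp at h
    | cons s P => rfl
  | cons p ps ih => cases P with
    | nil => simp at h
    | cons s P =>
      simp only [List.length_cons] at h
      rw [matchProb, ih _ (by simp; omega), ih _ (by omega)]; ring

/-- `P` demands no more than `P'`, position by position. -/
theorem matchProb_mono (h0 : 0 ≤ δ) (h1 : δ ≤ 1) {ps : List ℝ} (hps : IsProb ps) {P P' : List ℕ}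
    (h : List.Forall₂ (fun s s' => s = s' ∨ 2 ≤ s') P P') :
    matchProb δ ps P ≤ matchProb δ ps P' := by
  induction ps generalizing P P' with
  | nil => cases h <;> simp [matchProb]
  | cons p ps ih =>
    cases h with
    | nil => exact le_rfl
    | @cons s s' P P' hs hP =>
      simp only [matchProb]
      have a1 := ih hps.tail (List.Forall₂.cons hs hP)
      have a2 := ih hps.tail hP
      have a3 : fitProb p s ≤ fitProb p s' := by
        rcases hs with rfl | hs
        · exact le_rfl
        · rw [fitProb_of_two_le p hs]; exact fitProb_le_one hps.head s
      have a4 := matchProb_nonneg h0 h1 hps.tail P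
      have a5 := fitProb_nonneg hps.head s'
      have a6 := sub_nonneg.2 h1
      gcongr

/-- On the event that the first `P.length` entries all survive, each of them faces its own symbol.
-/
theorem le_matchProb (h0 : 0 ≤ δ) (h1 : δ ≤ 1) {ps : List ℝ} (hps : IsProb ps) {P : List ℕ}
    {g : ℝ → ℝ} (hg : ∀ p, 0 ≤ g p)
    (h : List.Forall₂ (fun p s => g p ≤ fitProb p s) (ps.take P.length) P) :
    (1 - δ) ^ P.length * ((ps.take P.length).map g).prod ≤ matchProb δ ps P := by
  induction P generalizing ps with
  | nil => simp [matchProb_nil]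
  | cons s P ih =>
    cases ps with
    | nil => simp at h
    | cons p ps =>
      simp only [List.length_cons, List.take_succ_cons, List.forall₂_cons] at h
      simp only [List.length_cons, List.take_succ_cons, List.map_cons, List.prod_cons, matchProb]
      have a1 := ih hps.tail h.2
      have a2 := matchProb_nonneg h0 h1 hps.tail (s :: P)
      have a3 := sub_nonneg.2 h1
      have a4 : g p * ((1 - δ) ^ P.length * ((ps.take P.length).map g).prod) ≤
          fitProb p s * matchProb δ ps P :=
        mul_le_mul h.1 a1 (mul_nonneg (pow_nonneg a3 _)
          (List.prod_nonneg (by simp only [List.mem_map]; rintro _ ⟨x, -, rfl⟩; exact hg x)))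
          (fitProb_nonneg hps.head s)
      have := mul_le_mul_of_nonneg_left a4 a3
      have := mul_nonneg h0 a2
      rw [pow_succ]
      linarith

theorem traceMean_length_eq_zero (ps : List ℝ) (r : ℕ) (hr : ps.length < r) :
    traceMean δ ps (fun T => if T.length = r then 1 else 0) = 0 := by
  induction ps generalizing r with
  | nil => simp only [traceMean]; rw [if_neg]; simp at hr ⊢; omega
  | cons q qs ih =>
    obtain ⟨r, rfl⟩ : ∃ r', r = r' + 1 := ⟨r - 1, by simp at hr; omega⟩
    simp only [List.length_cons] at hr
    simp only [traceMean, List.length_cons, add_left_inj, ih r (by omega), ih (r + 1) (by omega)]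
    ring

/-- The probability that a trace has length `r`. -/
theorem traceMean_length_le (h0 : 0 ≤ δ) (h1 : δ ≤ 1) (ps : List ℝ) (r : ℕ)
    (hr : r ≤ ps.length) :
    traceMean δ ps (fun T => if T.length = r then 1 else 0) ≤ (2 * δ) ^ (ps.length - r) * 2 ^ r := by
  -- With `m = ps.length` the probability is `C(m, r) δ ^ (m - r) (1 - δ) ^ r`. The bound replaces
  -- the binomial coefficient by `2 ^ m`, and Pascal's recursion becomes doubling.
  induction ps generalizing r with
  | nil =>
    obtain rfl : r = 0 := by simpa using hr
    simp [traceMean]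
  | cons p ps ih =>
    cases r with
    | zero =>
      have a1 := ih 0 (by simp)
      simp only [traceMean, List.length_cons, Nat.add_one_ne_zero, if_false, traceMean_const]
      simp only [Nat.sub_zero, pow_zero, mul_one] at a1 ⊢
      rw [pow_succ]
      have := mul_le_mul_of_nonneg_left a1 h0
      have : 0 ≤ (2 * δ) ^ ps.length := by positivity
      nlinarith
    | succ r =>
      have hr' : r ≤ ps.length := by simpa using hr
      have a1 := ih r hr'
      have a2 : traceMean δ ps (fun T => if T.length = r + 1 then 1 else 0) * (2 * δ) ≤
          (2 * δ) ^ (ps.length - r) * 2 ^ (r + 1) := by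
        rcases hr'.lt_or_eq with hlt | heq
        · have := ih (r + 1) hlt
          have e : ps.length - r = (ps.length - (r + 1)) + 1 := by omega
          rw [e, pow_succ]
          have := mul_le_mul_of_nonneg_right this (by positivity : 0 ≤ 2 * δ)
          linarith
        · have : traceMean δ ps (fun T => if T.length = r + 1 then 1 else 0) = 0 := by
            exact traceMean_length_eq_zero ps _ (by omega)
          rw [this, zero_mul]; positivity
      simp only [traceMean, List.length_cons, add_left_inj, Nat.add_sub_add_right]
      have e : (2 : ℝ) ^ (r + 1) = 2 * 2 ^ r := by ring
      rw [e] at a2 ⊢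
      have : 0 ≤ (2 * δ) ^ (ps.length - r) * 2 ^ r := by positivity
      have := mul_le_mul_of_nonneg_left a1 (sub_nonneg.2 h1)
      nlinarith

theorem le_traceMean_length (h1 : δ ≤ 1) {ps : List ℝ} (hps : IsProb ps) :
    (1 - δ) ^ ps.length ≤ traceMean δ ps (fun T => if T.length = ps.length then 1 else 0) := by
  induction ps with
  | nil => simp [traceMean]
  | cons p ps ih =>
    simp only [traceMean, List.length_cons, add_left_inj, pow_succ]
    rw [traceMean_length_eq_zero ps _ (Nat.lt_succ_self _)]
    have := mul_le_mul_of_nonneg_left (ih hps.tail) (sub_nonneg.2 h1)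
    linarith

end traceMean

/-! ### The law of a sample -/

/-- The probability that a bit with mean `q` equals `b`. -/
noncomputable def bitProb (q : ℝ) (b : Bool) : ℝ := if b then q else 1 - q

theorem trace_cons {n : ℕ} (b d : Bool) (x y : Fin n → Bool) :
    trace (n := n + 1) (Fin.cons b x, Fin.cons d y) =
      if d then trace (x, y) else b :: trace (x, y) := by
  cases d <;>
  simp [trace, List.finRange_succ, List.filter_map, Function.comp_def]

theorem length_trace_le {n : ℕ} (x : Flips n) : (trace x).length ≤ n := by
  simpa [trace] using (List.length_filter_le (fun i => !x.2 i) (List.finRange n))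

theorem sum_bool_cons {n : ℕ} (f : (Fin (n + 1) → Bool) → ℝ) :
    ∑ x, f x = (∑ x : Fin n → Bool, f (Fin.cons true x)) + ∑ x : Fin n → Bool, f (Fin.cons false x) := by
  rw [← (Fin.consEquiv fun _ => Bool).sum_comp f, Fintype.sum_prod_type]
  simp [Fin.consEquiv]

/-- This links the recursive mean to the product law of coin flips and deletions, by splitting off
the first entry on both sides. -/
theorem sum_bitProb_trace (δ : ℝ) {n : ℕ} (q : Fin n → ℝ) (φ : List Bool → ℝ) :
    ∑ x : Fin n → Bool, ∑ y : Fin n → Bool,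
      (∏ i, bitProb (q i) (x i)) * (∏ i, bitProb δ (y i)) * φ (trace (x, y)) =
        traceMean δ (List.ofFn q) φ := by
  induction n generalizing φ with
  | zero => simp [traceMean, trace]
  | succ n ih =>
    simp only [sum_bool_cons, Fin.prod_univ_succ, Fin.cons_zero, Fin.cons_succ, trace_cons,
      List.ofFn_succ, traceMean, ← ih, Finset.mul_sum, ← Finset.sum_add_distrib]
    refine Finset.sum_congr rfl fun x _ => Finset.sum_congr rfl fun y _ => ?_
    simp [bitProb]
    ring

instance {n : ℕ} (δ : unitInterval) (p : Fin n → unitInterval) :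
    IsProbabilityMeasure (flipLaw δ p) := by
  unfold flipLaw; infer_instance

instance {n N : ℕ} (δ : unitInterval) (p : Fin n → unitInterval) :
    IsProbabilityMeasure (sampleLaw δ p N) := by
  unfold sampleLaw; infer_instance

theorem flipLaw_real_singleton (δ : unitInterval) {n : ℕ} (p : Fin n → unitInterval) (x : Flips n) :
    (flipLaw δ p).real {x} = (∏ i, bitProb (p i) (x.1 i)) * ∏ i, bitProb δ (x.2 i) := by
  have key : ∀ (q : unitInterval) (b : Bool),
      (bernoulliMeasure true false q).real {b} = bitProb q b := by
    intro q b
    rw [bernoulliMeasure_real_apply q (measurableSet_singleton _)]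
    cases b <;> simp [bitProb]
  obtain ⟨x, y⟩ := x
  rw [← Set.singleton_prod_singleton, flipLaw, measureReal_prod_prod]
  simp only [← Set.univ_pi_singleton, measureReal_def, Measure.pi_pi, ENNReal.toReal_prod]
  simp only [← measureReal_def, key]

theorem integral_flipLaw (δ : unitInterval) {n : ℕ} (p : Fin n → unitInterval)
    (φ : List Bool → ℝ) :
    ∫ x, φ (trace x) ∂(flipLaw δ p) = traceMean δ (List.ofFn fun i => (p i : ℝ)) φ := by
  rw [integral_fintype (Integrable.of_finite), ← sum_bitProb_trace, Fintype.sum_prod_type]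
  simp only [flipLaw_real_singleton, smul_eq_mul]

/-- Chebyshev's inequality for the average of a bounded statistic over the traces. -/
theorem sampleLaw_deviation (δ : unitInterval) {n N : ℕ} (p : Fin n → unitInterval)
    (φ : List Bool → ℝ) {b τ : ℝ} (hτ : 0 < τ) (hN : 0 < N)
    (hφ : ∀ T : List Bool, T.length ≤ n → 0 ≤ φ T ∧ φ T ≤ b) :
    sampleLaw δ p N {ω | N * τ ≤
      |∑ t, φ (trace (ω t)) - N * traceMean δ (List.ofFn fun i => (p i : ℝ)) φ|} ≤
        ENNReal.ofReal (b ^ 2 / (N * τ ^ 2)) := by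
  have hmem : ∀ t : Fin N, MemLp (fun x : Flips n => φ (trace x)) 2 (flipLaw δ p) :=
    fun _ => MemLp.of_discrete
  have hvar : variance (fun x : Flips n => φ (trace x)) (flipLaw δ p) ≤ b ^ 2 := by
    refine (variance_le_expectation_sq (by fun_prop)).trans ?_
    calc _ ≤ ∫ x : Flips n, b ^ 2 ∂(flipLaw δ p) := by
            refine integral_mono Integrable.of_finite Integrable.of_finite fun x => ?_
            have := hφ (trace x) (length_trace_le x)
            simp only [Pi.pow_apply]
            exact pow_le_pow_left₀ this.1 this.2 2
      _ = b ^ 2 := by simp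
  have hsum := variance_sum_pi (μ := fun _ : Fin N => flipLaw δ p) hmem
  have hmean : ∫ ω, (∑ t, φ (trace (ω t))) ∂(sampleLaw δ p N) =
      N * traceMean δ (List.ofFn fun i => (p i : ℝ)) φ := by
    rw [integral_finsetSum _ fun _ _ => Integrable.of_finite]
    have : ∀ t : Fin N, ∫ ω : Fin N → Flips n, φ (trace (ω t)) ∂(sampleLaw δ p N) =
        traceMean δ (List.ofFn fun i => (p i : ℝ)) φ := by
      intro t
      rw [← integral_flipLaw]
      exact integral_comp_eval (μ := fun _ : Fin N => flipLaw δ p)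
        (f := fun x => φ (trace x)) (by fun_prop)
    simp [this]
  have hNpos : (0 : ℝ) < N := by exact_mod_cast hN
  have hc := meas_ge_le_variance_div_sq (μ := sampleLaw δ p N)
    (X := fun ω => ∑ t, φ (trace (ω t))) MemLp.of_discrete (c := N * τ) (by positivity)
  rw [hmean] at hc
  refine hc.trans (ENNReal.ofReal_le_ofReal ?_)
  have hv : variance (fun ω : Fin N → Flips n => ∑ t, φ (trace (ω t))) (sampleLaw δ p N) ≤
      N * b ^ 2 := by
    have e : (fun ω : Fin N → Flips n => ∑ t, φ (trace (ω t))) =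
        ∑ t : Fin N, fun ω : Fin N → Flips n => φ (trace (ω t)) := by
      funext ω; simp
    rw [e]
    unfold sampleLaw
    rw [hsum]
    calc _ ≤ ∑ t : Fin N, b ^ 2 := Finset.sum_le_sum fun _ _ => hvar
      _ = N * b ^ 2 := by simp
  calc _ ≤ N * b ^ 2 / (N * τ) ^ 2 := by gcongr
    _ = b ^ 2 / (N * τ ^ 2) := by field_simp

/-! ### Averages over reflections of the entries -/

/-- The average of `φ` over all ways to replace some entries `p` by `1 - p`. -/
noncomputable def flipMean : List ℝ → (List ℝ → ℝ) → ℝ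
  | [], φ => φ []
  | p :: ps, φ => flipMean ps fun l => (φ (p :: l) + φ ((1 - p) :: l)) / 2

/-- `l` arises from `ps` by replacing some entries `p` by `1 - p`. -/
abbrev IsFlip (ps l : List ℝ) : Prop := List.Forall₂ (fun p q => q = p ∨ q = 1 - p) ps l

theorem IsFlip.isProb {ps l : List ℝ} (h : IsFlip ps l) (hps : IsProb ps) : IsProb l := by
  induction h with
  | nil => exact hps
  | cons h1 h2 ih =>
    intro q hq
    rcases List.mem_cons.1 hq with rfl | hq
    · have := hps.head
      rcases h1 with rfl | rfl <;> constructor <;> linarith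
    · exact ih hps.tail q hq

theorem flipMean_mono {ps : List ℝ} {φ ψ : List ℝ → ℝ} (h : ∀ l, IsFlip ps l → φ l ≤ ψ l) :
    flipMean ps φ ≤ flipMean ps ψ := by
  induction ps generalizing φ ψ with
  | nil => exact h [] .nil
  | cons p ps ih =>
    refine ih fun l hl => ?_
    have := h (p :: l) (.cons (.inl rfl) hl)
    have := h ((1 - p) :: l) (.cons (.inr rfl) hl)
    linarith

theorem flipMean_congr {ps : List ℝ} {φ ψ : List ℝ → ℝ} (h : ∀ l, IsFlip ps l → φ l = ψ l) :
    flipMean ps φ = flipMean ps ψ :=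
  le_antisymm (flipMean_mono fun l hl => (h l hl).le) (flipMean_mono fun l hl => (h l hl).ge)

theorem flipMean_const (ps : List ℝ) (x : ℝ) : flipMean ps (fun _ => x) = x := by
  induction ps with
  | nil => rfl
  | cons p ps ih => simp only [flipMean, add_self_div_two, ih]

theorem flipMean_linear (ps : List ℝ) (x y : ℝ) (φ ψ : List ℝ → ℝ) :
    flipMean ps (fun l => x * φ l + y * ψ l) = x * flipMean ps φ + y * flipMean ps ψ := by
  induction ps generalizing φ ψ with
  | nil => rfl
  | cons p ps ih =>
    simp only [flipMean, ← ih]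
    congr 1; funext l; ring

theorem flipMean_drop (ps : List ℝ) (m : ℕ) (φ : List ℝ → ℝ) :
    flipMean ps (fun l => φ (l.drop m)) = flipMean (ps.drop m) φ := by
  induction ps generalizing m with
  | nil => simp [flipMean]
  | cons p ps ih =>
    cases m with
    | zero => simp
    | succ m => simp [flipMean, ih]

theorem flipMean_ofFn {n : ℕ} (p : Fin n → ℝ) (φ : List ℝ → ℝ) :
    flipMean (List.ofFn p) φ = (∑ σ : Fin n → Bool,
      φ (List.ofFn fun i => if σ i then p i else 1 - p i)) / 2 ^ n := by
  induction n generalizing φ with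
  | zero => simp [flipMean]
  | succ n ih =>
    simp only [List.ofFn_succ, flipMean, ih, sum_bool_cons, Fin.cons_zero, Fin.cons_succ, if_true,
      Bool.false_eq_true, if_false, ← Finset.sum_add_distrib, pow_succ, ← Finset.sum_div]
    rw [div_div, mul_comm]

/-! ### The pattern of confident bits -/

/-- The symbol of an entry: the more likely bit if it is likely enough, otherwise no demand. -/
noncomputable def symbol (p : ℝ) : ℕ := if 81 / 100 ≤ p then 1 else if p ≤ 19 / 100 then 0 else 2

/-- The probability that a fair bit fits the symbol of `p`. -/
noncomputable def symbolWeight (p : ℝ) : ℝ := if 81 / 100 ≤ p ∨ p ≤ 19 / 100 then 1 / 2 else 1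

theorem symbolWeight_nonneg (p : ℝ) : 0 ≤ symbolWeight p := by
  unfold symbolWeight; split_ifs <;> norm_num

theorem symbolWeight_le_one (p : ℝ) : symbolWeight p ≤ 1 := by
  unfold symbolWeight; split_ifs <;> norm_num

theorem symbolWeight_one_sub (p : ℝ) : symbolWeight (1 - p) = symbolWeight p := by
  unfold symbolWeight
  congr 1
  apply propext
  constructor <;> rintro (h | h) <;> [right; left; right; left] <;> linarith

theorem prod_symbolWeight_nonneg (ps : List ℝ) : 0 ≤ (ps.map symbolWeight).prod :=
  List.prod_nonneg (by simp only [List.mem_map]; rintro _ ⟨x, -, rfl⟩; exact symbolWeight_nonneg x)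

/-- The means `p` and `1 - p` average to 1/2, so an entry unrelated to `y` acts as a fair bit
against the symbol of `y`. -/
theorem fitProb_symbol_average (p y : ℝ) :
    (fitProb p (symbol y) + fitProb (1 - p) (symbol y)) / 2 = symbolWeight y := by
  unfold symbol symbolWeight
  by_cases h1 : 81 / 100 ≤ y
  · simp [h1, fitProb_one]
  · by_cases h2 : y ≤ 19 / 100
    · simp [h1, h2, fitProb_zero]
    · simp [h1, h2, fitProb_of_two_le]

variable {δ : ℝ}

theorem matchProb_zero_add_one (ps : List ℝ) (P : List ℕ) :
    matchProb δ ps (0 :: P) + matchProb δ ps (1 :: P) = matchProb δ ps (2 :: P) := by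
  induction ps with
  | nil => simp [matchProb]
  | cons p ps ih =>
    simp only [matchProb, ← ih, fitProb_zero, fitProb_one, fitProb_of_two_le p le_rfl]
    ring

/-- If `p` enters only through the demanded symbol, reflection exchanges the demands 0 and 1, which
together amount to a wildcard. -/
theorem matchProb_symbol_average (ps : List ℝ) (p : ℝ) (P : List ℕ) :
    (matchProb δ ps (symbol p :: P) + matchProb δ ps (symbol (1 - p) :: P)) / 2 =
      symbolWeight p * matchProb δ ps (2 :: P) := by
  have key := matchProb_zero_add_one (δ := δ) ps P
  unfold symbol symbolWeight
  by_cases h1 : 81 / 100 ≤ p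
  · have h2 : ¬ (81 / 100 ≤ 1 - p) := by linarith
    have h3 : 1 - p ≤ 19 / 100 := by linarith
    simp only [h1, h2, h3, if_true, if_false, true_or]
    linarith
  · by_cases h2 : p ≤ 19 / 100
    · have h3 : 81 / 100 ≤ 1 - p := by linarith
      simp only [h1, h2, h3, if_true, if_false, or_true]
      linarith
    · have h3 : ¬ (81 / 100 ≤ 1 - p) := by linarith
      have h4 : ¬ (1 - p ≤ 19 / 100) := by linarith
      simp only [h1, h2, h3, h4, if_false, or_self]
      ring

/-- The wildcard is taken by the first surviving entry, so the mean is a combination, of total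
weight at most 1, of means of matches that start at places `c' > c`. -/
theorem flipMean_matchProb_wildcard_le (h0 : 0 ≤ δ) (h1 : δ ≤ 1) (ps : List ℝ)
    (P : List ℝ → List ℕ) {W : ℝ} (hW : 0 ≤ W) (c : ℕ)
    (h : ∀ c', c < c' → flipMean ps (fun l => matchProb δ (l.drop c') (P l)) ≤ W) :
    flipMean ps (fun l => matchProb δ (l.drop c) (2 :: P l)) ≤ W := by
  induction hm : ps.length - c generalizing c with
  | zero =>
    have : flipMean ps (fun l => matchProb δ (l.drop c) (2 :: P l)) = flipMean ps fun _ => 0 := by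
      refine flipMean_congr fun l hl => ?_
      rw [List.drop_eq_nil_of_le (by have := hl.length_eq; omega), matchProb]
    rwa [this, flipMean_const]
  | succ m ih =>
    have e : flipMean ps (fun l => matchProb δ (l.drop c) (2 :: P l)) =
        flipMean ps (fun l => δ * matchProb δ (l.drop (c + 1)) (2 :: P l) +
          (1 - δ) * matchProb δ (l.drop (c + 1)) (P l)) := by
      refine flipMean_congr fun l hl => ?_
      have hc : c < l.length := by have := hl.length_eq; omega
      rw [List.drop_eq_getElem_cons hc, matchProb, fitProb_of_two_le _ le_rfl, one_mul]
    rw [e, flipMean_linear]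
    have a1 := ih (c + 1) (fun c' hc' => h c' (by omega)) (by omega)
    have a2 := h (c + 1) (Nat.lt_succ_self c)
    have := mul_le_mul_of_nonneg_left a1 h0
    have := mul_le_mul_of_nonneg_left a2 (sub_nonneg.2 h1)
    linarith

/-- A trace that starts behind the place where the pattern was taken. -/
theorem flipMean_matchProb_behind_le (h0 : 0 ≤ δ) (h1 : δ ≤ 1) (ps : List ℝ) (e r : ℕ) :
    flipMean ps (fun l => matchProb δ (l.drop (e + 1)) ((l.take r).map symbol)) ≤
      ((ps.take r).map symbolWeight).prod := by
  induction ps generalizing e r with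
  | nil => simp [flipMean, matchProb_nil]
  | cons p ps ih =>
    cases r with
    | zero => simp [matchProb_nil, flipMean_const]
    | succ r =>
      -- The head `p` lies before the text, so it is seen only by the pattern, and its reflection
      -- turns its symbol into a wildcard.
      simp only [flipMean, List.drop_succ_cons, List.take_succ_cons, List.map_cons,
        matchProb_symbol_average, List.prod_cons]
      have := flipMean_linear ps (symbolWeight p) 0
        (fun l => matchProb δ (l.drop e) (2 :: (l.take r).map symbol)) (fun _ => 0)
      simp only [mul_zero, add_zero, zero_mul] at this
      rw [this]
      refine mul_le_mul_of_nonneg_left ?_ (symbolWeight_nonneg p)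
      refine flipMean_matchProb_wildcard_le h0 h1 ps (fun l => (l.take r).map symbol)
        (prod_symbolWeight_nonneg _) e fun c' hc' => ?_
      -- The wildcard has consumed an entry, so the text again starts strictly behind the rest of
      -- the pattern.
      obtain ⟨c', rfl⟩ : ∃ x, c' = x + 1 := ⟨c' - 1, by omega⟩
      exact ih c' r

/-- A trace that starts before the place where the pattern was taken. -/
theorem flipMean_matchProb_before_le (h0 : 0 ≤ δ) (h1 : δ ≤ 1) {ps : List ℝ} (hps : IsProb ps)
    (e r : ℕ) :
    flipMean ps (fun l => matchProb δ l (((l.drop e).take r).map symbol)) ≤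
      (((ps.drop e).take r).map symbolWeight).prod + (2 * δ) ^ e * 2 ^ r := by
  induction ps generalizing e r with
  | nil => simp [flipMean, matchProb_nil]; positivity
  | cons p ps ih =>
    cases e with
    | zero =>
      -- Once the gap is closed nothing is independent any more; the error term is then at least 1
      -- and pays for the trivial bound.
      have : flipMean (p :: ps) (fun l => matchProb δ l (((l.drop 0).take r).map symbol)) ≤ 1 := by
        rw [← flipMean_const (p :: ps) 1]
        exact flipMean_mono fun l hl => matchProb_le_one h0 h1 (hl.isProb hps) _
      have h2 : (1 : ℝ) ≤ 2 ^ r := one_le_pow₀ (by norm_num)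
      have := prod_symbolWeight_nonneg (((p :: ps).drop 0).take r)
      simp only [pow_zero, one_mul]
      linarith
    | succ e =>
      have hpos : 0 ≤ (2 * δ) ^ (e + 1) * 2 ^ r := by positivity
      cases r with
      | zero => simp [matchProb_nil, flipMean_const]; positivity
      | succ r =>
        rcases le_or_gt ps.length e with hlen | hlen
        · have : flipMean (p :: ps) (fun l => matchProb δ l (((l.drop (e + 1)).take (r + 1)).map
              symbol)) = 1 := by
            rw [← flipMean_const (p :: ps) 1]
            refine flipMean_congr fun l hl => ?_
            rw [List.drop_eq_nil_of_le (by have := hl.length_eq; simp at this; omega)]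
            simp [matchProb_nil]
          rw [this, List.drop_eq_nil_of_le (by simp; omega)]
          simp; positivity
        · set y := ps[e] with hy
          -- The head lies before the pattern, so only the text sees it. If deleted, it shortens the
          -- gap by one; if kept, it uses up the symbol of `y` at the averaged cost `symbolWeight
          -- y`, and the gap stays the same.
          have eq : flipMean (p :: ps) (fun l => matchProb δ l (((l.drop (e + 1)).take (r + 1)).map
              symbol)) = flipMean ps (fun l =>
                δ * matchProb δ l (((l.drop e).take (r + 1)).map symbol) +
                ((1 - δ) * symbolWeight y) * matchProb δ l (((l.drop (e + 1)).take r).map symbol)) := by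
            rw [flipMean]
            refine flipMean_congr fun l hl => ?_
            have hle : e < l.length := by have := hl.length_eq; omega
            have hly : symbolWeight l[e] = symbolWeight y := by
              have := (List.forall₂_iff_get.1 hl).2 e hlen hle
              simp only [List.get_eq_getElem] at this
              rcases this with h | h <;> rw [h]
              exact symbolWeight_one_sub _
            simp only [List.drop_succ_cons]
            rw [List.drop_eq_getElem_cons hle]
            simp only [List.take_succ_cons, List.map_cons, matchProb]
            rw [← hly, ← fitProb_symbol_average p]
            ring
          rw [eq, flipMean_linear]
          have a1 := ih hps.tail e (r + 1)
          have a2 := ih hps.tail (e + 1) r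
          have hw := symbolWeight_nonneg y
          have hw1 := symbolWeight_le_one y
          have a3 := sub_nonneg.2 h1
          have b1 := mul_le_mul_of_nonneg_left a1 h0
          have b2 := mul_le_mul_of_nonneg_left a2 (mul_nonneg a3 hw)
          have e1 : ((ps.drop e).take (r + 1)).map symbolWeight =
              symbolWeight y :: ((ps.drop (e + 1)).take r).map symbolWeight := by
            rw [List.drop_eq_getElem_cons hlen]; rfl
          simp only [List.drop_succ_cons]
          rw [e1, List.prod_cons] at b1 ⊢
          set W := (((ps.drop (e + 1)).take r).map symbolWeight).prod
          have hX : 0 ≤ (2 * δ) ^ e * δ * 2 ^ r := by positivity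
          have b3 : (1 - δ) * symbolWeight y * ((2 * δ) ^ (e + 1) * 2 ^ r) ≤
              1 * ((2 * δ) ^ (e + 1) * 2 ^ r) :=
            mul_le_mul_of_nonneg_right (mul_le_one₀ (by linarith) hw hw1) (by positivity)
          -- The error terms of the two cases are bounded by equal halves of the claimed one.
          have e2 : (2 * δ) ^ (e + 1) * 2 ^ (r + 1) = 4 * ((2 * δ) ^ e * δ * 2 ^ r) := by ring
          have e3 : δ * ((2 * δ) ^ e * 2 ^ (r + 1)) = 2 * ((2 * δ) ^ e * δ * 2 ^ r) := by ring
          have e4 : (2 * δ) ^ (e + 1) * 2 ^ r = 2 * ((2 * δ) ^ e * δ * 2 ^ r) := by ring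
          rw [e2]
          rw [e4] at b2 b3
          rw [mul_add, e3] at b1
          nlinarith

/-! ### Random strings -/

/-- The entries of a random string, as a list of real numbers. -/
abbrev entries {n : ℕ} (p : Fin n → unitInterval) : List ℝ := List.ofFn fun i => (p i : ℝ)

theorem isProb_entries {n : ℕ} (p : Fin n → unitInterval) : IsProb (entries p) := by
  intro q hq
  obtain ⟨i, rfl⟩ := List.mem_ofFn.1 hq
  exact (p i).2

theorem measurable_symbol : Measurable symbol :=
  Measurable.ite (measurableSet_Ici) measurable_const
    (Measurable.ite (measurableSet_Iic) measurable_const measurable_const)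

theorem measurable_matchProb {Ω : Type*} [MeasurableSpace Ω] (δ : ℝ) (f g : List (Ω → ℝ))
    (hf : ∀ u ∈ f, Measurable u) (hg : ∀ u ∈ g, Measurable u) :
    Measurable fun ω => matchProb δ (f.map (· ω)) ((g.map (· ω)).map symbol) := by
  induction f generalizing g with
  | nil => cases g <;> simp [matchProb]
  | cons u f ih =>
    cases g with
    | nil => simp [matchProb]
    | cons v g =>
      simp only [List.map_cons, matchProb]
      have a1 := ih (v :: g) (fun w hw => hf w (List.mem_cons_of_mem _ hw)) hg
      have a2 := ih g (fun w hw => hf w (List.mem_cons_of_mem _ hw))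
        (fun w hw => hg w (List.mem_cons_of_mem _ hw))
      simp only [List.map_cons] at a1
      have hu := hf u List.mem_cons_self
      have hv : Measurable fun ω => symbol (v ω) := measurable_symbol.comp (hg v List.mem_cons_self)
      have a3 : Measurable fun ω => fitProb (u ω) (symbol (v ω)) := by
        unfold fitProb
        have k1 : ∀ b, MeasurableSet {ω | Fits (symbol (v ω)) b} := fun b =>
          hv (MeasurableSet.of_discrete (s := {s | Fits s b}))
        exact (hu.mul (Measurable.ite (k1 true) measurable_const measurable_const)).add
          ((measurable_const.sub hu).mul (Measurable.ite (k1 false) measurable_const measurable_const))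
      exact (a1.const_mul δ).add ((a3.mul a2).const_mul (1 - δ))

theorem measurable_matchProb_entries (δ : ℝ) (n j h c : ℕ) :
    Measurable fun p : Fin n → unitInterval =>
      matchProb δ ((entries p).drop c) ((((entries p).drop j).take h).map symbol) := by
  set F : List ((Fin n → unitInterval) → ℝ) := List.ofFn fun i p => (p i : ℝ) with hF
  have hmeas : ∀ u ∈ F, Measurable u := by
    intro u hu
    obtain ⟨i, rfl⟩ := List.mem_ofFn.1 hu
    fun_prop
  have e : ∀ p : Fin n → unitInterval, entries p = F.map (· p) := by
    intro p; rw [hF, List.map_ofFn]; rfl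
  simp only [e, ← List.map_drop, ← List.map_take]
  exact measurable_matchProb δ _ _ (fun u hu => hmeas u (List.mem_of_mem_drop hu))
    (fun u hu => hmeas u (List.mem_of_mem_drop (List.mem_of_mem_take hu)))

/-- The uniform law is invariant under each of the `2 ^ n` reflections, so `φ` can be replaced under
the integral by its average over them, which is bounded pointwise. -/
theorem integral_entries_le {n : ℕ} (φ ψ : List ℝ → ℝ)
    (hφ : Measurable fun p : Fin n → unitInterval => φ (entries p))
    (hφ0 : ∀ l, IsProb l → 0 ≤ φ l) (hφ1 : ∀ l, IsProb l → φ l ≤ 1)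
    (hψ : Integrable fun p : Fin n → unitInterval => ψ (entries p))
    (h : ∀ l, IsProb l → flipMean l φ ≤ ψ l) :
    ∫ p : Fin n → unitInterval, φ (entries p) ≤ ∫ p : Fin n → unitInterval, ψ (entries p) := by
  let fl : (Fin n → Bool) → (Fin n → unitInterval) → (Fin n → unitInterval) :=
    fun σ p i => if σ i then p i else unitInterval.symm (p i)
  have hfl : ∀ σ, MeasurePreserving (fl σ) volume volume := by
    intro σ
    refine volume_preserving_pi (f := fun i x => if σ i then x else unitInterval.symm x) fun i => ?_
    rcases Bool.eq_false_or_eq_true (σ i) with h | h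
    rotate_left
    · simpa [h] using unitInterval.measurePreserving_symm
    · simp only [h, if_true]
      exact MeasurePreserving.id volume
  have hint : Integrable fun p : Fin n → unitInterval => φ (entries p) :=
    Integrable.of_bound hφ.aestronglyMeasurable 1 (ae_of_all _ fun p => by
      rw [Real.norm_eq_abs, abs_of_nonneg (hφ0 _ (isProb_entries p))]
      exact hφ1 _ (isProb_entries p))
  have e1 : ∀ σ, ∫ p, φ (entries (fl σ p)) = ∫ p : Fin n → unitInterval, φ (entries p) := by
    intro σ
    have := integral_map (μ := (volume : Measure (Fin n → unitInterval)))
      (hfl σ).measurable.aemeasurable (f := fun p => φ (entries p))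
      (by rw [(hfl σ).map_eq]; exact hφ.aestronglyMeasurable)
    rw [(hfl σ).map_eq] at this
    exact this.symm
  have e2 : ∫ p : Fin n → unitInterval, flipMean (entries p) φ =
      ∫ p : Fin n → unitInterval, φ (entries p) := by
    have e3 : ∀ p : Fin n → unitInterval, flipMean (entries p) φ =
        (∑ σ, φ (entries (fl σ p))) / 2 ^ n := by
      intro p
      rw [flipMean_ofFn]
      congr 1
      refine Finset.sum_congr rfl fun σ _ => ?_
      congr 2
      funext i
      cases hσ : σ i <;> simp [fl, hσ, unitInterval.coe_symm_eq]
    simp only [e3]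
    have e4 : ∀ σ ∈ Finset.univ, Integrable fun p : Fin n → unitInterval => φ (entries (fl σ p)) :=
      fun σ _ => (hfl σ).integrable_comp_of_integrable hint
    rw [integral_div, integral_finsetSum _ e4]
    simp only [e1]
    simp
  rw [← e2]
  refine integral_mono_of_nonneg (ae_of_all _ fun p => ?_) hψ
    (ae_of_all _ fun p => h _ (isProb_entries p))
  have : flipMean (entries p) (fun _ => 0) ≤ flipMean (entries p) φ :=
    flipMean_mono fun l hl => hφ0 l (hl.isProb (isProb_entries p))
  rwa [flipMean_const] at this

theorem prod_take_drop_ofFn {n : ℕ} (f : Fin n → ℝ) (j h : ℕ) :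
    (((List.ofFn f).drop j).take h).prod =
      ∏ i : Fin n, if j ≤ i ∧ (i : ℕ) < j + h then f i else 1 := by
  induction n generalizing j h with
  | zero => simp
  | succ n ih =>
    rw [List.ofFn_succ, Fin.prod_univ_succ]
    cases j with
    | zero =>
      cases h with
      | zero => simp
      | succ h =>
        have := ih (fun i => f i.succ) 0 h
        simp only [List.drop_zero] at this
        simp only [List.drop_zero, List.take_succ_cons, List.prod_cons, this]
        simp
    | succ j =>
      rw [List.drop_succ_cons, ih]
      rw [if_neg (by simp), one_mul]
      refine Finset.prod_congr rfl fun i _ => ?_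
      have : (j ≤ (i : ℕ) ∧ (i : ℕ) < j + h) ↔
          (j + 1 ≤ (i.succ : ℕ) ∧ (i.succ : ℕ) < j + 1 + h) := by
        rw [Fin.val_succ]; omega
      simp only [this]

/-- By independence the `h` factors of the window integrate separately; entries outside contribute
1. -/
theorem integral_prod_window {n : ℕ} (g : ℝ → ℝ) (j h : ℕ) (hjh : j + h ≤ n) :
    ∫ p : Fin n → unitInterval, ((((entries p).drop j).take h).map g).prod =
      (∫ x : unitInterval, g x) ^ h := by
  set G : Fin n → unitInterval → ℝ := fun i x => if j ≤ i ∧ (i : ℕ) < j + h then g x else 1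
  have e1 : ∀ p : Fin n → unitInterval,
      ((((entries p).drop j).take h).map g).prod = ∏ i, G i (p i) := by
    intro p
    rw [List.map_take, List.map_drop, List.map_ofFn, prod_take_drop_ofFn]
    rfl
  simp only [e1]
  rw [integral_fintype_prod_volume_eq_prod]
  have e2 : ∀ i : Fin n, ∫ x, G i x =
      if j ≤ i ∧ (i : ℕ) < j + h then ∫ x : unitInterval, g x else 1 := by
    intro i
    by_cases hi : j ≤ i ∧ (i : ℕ) < j + h <;> simp [G, hi]
  simp only [e2]
  rw [← prod_take_drop_ofFn (fun _ => ∫ x : unitInterval, g x)]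
  simp only [List.ofFn_const, List.drop_replicate, List.take_replicate, List.prod_replicate]
  congr 1; omega

theorem integrable_prod_window {n : ℕ} {g : ℝ → ℝ} (hg : Measurable g) {b : ℝ}
    (hb : ∀ x, 0 ≤ x → x ≤ 1 → 0 ≤ g x ∧ g x ≤ b) (j h : ℕ) :
    Integrable fun p : Fin n → unitInterval => ((((entries p).drop j).take h).map g).prod := by
  set G : Fin n → unitInterval → ℝ := fun i x => if j ≤ i ∧ (i : ℕ) < j + h then g x else 1
  have e1 : ∀ p : Fin n → unitInterval,
      ((((entries p).drop j).take h).map g).prod = ∏ i, G i (p i) := by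
    intro p
    rw [List.map_take, List.map_drop, List.map_ofFn, prod_take_drop_ofFn]
    rfl
  simp only [e1]
  refine Integrable.fintype_prod (f := G) (μ := fun _ => volume) fun i => ?_
  by_cases hi : j ≤ i ∧ (i : ℕ) < j + h
  · simp only [G, hi, and_self, if_true]
    refine Integrable.of_bound (hg.comp measurable_subtype_coe).aestronglyMeasurable b
      (ae_of_all _ fun x => ?_)
    have := hb x x.2.1 x.2.2
    rw [Real.norm_eq_abs, abs_of_nonneg this.1]
    exact this.2
  · simp only [G, hi, if_false]
    exact integrable_const _

/-! ### Moments of a single entry -/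

theorem integral_unitInterval (g : ℝ → ℝ) :
    ∫ x : unitInterval, g x = ∫ x in (0 : ℝ)..1, g x := by
  rw [intervalIntegral.integral_of_le zero_le_one, ← integral_Icc_eq_integral_Ioc]
  exact integral_subtype measurableSet_Icc g

/-- A lower bound for the probability that a bit with mean `p` fits its symbol. -/
noncomputable def confidence (p : ℝ) : ℝ :=
  if 4 / 5 ≤ p then p else if p ≤ 1 / 5 then 1 - p else 1

theorem confidence_pos (p : ℝ) : 0 < confidence p := by
  unfold confidence; split_ifs <;> linarith

/-- A piecewise linear upper bound for the inverse of `confidence` on the unit interval. -/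
noncomputable def confidenceInvBound (p : ℝ) : ℝ :=
  if 4 / 5 ≤ p then 9 / 4 - 5 / 4 * p else if p ≤ 1 / 5 then 1 + 5 / 4 * p else 1

/-- On `[4 / 5, 1]` the bound is the chord of the convex function `1 / p`; on `[0, 1 / 5]` it is the
mirror image. -/
theorem confidence_inv_le {p : ℝ} (h0 : 0 ≤ p) (h1 : p ≤ 1) :
    1 ≤ confidence p * confidenceInvBound p := by
  unfold confidence confidenceInvBound; split_ifs <;> nlinarith

theorem confidenceInvBound_mem {p : ℝ} (h0 : 0 ≤ p) (h1 : p ≤ 1) :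
    0 ≤ confidenceInvBound p ∧ confidenceInvBound p ≤ 2 := by
  unfold confidenceInvBound; split_ifs <;> constructor <;> linarith

theorem measurable_confidenceInvBound : Measurable confidenceInvBound :=
  Measurable.ite measurableSet_Ici (by fun_prop)
    (Measurable.ite measurableSet_Iic (by fun_prop) measurable_const)

theorem measurable_symbolWeight : Measurable symbolWeight :=
  Measurable.ite (measurableSet_Ici.union measurableSet_Iic) measurable_const measurable_const

theorem integral_piecewise {g g1 g2 g3 : ℝ → ℝ} {x : ℝ} (hx : 0 ≤ x) (hx' : x ≤ 1 / 2)
    (h1 : Set.EqOn g g1 (Set.Ioo 0 x)) (h2 : Set.EqOn g g2 (Set.Ioo x (1 - x)))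
    (h3 : Set.EqOn g g3 (Set.Ioo (1 - x) 1)) (c1 : Continuous g1) (c2 : Continuous g2)
    (c3 : Continuous g3) :
    ∫ y in (0 : ℝ)..1, g y = (∫ y in (0 : ℝ)..x, g1 y) + (∫ y in x..(1 - x), g2 y) +
      ∫ y in (1 - x)..1, g3 y := by
  have i1 : IntervalIntegrable g volume 0 x :=
    (c1.intervalIntegrable 0 x).congr_uIoo (by rw [Set.uIoo_of_le hx]; exact h1.symm)
  have i2 : IntervalIntegrable g volume x (1 - x) :=
    (c2.intervalIntegrable _ _).congr_uIoo (by
      rw [Set.uIoo_of_le (by linarith)]; exact h2.symm)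
  have i3 : IntervalIntegrable g volume (1 - x) 1 :=
    (c3.intervalIntegrable _ _).congr_uIoo (by
      rw [Set.uIoo_of_le (by linarith)]; exact h3.symm)
  rw [← intervalIntegral.integral_add_adjacent_intervals (i1.trans i2) i3,
    ← intervalIntegral.integral_add_adjacent_intervals i1 i2,
    intervalIntegral.integral_congr_Ioo_of_le hx h1,
    intervalIntegral.integral_congr_Ioo_of_le (by linarith) h2,
    intervalIntegral.integral_congr_Ioo_of_le (by linarith) h3]

/-- The weight is 1/2 on a set of measure 0.38 and 1 elsewhere. -/
theorem integral_symbolWeight : ∫ x : unitInterval, symbolWeight x = 81 / 100 := by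
  rw [integral_unitInterval, integral_piecewise (x := 19 / 100) (g1 := fun _ => 1 / 2)
    (g2 := fun _ => 1) (g3 := fun _ => 1 / 2) (by norm_num) (by norm_num) _ _ _ (by fun_prop)
    (by fun_prop) (by fun_prop)]
  · simp; norm_num
  · intro y hy
    simp only [symbolWeight]; rw [if_pos (.inr hy.2.le)]
  · intro y hy
    simp only [symbolWeight]; rw [if_neg]
    have := hy.1; have := hy.2
    rintro (h | h) <;> linarith
  · intro y hy
    have := hy.1
    simp only [symbolWeight]; rw [if_pos (.inl (by linarith))]

/-- The excess over 1 consists of two triangles of base 1/5 and height 1/4. -/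
theorem integral_confidenceInvBound : ∫ x : unitInterval, confidenceInvBound x = 21 / 20 := by
  rw [integral_unitInterval, integral_piecewise (x := 1 / 5) (g1 := fun y => 1 + 5 / 4 * y)
    (g2 := fun _ => 1) (g3 := fun y => 9 / 4 - 5 / 4 * y) (by norm_num) (by norm_num) _ _ _
    (by fun_prop) (by fun_prop) (by fun_prop)]
  · rw [intervalIntegral.integral_add (by simp) (by
      exact (Continuous.intervalIntegrable (by fun_prop) _ _)),
      intervalIntegral.integral_sub (by simp) (by
      exact (Continuous.intervalIntegrable (by fun_prop) _ _))]
    have key : ∀ a b : ℝ, ∫ y in a..b, 5 / 4 * y = 5 / 4 * ((b ^ 2 - a ^ 2) / 2) := by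
      intro a b
      rw [intervalIntegral.integral_const_mul, integral_id]
    rw [key, key]
    simp only [intervalIntegral.integral_const]
    norm_num
  · intro y hy
    have := hy.2
    simp only [confidenceInvBound]; rw [if_neg (by linarith), if_pos this.le]
  · intro y hy
    have := hy.1; have := hy.2
    simp only [confidenceInvBound]; rw [if_neg (by linarith), if_neg (by linarith)]
  · intro y hy
    have := hy.1
    simp only [confidenceInvBound]; rw [if_pos (by linarith)]

/-! ### Random strings are good -/

/-- The windows of length `h` of the string `S` fit their own pattern with large probability and
do not fit the pattern of a different place. -/
structure Good (δ : ℝ) (h : ℕ) (S : List ℝ) : Prop where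
  le_confidence : ∀ j, j + h ≤ S.length →
    (94 / 100 : ℝ) ^ h ≤ (((S.drop j).take h).map confidence).prod
  matchProb_le : ∀ j c, j + h ≤ S.length → (j < c ∨ c + h < j) →
    matchProb δ (S.drop c) (((S.drop j).take h).map symbol) ≤ (82 / 100 : ℝ) ^ h

/-- Averaged over reflections, each symbol of the window costs its `symbolWeight`, unless the text
starts before the pattern and deletions close the gap. In that case the gap exceeds `h`, so the
extra term is at most `(4 * δ) ^ h`. -/
theorem integral_matchProb_le {δ : ℝ} (h0 : 0 ≤ δ) (h1 : δ ≤ 1 / 10 ^ 7) {n h j c : ℕ}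
    (hj : j + h ≤ n) (hc : j < c ∨ c + h < j) :
    ∫ p : Fin n → unitInterval,
      matchProb δ ((entries p).drop c) ((((entries p).drop j).take h).map symbol) ≤
        2 * (81 / 100) ^ h := by
  have hδ1 : δ ≤ 1 := h1.trans (by norm_num)
  have hpw : (4 * δ) ^ h ≤ (81 / 100 : ℝ) ^ h :=
    pow_le_pow_left₀ (by positivity) (h1.trans (by norm_num) |> fun h : δ ≤ 1 / 5 => by linarith) h
  have hint := integrable_prod_window (n := n) measurable_symbolWeight (b := 1)
    (fun x _ _ => ⟨symbolWeight_nonneg x, symbolWeight_le_one x⟩) j h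
  have hval : ∫ p : Fin n → unitInterval,
      (((((entries p).drop j).take h).map symbolWeight).prod + (4 * δ) ^ h) =
        (81 / 100) ^ h + (4 * δ) ^ h := by
    rw [integral_add hint (integrable_const _), integral_prod_window _ _ _ hj,
      integral_symbolWeight]
    simp
  refine (integral_entries_le
    (fun S => matchProb δ (S.drop c) (((S.drop j).take h).map symbol))
    (fun S => (((S.drop j).take h).map symbolWeight).prod + (4 * δ) ^ h)
    (measurable_matchProb_entries δ n j h c)
    (fun l hl => matchProb_nonneg h0 hδ1 (hl.drop c) _)
    (fun l hl => matchProb_le_one h0 hδ1 (hl.drop c) _)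
    (hint.add (integrable_const _)) ?_).trans (by rw [hval]; linarith)
  intro l hl
  rcases hc with hc | hc
  · obtain ⟨e, rfl⟩ : ∃ e, c = j + (e + 1) := ⟨c - j - 1, by omega⟩
    have := flipMean_drop l j fun l => matchProb δ (l.drop (e + 1)) ((l.take h).map symbol)
    simp only [List.drop_drop] at this
    rw [this]
    have := flipMean_matchProb_behind_le h0 hδ1 (l.drop j) e h
    have : 0 ≤ (4 * δ) ^ h := by positivity
    linarith
  · obtain ⟨e, rfl⟩ : ∃ e, j = c + e := ⟨j - c, by omega⟩
    have := flipMean_drop l c fun l => matchProb δ l (((l.drop e).take h).map symbol)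
    simp only [List.drop_drop] at this
    rw [this]
    have a1 := flipMean_matchProb_before_le h0 hδ1 (hl.drop c) e h
    rw [List.drop_drop] at a1
    have a2 : (2 * δ) ^ e * 2 ^ h ≤ (4 * δ) ^ h := by
      have : (2 * δ) ^ e ≤ (2 * δ) ^ h :=
        pow_le_pow_of_le_one (by positivity) (h1.trans (by norm_num) |>
          fun h : δ ≤ 1 / 5 => by linarith) (by omega)
      calc (2 * δ) ^ e * 2 ^ h ≤ (2 * δ) ^ h * 2 ^ h := by gcongr
        _ = (4 * δ) ^ h := by rw [← mul_pow]; ring_nf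
    linarith

theorem volume_le_of_integral {n : ℕ} {f : (Fin n → unitInterval) → ℝ} {x m : ℝ} (hx : 0 < x)
    (hf0 : ∀ p, 0 ≤ f p) (hf : Integrable f) (hm : ∫ p, f p ≤ x * m) :
    volume {p | x ≤ f p} ≤ ENNReal.ofReal m := by
  have := mul_meas_ge_le_integral_of_nonneg (ae_of_all _ hf0) hf x
  rw [← ofReal_measureReal]
  refine ENNReal.ofReal_le_ofReal ?_
  exact le_of_mul_le_mul_left (this.trans hm) hx

/-- Markov's inequality and a union bound over places. Foreign matches have mean at most `2 * (81 /
100) ^ h`, against the threshold `(82 / 100) ^ h`; the inverse of the product of confidences has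
mean at most `(21 / 20) ^ h`, against `(100 / 94) ^ h`. Both quotients of bases are at most 99/100.
-/
theorem volume_not_good_le {δ : ℝ} (h0 : 0 ≤ δ) (h1 : δ ≤ 1 / 10 ^ 7) (n h : ℕ) :
    volume {p : Fin n → unitInterval | ¬ Good δ h (entries p)} ≤
      ENNReal.ofReal (3 * (n + 1) ^ 2 * (99 / 100) ^ h) := by
  have hδ1 : δ ≤ 1 := h1.trans (by norm_num)
  set A : ℕ → Set (Fin n → unitInterval) := fun j =>
    {p | j + h ≤ n ∧ (((entries p).drop j).take h |>.map confidence).prod < (94 / 100) ^ h} with hA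
  set B : ℕ × ℕ → Set (Fin n → unitInterval) := fun x =>
    {p | (x.1 + h ≤ n ∧ (x.1 < x.2 ∨ x.2 + h < x.1)) ∧ (82 / 100) ^ h ≤
      matchProb δ ((entries p).drop x.2) ((((entries p).drop x.1).take h).map symbol)} with hB
  have hsub : {p : Fin n → unitInterval | ¬ Good δ h (entries p)} ⊆
      (⋃ j ∈ Finset.range (n + 1), A j) ∪
        ⋃ x ∈ Finset.range (n + 1) ×ˢ Finset.range (n + 1), B x := by
    intro p hp
    by_contra hcon
    simp only [Set.mem_union, Set.mem_iUnion, not_or, not_exists] at hcon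
    obtain ⟨c1, c2⟩ := hcon
    refine hp ⟨fun j hj => ?_, fun j c hj hc => ?_⟩
    · have hjn : j + h ≤ n := by simpa using hj
      by_contra hlt
      exact c1 j (Finset.mem_range.2 (by omega)) ⟨hjn, not_le.1 hlt⟩
    · have hjn : j + h ≤ n := by simpa using hj
      have hcn : c ≤ n ∨ n < c := le_or_gt c n
      by_contra hlt
      have key : ∀ c', c' ≤ n → (j < c' ∨ c' + h < j) → ¬ ((82 / 100 : ℝ) ^ h <
          matchProb δ ((entries p).drop c') ((((entries p).drop j).take h).map symbol)) :=
        fun c' h1 h2 h3 => c2 (j, c') (Finset.mem_product.2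
          ⟨Finset.mem_range.2 (by simp; omega), Finset.mem_range.2 (by simp; omega)⟩)
            ⟨⟨hjn, h2⟩, h3.le⟩
      rcases hcn with hcn | hcn
      · exact key c hcn hc (not_le.1 hlt)
      -- Beyond `n` the text is empty, just as at `c = n`, so finitely many places suffice. For `h =
      -- 0` the bound is 1.
      · rcases Nat.eq_zero_or_pos h with rfl | hpos
        · simp [matchProb_nil] at hlt
        · refine key n le_rfl (.inl (by omega)) ?_
          rw [List.drop_eq_nil_of_le (by simp; omega)] at hlt
          rw [List.drop_eq_nil_of_le (by simp)]
          exact not_le.1 hlt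
  have hAle : ∀ j, volume (A j) ≤ ENNReal.ofReal ((99 / 100) ^ h) := by
    intro j
    by_cases hj : j + h ≤ n
    · have hle : A j ⊆ {p | (100 / 94 : ℝ) ^ h ≤
          ((((entries p).drop j).take h).map confidenceInvBound).prod} := by
        intro p hp
        have hlt := hp.2
        have key : ∀ l : List ℝ, IsProb l →
            1 ≤ (l.map confidence).prod * (l.map confidenceInvBound).prod := by
          intro l hl
          induction l with
          | nil => simp
          | cons q l ih =>
            simp only [List.map_cons, List.prod_cons]
            have := one_le_mul_of_one_le_of_one_le (confidence_inv_le hl.head.1 hl.head.2)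
              (ih hl.tail)
            linarith
        have k1 := key _ (((isProb_entries p).drop j).take h)
        simp only [Set.mem_ofPred_eq]
        set u := ((((entries p).drop j).take h).map confidence).prod
        set v := ((((entries p).drop j).take h).map confidenceInvBound).prod
        have hu : 0 < u := List.prod_pos (by
          simp only [List.mem_map]; rintro _ ⟨x, -, rfl⟩; exact confidence_pos x)
        have hv : 0 < v := by
          by_contra hv
          have := mul_nonpos_of_nonneg_of_nonpos hu.le (not_lt.1 hv)
          linarith
        have k2 : (100 / 94 : ℝ) ^ h * (94 / 100) ^ h = 1 := by
          rw [← mul_pow]; norm_num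
        have k3 : (100 / 94 : ℝ) ^ h * u ≤ 1 := by
          rw [← k2]; gcongr
        calc (100 / 94 : ℝ) ^ h ≤ (100 / 94 : ℝ) ^ h * (u * v) :=
              le_mul_of_one_le_right (by positivity) k1
          _ = ((100 / 94 : ℝ) ^ h * u) * v := by ring
          _ ≤ v := mul_le_of_le_one_left hv.le k3
      refine (measure_mono hle).trans (volume_le_of_integral (by positivity) ?_
        (integrable_prod_window measurable_confidenceInvBound
          (fun x hx hx' => confidenceInvBound_mem hx hx') j h) ?_)
      · intro p
        refine List.prod_nonneg ?_
        simp only [List.mem_map]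
        rintro _ ⟨x, hx, rfl⟩
        have := ((isProb_entries p).drop j).take h x hx
        exact (confidenceInvBound_mem this.1 this.2).1
      · rw [integral_prod_window _ _ _ hj, integral_confidenceInvBound, ← mul_pow]
        gcongr; norm_num
    · have : A j = ∅ := Set.eq_empty_of_forall_notMem fun p hp => hj hp.1
      rw [this]; simp
  have hBle : ∀ x, volume (B x) ≤ ENNReal.ofReal (2 * (99 / 100) ^ h) := by
    rintro ⟨j, c⟩
    by_cases hjc : j + h ≤ n ∧ (j < c ∨ c + h < j)
    · refine (measure_mono (t := {p | (82 / 100 : ℝ) ^ h ≤ matchProb δ ((entries p).drop c)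
        ((((entries p).drop j).take h).map symbol)}) fun p hp => hp.2).trans
        (volume_le_of_integral (by positivity) ?_ ?_ ?_)
      · exact fun p => matchProb_nonneg h0 hδ1 ((isProb_entries p).drop c) _
      · refine Integrable.of_bound (measurable_matchProb_entries δ n j h c).aestronglyMeasurable 1
          (ae_of_all _ fun p => ?_)
        rw [Real.norm_eq_abs, abs_of_nonneg (matchProb_nonneg h0 hδ1 ((isProb_entries p).drop c) _)]
        exact matchProb_le_one h0 hδ1 ((isProb_entries p).drop c) _
      · refine (integral_matchProb_le h0 h1 hjc.1 hjc.2).trans ?_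
        have : (81 / 100 : ℝ) ^ h ≤ (82 / 100) ^ h * (99 / 100) ^ h := by
          rw [← mul_pow]; gcongr; norm_num
        linarith
    · have : B (j, c) = ∅ := Set.eq_empty_of_forall_notMem fun p hp => hjc hp.1
      rw [this]; simp
  refine (measure_mono hsub).trans ((measure_union_le _ _).trans ?_)
  have s1 : volume (⋃ j ∈ Finset.range (n + 1), A j) ≤
      ENNReal.ofReal ((n + 1) * (99 / 100) ^ h) := by
    refine (measure_biUnion_finset_le _ _).trans ((Finset.sum_le_sum fun j _ => hAle j).trans ?_)
    rw [Finset.sum_const, Finset.card_range, ← ENNReal.ofReal_nsmul]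
    simp
  have s2 : volume (⋃ x ∈ Finset.range (n + 1) ×ˢ Finset.range (n + 1), B x) ≤
      ENNReal.ofReal ((n + 1) ^ 2 * (2 * (99 / 100) ^ h)) := by
    refine (measure_biUnion_finset_le _ _).trans ((Finset.sum_le_sum fun j _ => hBle j).trans ?_)
    rw [Finset.sum_const, Finset.card_product, Finset.card_range, ← ENNReal.ofReal_nsmul]
    simp [sq]
  refine (add_le_add s1 s2).trans ?_
  rw [← ENNReal.ofReal_add (by positivity) (by positivity)]
  refine ENNReal.ofReal_le_ofReal ?_
  have : (0 : ℝ) ≤ (99 / 100) ^ h := by positivity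
  nlinarith [mul_nonneg (mul_nonneg (Nat.cast_nonneg (α := ℝ) n) (by positivity : (0:ℝ) ≤ n + 1)) this]

/-- Reversing the coordinates preserves the uniform law. Goodness of the reversed string is what
controls anchors. -/
theorem volume_not_good_reverse_le {δ : ℝ} (h0 : 0 ≤ δ) (h1 : δ ≤ 1 / 10 ^ 7) (n h : ℕ) :
    volume {p : Fin n → unitInterval | ¬ Good δ h (entries p).reverse} ≤
      ENNReal.ofReal (3 * (n + 1) ^ 2 * (99 / 100) ^ h) := by
  have hmp := volume_measurePreserving_piCongrLeft (fun _ : Fin n => unitInterval) Fin.revPerm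
  have e : {p : Fin n → unitInterval | ¬ Good δ h (entries p).reverse} =
      (MeasurableEquiv.piCongrLeft (fun _ : Fin n => unitInterval) Fin.revPerm) ⁻¹'
        {p | ¬ Good δ h (entries p)} := by
    ext p
    have : entries ((MeasurableEquiv.piCongrLeft (fun _ : Fin n => unitInterval) Fin.revPerm) p) =
        (entries p).reverse := by
      refine List.ext_getElem (by simp) fun i h1 h2 => ?_
      simp only [List.getElem_ofFn, List.getElem_reverse, List.length_ofFn]
      congr 1
      have := MeasurableEquiv.piCongrLeft_apply_apply (β := fun _ => unitInterval) Fin.revPerm p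
        (Fin.rev ⟨i, by simpa using h1⟩)
      rw [Fin.revPerm_apply, Fin.rev_rev] at this
      rw [this]
      congr 1
      ext
      simp only [Fin.val_rev]
      omega
    simp only [Set.mem_ofPred_eq, Set.mem_preimage, this]
  rw [e, hmp.measure_preimage_equiv]
  exact volume_not_good_le h0 h1 n h

/-! ### The statistics of the algorithm and their means -/

/-- What has to precede bit number `i`: exactly `i` bits if `i < h`, otherwise bits that fit the
pattern `A`, which is read backwards. -/
noncomputable def anchor (h i : ℕ) (A : List ℕ) (T : List Bool) : ℝ :=
  if i < h then (if T.length = i then 1 else 0) else matchInd A T.reverse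

theorem anchor_nonneg (h i : ℕ) (A : List ℕ) (T : List Bool) : 0 ≤ anchor h i A T := by
  unfold anchor
  split_ifs <;> first | exact matchInd_nonneg _ _ | norm_num

theorem anchor_le_one (h i : ℕ) (A : List ℕ) (T : List Bool) : anchor h i A T ≤ 1 := by
  unfold anchor
  split_ifs <;> first | exact matchInd_le_one _ _ | norm_num

/-- The number of places between the anchor and an occurrence of the pattern `B`. -/
noncomputable def hits (h i : ℕ) (A B : List ℕ) : List Bool → ℝ :=
  splitSum (anchor h i A) (fun _ => 1) (matchInd B)

/-- The number of such places that hold the bit `1`. -/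
noncomputable def ones (h i : ℕ) (A B : List ℕ) : List Bool → ℝ :=
  splitSum (anchor h i A) (fun b => if b then 1 else 0) (matchInd B)

/-- The number of pairs of an anchor and an occurrence of `B` that are too far apart. -/
noncomputable def stretches (n h i : ℕ) (A B : List ℕ) (T : List Bool) : ℝ :=
  ∑ d ∈ Finset.range n, splitSum (anchor h i A) (fun _ => 1) (fun U => matchInd (2 :: B) (U.drop d)) T

theorem splitSum_mem {α : List Bool → ℝ} {β : Bool → ℝ} {γ : List Bool → ℝ}
    (hα : ∀ T, 0 ≤ α T ∧ α T ≤ 1) (hβ : ∀ b, 0 ≤ β b ∧ β b ≤ 1) (hγ : ∀ T, 0 ≤ γ T ∧ γ T ≤ 1)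
    {n : ℕ} {T : List Bool} (hT : T.length ≤ n) :
    0 ≤ splitSum α β γ T ∧ splitSum α β γ T ≤ n := by
  constructor
  · exact Finset.sum_nonneg fun y _ => mul_nonneg (mul_nonneg (hα _).1 (hβ _).1) (hγ _).1
  · calc splitSum α β γ T ≤ ∑ y ∈ Finset.range T.length, (1 : ℝ) :=
          Finset.sum_le_sum fun y _ =>
            mul_le_one₀ (mul_le_one₀ (hα _).2 (hβ _).1 (hβ _).2) (hγ _).1 (hγ _).2
      _ ≤ n := by simpa using hT

theorem hits_mem (h i : ℕ) (A B : List ℕ) {n : ℕ} {T : List Bool} (hT : T.length ≤ n) :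
    0 ≤ hits h i A B T ∧ hits h i A B T ≤ n :=
  splitSum_mem (fun _ => ⟨anchor_nonneg _ _ _ _, anchor_le_one _ _ _ _⟩) (fun _ => by norm_num)
    (fun _ => ⟨matchInd_nonneg _ _, matchInd_le_one _ _⟩) hT

theorem ones_mem (h i : ℕ) (A B : List ℕ) {n : ℕ} {T : List Bool} (hT : T.length ≤ n) :
    0 ≤ ones h i A B T ∧ ones h i A B T ≤ n :=
  splitSum_mem (fun _ => ⟨anchor_nonneg _ _ _ _, anchor_le_one _ _ _ _⟩)
    (fun b => by cases b <;> norm_num)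
    (fun _ => ⟨matchInd_nonneg _ _, matchInd_le_one _ _⟩) hT

theorem stretches_mem (h i : ℕ) (A B : List ℕ) {n : ℕ} {T : List Bool} (hT : T.length ≤ n) :
    0 ≤ stretches n h i A B T ∧ stretches n h i A B T ≤ (n : ℝ) ^ 2 := by
  have key := fun d => splitSum_mem (α := anchor h i A) (β := fun _ => 1)
    (γ := fun U => matchInd (2 :: B) (U.drop d))
    (fun _ => ⟨anchor_nonneg _ _ _ _, anchor_le_one _ _ _ _⟩) (fun _ => by norm_num)
    (fun _ => ⟨matchInd_nonneg _ _, matchInd_le_one _ _⟩) hT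
  constructor
  · exact Finset.sum_nonneg fun d _ => (key d).1
  · calc stretches n h i A B T ≤ ∑ d ∈ Finset.range n, (n : ℝ) :=
          Finset.sum_le_sum fun d _ => (key d).2
      _ = (n : ℝ) ^ 2 := by simp [sq]

/-- The pattern `A` is compatible with the entries that precede entry `i`, read backwards. -/
structure Compatible (h i : ℕ) (S : List ℝ) (A : List ℕ) : Prop where
  confidence_le : List.Forall₂ (fun p s => confidence p ≤ fitProb p s)
    ((S.take i).reverse.take h) A
  le_symbol : List.Forall₂ (fun s p => s = symbol p ∨ 2 ≤ symbol p)
    A ((S.take i).reverse.take h)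

/-! ### Means of the statistics over one trace -/

section means

variable {δ : ℝ}

/-- The probability that the trace of the first `c` entries is an anchor. -/
noncomputable def anchorProb (δ : ℝ) (h i : ℕ) (S : List ℝ) (A : List ℕ) (c : ℕ) : ℝ :=
  traceMean δ (S.take c) (anchor h i A)

theorem confidence_le_fitProb_symbol (p : ℝ) :
    confidence p ≤ fitProb p (symbol p) := by
  unfold confidence symbol
  by_cases a : 81 / 100 ≤ p
  · rw [if_pos a, if_pos (by linarith), fitProb_one]
  · rw [if_neg a]
    by_cases b : p ≤ 19 / 100
    · rw [if_pos b, fitProb_zero, if_neg (by linarith), if_pos (by linarith)]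
    · rw [if_neg b, fitProb_of_two_le _ le_rfl]
      split_ifs <;> linarith

/-- Seen backwards, the text starts at `S.length - c`, while the pattern belongs to the place
`S.length - i`; so `Good` for the reversed string applies. -/
theorem anchorProb_of_le {h i : ℕ} (hi : h ≤ i) (S : List ℝ) (A : List ℕ) (c : ℕ) :
    anchorProb δ h i S A c = matchProb δ (S.reverse.drop (S.length - c)) A := by
  have e : anchor h i A = fun T => matchInd A T.reverse := by
    funext T; rw [anchor, if_neg (not_lt.2 hi)]
  rw [anchorProb, e, ← traceMean_reverse, traceMean_matchInd, List.reverse_take]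

theorem anchorProb_of_lt {h i : ℕ} (hi : i < h) (S : List ℝ) (A : List ℕ) (c : ℕ) :
    anchorProb δ h i S A c =
      traceMean δ (S.take c) (fun T => if T.length = i then 1 else 0) := by
  have e : anchor h i A = fun T => if T.length = i then 1 else 0 := by
    funext T; rw [anchor, if_pos hi]
  rw [anchorProb, e]

/-- For `i < h` it is enough that the first `i` entries survive. Otherwise it is enough that the `h`
entries before `i` survive and fit `A`, each with probability at least its confidence. -/
theorem le_anchorProb (h0 : 0 ≤ δ) (h1 : δ ≤ 1) {S : List ℝ} (hS : IsProb S) {h i : ℕ}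
    (hi : i < S.length) (hgood : Good δ h S.reverse) {A : List ℕ}
    (hA : h ≤ i → Compatible h i S A) :
    (1 - δ) ^ h * (94 / 100) ^ h ≤ anchorProb δ h i S A i := by
  rcases lt_or_ge i h with hih | hih
  · rw [anchorProb_of_lt hih]
    have a1 := le_traceMean_length h1 (hS.take i)
    have hl : (S.take i).length = i := by simp; omega
    rw [hl] at a1
    refine le_trans ?_ a1
    calc (1 - δ) ^ h * (94 / 100) ^ h ≤ (1 - δ) ^ h * 1 := by
          refine mul_le_mul_of_nonneg_left (pow_le_one₀ (by norm_num) (by norm_num))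
            (pow_nonneg (by linarith) _)
      _ ≤ (1 - δ) ^ i := by
          rw [mul_one]; exact pow_le_pow_of_le_one (by linarith) (by linarith) hih.le
  · rw [anchorProb_of_le hih]
    have hA := hA hih
    have e : (S.take i).reverse = S.reverse.drop (S.length - i) := List.reverse_take
    have hlen : A.length = h := by
      rw [← hA.confidence_le.length_eq]; simp; omega
    have a1 := le_matchProb h0 h1 (hS.reverse.drop (S.length - i)) (P := A) (g := confidence)
      (fun p => (confidence_pos p).le) (by rw [hlen, ← e]; exact hA.confidence_le)
    rw [hlen] at a1
    refine le_trans ?_ a1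
    refine mul_le_mul_of_nonneg_left (hgood.le_confidence _ ?_) (pow_nonneg (by linarith) _)
    simp; omega

/-- The pattern `A` demands at least what the true symbols demand, so goodness bounds it. For `i <
h`, a place `c < i` leaves too few bits and `c > i + h` needs more than `h` deletions. Places `i < c
≤ i + h` are not covered: they are left to the test on `stretches`. -/
theorem anchorProb_le (h0 : 0 ≤ δ) (h1 : δ ≤ 1 / 10 ^ 7) {S : List ℝ} (hS : IsProb S) {h i : ℕ}
    (hi : i < S.length) (hgood : Good δ h S.reverse) {A : List ℕ}
    (hA : h ≤ i → Compatible h i S A) {c : ℕ} (hc : c < S.length) (hci : c < i ∨ i + h < c) :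
    anchorProb δ h i S A c ≤ (82 / 100) ^ h := by
  have hδ1 : δ ≤ 1 := h1.trans (by norm_num)
  have hδ5 : δ ≤ 1 / 5 := h1.trans (by norm_num)
  rcases lt_or_ge i h with hih | hih
  · rw [anchorProb_of_lt hih]
    have hl : (S.take c).length = c := by simp; omega
    rcases hci with hci | hci
    · rw [traceMean_length_eq_zero _ _ (by omega)]; positivity
    · refine (traceMean_length_le h0 hδ1 _ i (by omega)).trans ?_
      rw [hl]
      calc (2 * δ) ^ (c - i) * 2 ^ i ≤ (2 * δ) ^ h * 2 ^ h := by
            refine mul_le_mul (pow_le_pow_of_le_one (by positivity) (by linarith) (by omega))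
              (pow_le_pow_right₀ (by norm_num) hih.le) (by positivity) (by positivity)
        _ = (4 * δ) ^ h := by rw [← mul_pow]; ring_nf
        _ ≤ (82 / 100) ^ h := pow_le_pow_left₀ (by positivity) (by linarith) h
  · rw [anchorProb_of_le hih]
    have hA := hA hih
    refine (matchProb_mono h0 hδ1 (hS.reverse.drop _) (P' := (((S.reverse.drop
      (S.length - i)).take h).map symbol)) ?_).trans (hgood.matchProb_le _ _ ?_ ?_)
    · rw [List.forall₂_map_right_iff, ← List.reverse_take]
      exact hA.le_symbol
    · simp; omega
    · omega

theorem anchorProb_nonneg (h0 : 0 ≤ δ) (h1 : δ ≤ 1) {S : List ℝ} (hS : IsProb S) (h i : ℕ)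
    (A : List ℕ) (c : ℕ) : 0 ≤ anchorProb δ h i S A c :=
  traceMean_nonneg h0 h1 (hS.take c) (anchor_nonneg h i A)

theorem anchorProb_le_one (h0 : 0 ≤ δ) (h1 : δ ≤ 1) {S : List ℝ} (hS : IsProb S) (h i : ℕ)
    (A : List ℕ) (c : ℕ) : anchorProb δ h i S A c ≤ 1 :=
  traceMean_le_one h0 h1 (hS.take c) (anchor_le_one h i A)

theorem traceMean_hits (S : List ℝ) (h i : ℕ) (A B : List ℕ) :
    traceMean δ S (hits h i A B) = ∑ c ∈ Finset.range S.length,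
      anchorProb δ h i S A c * (1 - δ) * matchProb δ (S.drop (c + 1)) B := by
  rw [hits, traceMean_splitSum]
  refine Finset.sum_congr rfl fun c _ => ?_
  rw [anchorProb, traceMean_matchInd]; ring

theorem traceMean_ones (S : List ℝ) (h i : ℕ) (A B : List ℕ) :
    traceMean δ S (ones h i A B) = ∑ c ∈ Finset.range S.length,
      S.getD c 0 * (anchorProb δ h i S A c * (1 - δ) * matchProb δ (S.drop (c + 1)) B) := by
  rw [ones, traceMean_splitSum]
  refine Finset.sum_congr rfl fun c _ => ?_
  rw [anchorProb, traceMean_matchInd]; simp; ring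

theorem traceMean_stretches (S : List ℝ) (n h i : ℕ) (A B : List ℕ) :
    traceMean δ S (stretches n h i A B) = ∑ d ∈ Finset.range n, ∑ c ∈ Finset.range S.length,
      anchorProb δ h i S A c * (1 - δ) *
        traceMean δ (S.drop (c + 1)) (fun U => matchInd (2 :: B) (U.drop d)) := by
  have e : stretches n h i A B = fun T => ∑ d ∈ Finset.range n,
    splitSum (anchor h i A) (fun _ => 1) (fun U => matchInd (2 :: B) (U.drop d)) T := rfl
  rw [e, traceMean_sum]
  refine Finset.sum_congr rfl fun d _ => ?_
  rw [traceMean_splitSum]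
  refine Finset.sum_congr rfl fun c _ => ?_
  rw [anchorProb]; ring

theorem matchProb_wildcard_le (h0 : 0 ≤ δ) (h1 : δ ≤ 1) (S : List ℝ) (B : List ℕ) {τ : ℝ}
    (hτ : 0 ≤ τ) (c : ℕ) (h : ∀ c', c < c' → c' ≤ S.length → matchProb δ (S.drop c') B ≤ τ) :
    matchProb δ (S.drop c) (2 :: B) ≤ τ := by
  induction hm : S.length - c generalizing c with
  | zero => rwa [List.drop_eq_nil_of_le (by omega), matchProb]
  | succ m ih =>
    rw [List.drop_eq_getElem_cons (by omega), matchProb, fitProb_of_two_le _ le_rfl, one_mul]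
    have a1 := ih (c + 1) (fun c' hc' => h c' (by omega)) (by omega)
    have a2 := h (c + 1) (Nat.lt_succ_self c) (by omega)
    have := mul_le_mul_of_nonneg_left a1 h0
    have := mul_le_mul_of_nonneg_left a2 (sub_nonneg.2 h1)
    linarith

theorem le_matchProb_wildcard (h0 : 0 ≤ δ) (h1 : δ ≤ 1) {S : List ℝ} (hS : IsProb S) (B : List ℕ)
    {c : ℕ} (hc : c < S.length) :
    (1 - δ) * matchProb δ (S.drop (c + 1)) B ≤ matchProb δ (S.drop c) (2 :: B) := by
  rw [List.drop_eq_getElem_cons hc, matchProb, fitProb_of_two_le _ le_rfl, one_mul]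
  have := mul_nonneg h0 (matchProb_nonneg h0 h1 (hS.drop (c + 1)) (2 :: B))
  linarith

/-- The mean number of stretches is small if `B` does not occur behind its proper place. -/
theorem traceMean_stretches_le (h0 : 0 ≤ δ) (h1 : δ ≤ 1 / 10 ^ 7) {S : List ℝ} (hS : IsProb S)
    {h i : ℕ} (hi : i < S.length) (hgood : Good δ h S.reverse) {A : List ℕ}
    (hA : h ≤ i → Compatible h i S A) (B : List ℕ)
    (hB : ∀ c, i + 1 < c → c ≤ S.length → matchProb δ (S.drop c) B ≤ (82 / 100) ^ h) :
    traceMean δ S (stretches S.length h i A B) ≤ (S.length : ℝ) ^ 2 * (82 / 100) ^ h := by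
  have hδ1 : δ ≤ 1 := h1.trans (by norm_num)
  rw [traceMean_stretches]
  have key : ∀ d ∈ Finset.range S.length, ∀ c ∈ Finset.range S.length,
      anchorProb δ h i S A c * (1 - δ) *
        traceMean δ (S.drop (c + 1)) (fun U => matchInd (2 :: B) (U.drop d)) ≤ (82 / 100) ^ h := by
    intro d _ c hc
    have hc := Finset.mem_range.1 hc
    have b0 := anchorProb_nonneg h0 hδ1 hS h i A c
    have b1 := anchorProb_le_one h0 hδ1 hS h i A c
    have t0 : 0 ≤ traceMean δ (S.drop (c + 1)) (fun U => matchInd (2 :: B) (U.drop d)) :=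
      traceMean_nonneg h0 hδ1 (hS.drop _) fun T => matchInd_nonneg _ _
    have t1 : traceMean δ (S.drop (c + 1)) (fun U => matchInd (2 :: B) (U.drop d)) ≤ 1 :=
      traceMean_le_one h0 hδ1 (hS.drop _) fun T => matchInd_le_one _ _
    have hpos : (0 : ℝ) ≤ (82 / 100) ^ h := by positivity
    have hmul : anchorProb δ h i S A c * (1 - δ) ≤ anchorProb δ h i S A c :=
      mul_le_of_le_one_right b0 (by linarith)
    have hmul0 : 0 ≤ anchorProb δ h i S A c * (1 - δ) := mul_nonneg b0 (by linarith)
    -- Either the anchor is misplaced and rare, or `i ≤ c`; then the wildcard pushes `B` beyond `i +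
    -- 1`, where it is rare.
    by_cases hci : c < i ∨ i + h < c
    · have := anchorProb_le h0 h1 hS hi hgood hA hc hci
      calc _ ≤ anchorProb δ h i S A c * 1 := mul_le_mul hmul t1 t0 b0
        _ ≤ _ := by linarith
    · have : traceMean δ (S.drop (c + 1)) (fun U => matchInd (2 :: B) (U.drop d)) ≤
          (82 / 100) ^ h := by
        refine traceMean_drop_le h0 hδ1 (hS.drop _) d fun c' _ => ?_
        rw [traceMean_matchInd, List.drop_drop]
        exact matchProb_wildcard_le h0 hδ1 S B hpos _ fun c'' hc'' hle =>
          hB c'' (by omega) hle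
      calc _ ≤ 1 * (82 / 100 : ℝ) ^ h := mul_le_mul (hmul.trans b1) this t0 (by norm_num)
        _ = _ := one_mul _
  calc _ ≤ ∑ d ∈ Finset.range S.length, ∑ c ∈ Finset.range S.length, (82 / 100 : ℝ) ^ h :=
        Finset.sum_le_sum fun d hd => Finset.sum_le_sum fun c hc => key d hd c hc
    _ = (S.length : ℝ) ^ 2 * (82 / 100) ^ h := by simp [sq, mul_assoc]

/-- If there are few stretches, then `B` does not occur shortly behind its proper place. -/
theorem matchProb_le_of_stretches (h0 : 0 ≤ δ) (h1 : δ ≤ 1) {S : List ℝ} (hS : IsProb S)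
    {h i c : ℕ} {A B : List ℕ} (hic : i < c) (hc : c < S.length) :
    anchorProb δ h i S A i * (1 - δ) ^ (c - i + 1) * matchProb δ (S.drop (c + 1)) B ≤
      traceMean δ S (stretches S.length h i A B) := by
  -- The number `d` counts the entries strictly between `i` and `c`. One way to produce a stretch is
  -- that the anchor sits at `i`, that all entries from `i` to `c` survive, with `c` under the
  -- wildcard, and that `B` follows.
  obtain ⟨d, rfl⟩ : ∃ d, c = i + 1 + d := ⟨c - i - 1, by omega⟩
  have hδ : 0 ≤ 1 - δ := by linarith
  rw [traceMean_stretches]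
  have hterm : ∀ d c, 0 ≤ anchorProb δ h i S A c * (1 - δ) *
        traceMean δ (S.drop (c + 1)) (fun U => matchInd (2 :: B) (U.drop d)) := fun d c =>
    mul_nonneg (mul_nonneg (anchorProb_nonneg h0 h1 hS h i A c) hδ)
      (traceMean_nonneg h0 h1 (hS.drop _) fun T => matchInd_nonneg _ _)
  refine le_trans ?_ (Finset.single_le_sum (f := fun d => ∑ c ∈ Finset.range S.length,
      anchorProb δ h i S A c * (1 - δ) *
        traceMean δ (S.drop (c + 1)) (fun U => matchInd (2 :: B) (U.drop d)))
      (fun d _ => Finset.sum_nonneg fun c _ => hterm d c)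
      (Finset.mem_range.2 (by omega : d < S.length)))
  refine le_trans ?_ (Finset.single_le_sum (f := fun c =>
      anchorProb δ h i S A c * (1 - δ) *
        traceMean δ (S.drop (c + 1)) (fun U => matchInd (2 :: B) (U.drop d)))
      (fun c _ => hterm d c) (Finset.mem_range.2 (by omega : i < S.length)))
  have a1 := le_traceMean_drop h0 h1 (hS.drop (i + 1)) (matchInd_nonneg (2 :: B)) d
    (by simp; omega)
  rw [traceMean_matchInd, List.drop_drop] at a1
  have a2 := le_matchProb_wildcard h0 h1 hS B hc
  have a3 := mul_le_mul_of_nonneg_left a2 (pow_nonneg hδ d)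
  have a4 := mul_le_mul_of_nonneg_left (a3.trans a1)
    (mul_nonneg (anchorProb_nonneg h0 h1 hS h i A i) hδ)
  refine le_trans (le_of_eq ?_) a4
  rw [show i + 1 + d - i + 1 = d + 1 + 1 by omega, pow_succ, pow_succ]
  ring

theorem le_traceMean_hits (h0 : 0 ≤ δ) (h1 : δ ≤ 1) {S : List ℝ} (hS : IsProb S) {h i : ℕ}
    (A B : List ℕ) (hi : i < S.length) :
    anchorProb δ h i S A i * (1 - δ) * matchProb δ (S.drop (i + 1)) B ≤
      traceMean δ S (hits h i A B) := by
  rw [traceMean_hits]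
  exact Finset.single_le_sum (f := fun c => anchorProb δ h i S A c * (1 - δ) *
    matchProb δ (S.drop (c + 1)) B)
    (fun c _ => mul_nonneg (mul_nonneg (anchorProb_nonneg h0 h1 hS h i A c) (by linarith))
      (matchProb_nonneg h0 h1 (hS.drop _) B)) (Finset.mem_range.2 hi)

/-- Hits whose bit stems from entry `i` contribute ones in exactly the proportion `S.getD i 0`; only
the other places cause an error, at most `x` each. -/
theorem abs_traceMean_ones_sub_le (h0 : 0 ≤ δ) (h1 : δ ≤ 1) {S : List ℝ} (hS : IsProb S) {h i : ℕ}
    (A B : List ℕ) (hi : i < S.length) {x : ℝ} (hx0 : 0 ≤ x)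
    (hx : ∀ c < S.length, c ≠ i →
      anchorProb δ h i S A c * matchProb δ (S.drop (c + 1)) B ≤ x) :
    |traceMean δ S (ones h i A B) - S.getD i 0 * traceMean δ S (hits h i A B)| ≤
      S.length * x := by
  rw [traceMean_ones, traceMean_hits, Finset.mul_sum, ← Finset.sum_sub_distrib]
  refine (Finset.abs_sum_le_sum_abs _ _).trans ?_
  have hprob : ∀ c < S.length, 0 ≤ S.getD c 0 ∧ S.getD c 0 ≤ 1 := by
    intro c hc
    rw [List.getD_eq_getElem _ _ hc]
    exact hS _ (List.getElem_mem hc)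
  calc _ ≤ ∑ c ∈ Finset.range S.length, x := by
        refine Finset.sum_le_sum fun c hc => ?_
        have hc := Finset.mem_range.1 hc
        rw [← sub_mul]
        rcases eq_or_ne c i with rfl | hci
        · simpa using hx0
        · have b0 := anchorProb_nonneg h0 h1 hS h i A c
          have b1 := matchProb_nonneg h0 h1 (hS.drop (c + 1)) B
          rw [abs_mul, mul_right_comm, abs_of_nonneg (mul_nonneg (mul_nonneg b0 b1) (by linarith))]
          have c1 : |S.getD c 0 - S.getD i 0| ≤ 1 := by
            have := hprob c hc; have := hprob i hi
            rw [abs_le]; constructor <;> linarith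
          calc _ ≤ 1 * (anchorProb δ h i S A c * matchProb δ (S.drop (c + 1)) B * 1) := by
                refine mul_le_mul c1 ?_ (mul_nonneg (mul_nonneg b0 b1) (by linarith)) (by norm_num)
                exact mul_le_mul_of_nonneg_left (by linarith) (mul_nonneg b0 b1)
            _ ≤ x := by rw [one_mul, mul_one]; exact hx c hc hci
    _ = S.length * x := by simp

end means

theorem forall₂_confidence_symbol (ps : List ℝ) :
    List.Forall₂ (fun p s => confidence p ≤ fitProb p s) ps (ps.map symbol) := by
  rw [List.forall₂_map_right_iff, List.forall₂_same]
  exact fun p _ => confidence_le_fitProb_symbol p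

theorem symbol_lt_three (p : ℝ) : symbol p < 3 := by
  unfold symbol; split_ifs <;> norm_num

/-- Behind every place there is a pattern that occurs there with large probability and behind it
with small probability only. -/
theorem exists_following_pattern {δ : ℝ} (h0 : 0 ≤ δ) (h1 : δ ≤ 1) {S : List ℝ} (hS : IsProb S)
    {h i : ℕ} (hi : i < S.length) (hgood : Good δ h S) :
    ∃ B : List ℕ, B.length = min h (S.length - 1 - i) ∧ (∀ s ∈ B, s < 3) ∧
      (1 - δ) ^ h * (94 / 100) ^ h ≤ matchProb δ (S.drop (i + 1)) B ∧
      ∀ c, i + 1 < c → c ≤ S.length → matchProb δ (S.drop c) B ≤ (82 / 100) ^ h := by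
  rcases le_or_gt (i + 1 + h) S.length with hlen | hlen
  · have hl : (((S.drop (i + 1)).take h).map symbol).length = h := by simp; omega
    refine ⟨((S.drop (i + 1)).take h).map symbol, by rw [hl]; omega, ?_, ?_, ?_⟩
    · intro s hs
      obtain ⟨p, -, rfl⟩ := List.mem_map.1 hs
      exact symbol_lt_three p
    · have a1 := le_matchProb h0 h1 (hS.drop (i + 1)) (P := ((S.drop (i + 1)).take h).map symbol)
        (g := confidence) (fun p => (confidence_pos p).le)
        (by rw [hl]; exact forall₂_confidence_symbol _)
      rw [hl] at a1
      exact (mul_le_mul_of_nonneg_left (hgood.le_confidence _ hlen)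
        (pow_nonneg (by linarith) _)).trans a1
    · exact fun c hc _ => hgood.matchProb_le _ _ hlen (.inl hc)
  -- Too few entries are left for a window. Here `B` demands only that as many bits follow as there
  -- are entries behind `i`, which is impossible further back.
  · refine ⟨List.replicate (S.length - 1 - i) 2, by simp; omega, ?_, ?_, ?_⟩
    · intro s hs
      rw [List.eq_of_mem_replicate hs]; norm_num
    · have a1 := le_matchProb h0 h1 (hS.drop (i + 1)) (P := List.replicate (S.length - 1 - i) 2)
        (g := fun _ => 1) (fun p => zero_le_one) (by
          rw [List.forall₂_iff_get]
          refine ⟨by simp; omega, fun j hj hj' => ?_⟩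
          simp [fitProb_of_two_le])
      refine le_trans ?_ a1
      simp only [List.map_const', List.prod_replicate, one_pow, mul_one, List.length_replicate]
      calc (1 - δ) ^ h * (94 / 100) ^ h ≤ (1 - δ) ^ h * 1 :=
            mul_le_mul_of_nonneg_left (pow_le_one₀ (by norm_num) (by norm_num))
              (pow_nonneg (by linarith) _)
        _ ≤ (1 - δ) ^ (S.length - 1 - i) := by
            rw [mul_one]; exact pow_le_pow_of_le_one (by linarith) (by linarith) (by omega)
    · intro c hc hcl
      rw [matchProb_eq_zero _ _ (by simp; omega)]
      positivity

/-- This guarantees that the search of the algorithm succeeds. Anchor and following pattern are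
independent given that entry `i` survives, each with probability at least `(0.94 * (1 - δ)) ^ h`,
and `0.94 ^ 2 = 0.8836` leaves room above 0.882. -/
theorem traceMean_following_pattern {δ : ℝ} (h0 : 0 ≤ δ) (h1 : δ ≤ 1 / 10 ^ 7) {S : List ℝ}
    (hS : IsProb S) {h i : ℕ} (hi : i < S.length) (hgood : Good δ h S)
    (hgood' : Good δ h S.reverse) {A : List ℕ} (hA : h ≤ i → Compatible h i S A) :
    ∃ B : List ℕ, B.length = min h (S.length - 1 - i) ∧ (∀ s ∈ B, s < 3) ∧
      (882 / 1000) ^ h / 2 ≤ traceMean δ S (hits h i A B) ∧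
      traceMean δ S (stretches S.length h i A B) ≤ (S.length : ℝ) ^ 2 * (82 / 100) ^ h := by
  have hδ1 : δ ≤ 1 := h1.trans (by norm_num)
  obtain ⟨B, hB1, hB2, hB3, hB4⟩ := exists_following_pattern h0 hδ1 hS hi hgood
  refine ⟨B, hB1, hB2, ?_, traceMean_stretches_le h0 h1 hS hi hgood' hA B hB4⟩
  refine le_trans ?_ (le_traceMean_hits h0 hδ1 hS A B hi)
  have a1 := le_anchorProb h0 hδ1 hS hi hgood' hA
  have hδ' : 1 - 1 / 10 ^ 7 ≤ 1 - δ := by linarith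
  calc (882 / 1000 : ℝ) ^ h / 2 ≤ ((1 - δ) * (94 / 100) * ((1 - δ) * (94 / 100))) ^ h * (1 - δ) := by
        have : (882 / 1000 : ℝ) ≤ (1 - δ) * (94 / 100) * ((1 - δ) * (94 / 100)) := by
          nlinarith
        have := pow_le_pow_left₀ (by norm_num) this h
        have hp : (0 : ℝ) ≤ (882 / 1000) ^ h := by positivity
        rw [div_eq_mul_inv]
        exact mul_le_mul this (by norm_num at hδ' ⊢; linarith) (by norm_num) (hp.trans this)
    _ = (1 - δ) ^ h * (94 / 100) ^ h * (1 - δ) * ((1 - δ) ^ h * (94 / 100) ^ h) := by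
        simp only [mul_pow]; ring
    _ ≤ _ := by
        have hn : (0 : ℝ) ≤ (1 - δ) ^ h * (94 / 100) ^ h :=
          mul_nonneg (pow_nonneg (by linarith) _) (by positivity)
        exact mul_le_mul (mul_le_mul_of_nonneg_right a1 (by linarith)) hB3 hn
          (mul_nonneg (hn.trans a1) (by linarith))

/-- If the pattern passes the test, then the fraction of ones is close to the entry. -/
theorem estimate_error {δ : ℝ} (h0 : 0 ≤ δ) (h1 : δ ≤ 1 / 10 ^ 7) {S : List ℝ}
    (hS : IsProb S) {h i : ℕ} (hi : i < S.length) (hgood' : Good δ h S.reverse) {A B : List ℕ}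
    (hA : h ≤ i → Compatible h i S A) {x₀ x₁ xd : ℝ}
    (hx₀ : |x₀ - traceMean δ S (hits h i A B)| ≤ (82 / 100) ^ h)
    (hx₁ : |x₁ - traceMean δ S (ones h i A B)| ≤ (82 / 100) ^ h)
    (hxd : |xd - traceMean δ S (stretches S.length h i A B)| ≤ (82 / 100) ^ h)
    (hpass₀ : (882 / 1000) ^ h / 4 ≤ x₀)
    (hpassd : xd ≤ 2 * (S.length : ℝ) ^ 2 * (82 / 100) ^ h) :
    |x₁ / x₀ - S.getD i 0| ≤ 32 * (S.length : ℝ) ^ 3 * (99 / 100) ^ h := by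
  have hδ1 : δ ≤ 1 := h1.trans (by norm_num)
  have hδ' : 1 - 1 / 10 ^ 7 ≤ 1 - δ := by linarith
  have hδn : 0 ≤ 1 - δ := by linarith
  have a1 := le_anchorProb h0 hδ1 hS hi hgood' hA
  set τ : ℝ := (82 / 100) ^ h with hτ
  -- As `0.9395 ≤ 0.94 * (1 - δ) ^ 2`, the number `q / 2` bounds from below the probability of a
  -- correct anchor followed by `h + 1` surviving entries.
  set q : ℝ := (9395 / 10000) ^ h with hq
  set n : ℝ := (S.length : ℝ) with hn
  have hn1 : 1 ≤ n := by rw [hn]; exact_mod_cast (by omega : 1 ≤ S.length)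
  have hτ0 : 0 < τ := by positivity
  have hq0 : 0 < q := by positivity
  have hq1 : q ≤ 1 := pow_le_one₀ (by norm_num) (by norm_num)
  have hpow : q / 2 ≤ (1 - δ) ^ h * (94 / 100) ^ h * (1 - δ) ^ (h + 1) := by
    have e : (1 - δ) ^ h * (94 / 100) ^ h * (1 - δ) ^ (h + 1) =
        ((1 - δ) * (94 / 100) * (1 - δ)) ^ h * (1 - δ) := by
      simp only [mul_pow, pow_succ]; ring
    rw [e, div_eq_mul_inv]
    have : (9395 / 10000 : ℝ) ≤ (1 - δ) * (94 / 100) * (1 - δ) := by nlinarith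
    have := pow_le_pow_left₀ (by norm_num) this h
    exact mul_le_mul this (by norm_num at hδ' ⊢; linarith) (by norm_num) (hq0.le.trans this)
  have hed : traceMean δ S (stretches S.length h i A B) ≤ 3 * n ^ 2 * τ := by
    have := abs_le.1 hxd
    have : τ ≤ n ^ 2 * τ := le_mul_of_one_le_left hτ0.le (one_le_pow₀ hn1)
    linarith
  -- Far from `i` the anchor is rare. For `i < c ≤ i + h` the accepted bound on stretches makes `B`
  -- rare behind `c`.
  have hx : ∀ c < S.length, c ≠ i →
      anchorProb δ h i S A c * matchProb δ (S.drop (c + 1)) B ≤ 6 * n ^ 2 * τ / q := by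
    intro c hc hci
    have b0 := anchorProb_nonneg h0 hδ1 hS h i A c
    have b1 := anchorProb_le_one h0 hδ1 hS h i A c
    have m0 := matchProb_nonneg h0 hδ1 (hS.drop (c + 1)) B
    have m1 := matchProb_le_one h0 hδ1 (hS.drop (c + 1)) B
    by_cases hfar : c < i ∨ i + h < c
    · have := anchorProb_le h0 h1 hS hi hgood' hA hc hfar
      calc _ ≤ τ * 1 := mul_le_mul this m1 m0 hτ0.le
        _ ≤ 6 * n ^ 2 * τ / q := by
            rw [le_div_iff₀ hq0]
            have : 1 ≤ n ^ 2 := one_le_pow₀ hn1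
            nlinarith
    · have a2 := matchProb_le_of_stretches h0 hδ1 hS (h := h) (A := A) (B := B)
        (by omega : i < c) hc
      have a3 : q / 2 ≤ anchorProb δ h i S A i * (1 - δ) ^ (c - i + 1) :=
        hpow.trans (mul_le_mul a1 (pow_le_pow_of_le_one hδn (by linarith) (by omega))
          (pow_nonneg hδn _) (anchorProb_nonneg h0 hδ1 hS h i A i))
      have a4 := mul_le_mul_of_nonneg_right a3 m0
      calc _ ≤ 1 * matchProb δ (S.drop (c + 1)) B := mul_le_mul_of_nonneg_right b1 m0
        _ ≤ 6 * n ^ 2 * τ / q := by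
            rw [le_div_iff₀ hq0]; linarith
  have hE := abs_traceMean_ones_sub_le h0 hδ1 hS (h := h) A B hi (by positivity) hx
  have hp : 0 ≤ S.getD i 0 ∧ S.getD i 0 ≤ 1 := by
    rw [List.getD_eq_getElem _ _ hi]
    exact hS _ (List.getElem_mem hi)
  have hw : (0 : ℝ) < (882 / 1000) ^ h := by positivity
  have hx₀pos : 0 < x₀ := by linarith
  -- At most `n` wrong places contribute the systematic error, and the two empirical means
  -- contribute the sampling error `2 * τ`.
  have hdiff : |x₁ - S.getD i 0 * x₀| ≤ 8 * n ^ 3 * τ / q := by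
    have e : x₁ - S.getD i 0 * x₀ = (x₁ - traceMean δ S (ones h i A B)) +
        (traceMean δ S (ones h i A B) - S.getD i 0 * traceMean δ S (hits h i A B)) -
        S.getD i 0 * (x₀ - traceMean δ S (hits h i A B)) := by ring
    have c1 : |S.getD i 0 * (x₀ - traceMean δ S (hits h i A B))| ≤ τ := by
      rw [abs_mul, abs_of_nonneg hp.1]
      calc _ ≤ 1 * τ := mul_le_mul hp.2 hx₀ (abs_nonneg _) zero_le_one
        _ = τ := one_mul _
    have c2 : 2 * τ ≤ 2 * n ^ 3 * τ / q := by
      rw [le_div_iff₀ hq0]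
      have : 1 ≤ n ^ 3 := one_le_pow₀ hn1
      nlinarith
    have c3 : n * (6 * n ^ 2 * τ / q) + 2 * n ^ 3 * τ / q = 8 * n ^ 3 * τ / q := by ring
    rw [e]
    have d1 := abs_le.1 hx₁
    have d2 := abs_le.1 hE
    have d3 := abs_le.1 c1
    rw [abs_le]
    constructor <;> linarith
  have e : x₁ / x₀ - S.getD i 0 = (x₁ - S.getD i 0 * x₀) / x₀ := by field_simp
  rw [e, abs_div, abs_of_pos hx₀pos, div_le_iff₀ hx₀pos]
  -- The constants are balanced so that `0.82 ≤ 0.99 * 0.9395 * 0.882`.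
  have hratio : τ ≤ (99 / 100) ^ h * q * (882 / 1000) ^ h := by
    rw [hτ, hq, ← mul_pow, ← mul_pow]
    exact pow_le_pow_left₀ (by norm_num) (by norm_num) h
  have h99 : (0 : ℝ) < (99 / 100) ^ h := by positivity
  calc _ ≤ 8 * n ^ 3 * τ / q := hdiff
    _ ≤ 8 * n ^ 3 * ((99 / 100) ^ h * (882 / 1000) ^ h) := by
        rw [div_le_iff₀ hq0]
        have := mul_le_mul_of_nonneg_left hratio (by positivity : 0 ≤ 8 * n ^ 3)
        linarith
    _ = 32 * n ^ 3 * (99 / 100) ^ h * ((882 / 1000) ^ h / 4) := by ring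
    _ ≤ _ := mul_le_mul_of_nonneg_left hpass₀ (by positivity)

/-! ### Functions that programs can compute

The arrays `0` to `4` are visible; every further array holds one variable, in its cell `0`. All
loops run as many times as there are traces. -/

/-- The visible part of a memory. -/
def Memory.visible (s : Memory) : Memory := fun a i => if a < 5 then s a i else 0

/-- The environment with one more variable. -/
def push (x : ℕ) (env : ℕ → ℕ) : ℕ → ℕ
  | 0 => x
  | i + 1 => env i

/-- `F`, a function of the visible memory and of variables, is computed by a program in polynomial
time, without changes to the arrays below the array `d` that gets the result. -/
def PolyTime (F : Memory → (ℕ → ℕ) → ℕ) : Prop :=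
  ∀ (ρ : ℕ → ℕ) (d : ℕ), 5 ≤ d → (∀ i, ρ i < d) → ∃ (c : Program) (P : Polynomial ℕ),
    ∀ s : Memory, ∃ (u : Memory) (t : ℕ), Exec c s u t ∧ t ≤ P.eval (s 0 2) ∧
      (∀ a < d, u a = s a) ∧ u d 0 = F s.visible fun i => s (ρ i) 0

theorem Memory.visible_congr {d : ℕ} (hd : 5 ≤ d) {s u : Memory} (h : ∀ a < d, u a = s a) :
    u.visible = s.visible := by
  funext a i
  unfold Memory.visible
  split_ifs with ha
  · rw [h a (by omega)]
  · rfl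

theorem Memory.write_of_ne {s : Memory} {a i v a' : ℕ} (h : a' ≠ a) : s.write a i v a' = s a' := by
  funext j
  simp [Memory.write, h]

theorem Memory.write_self (s : Memory) (a i v : ℕ) : s.write a i v a i = v := by
  simp [Memory.write]

namespace PolyTime

open Polynomial

theorem const (v : ℕ) : PolyTime fun _ _ => v := by
  intro ρ d _ _
  refine ⟨.set d (.lit 0) (.lit v), 3, fun s => ⟨_, _, .set _ _ _ _, ?_, ?_, ?_⟩⟩
  · simp [Expr.cost]
  · intro a ha; exact Memory.write_of_ne (by omega)
  · exact Memory.write_self _ _ _ _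

theorem var (i : ℕ) : PolyTime fun _ env => env i := by
  intro ρ d _ _
  refine ⟨.set d (.lit 0) (.get (ρ i) (.lit 0)), 4, fun s => ⟨_, _, .set _ _ _ _, ?_, ?_, ?_⟩⟩
  · simp [Expr.cost]
  · intro a ha; exact Memory.write_of_ne (by omega)
  · exact Memory.write_self _ _ _ _

theorem rename {F : Memory → (ℕ → ℕ) → ℕ} (hF : PolyTime F) (r : ℕ → ℕ) :
    PolyTime fun m env => F m fun i => env (r i) :=
  fun ρ d hd hρ => hF (fun i => ρ (r i)) d hd fun i => hρ (r i)

theorem get {F : Memory → (ℕ → ℕ) → ℕ} {a : ℕ} (ha : a < 5) (hF : PolyTime F) :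
    PolyTime fun m env => m a (F m env) := by
  intro ρ d hd hρ
  obtain ⟨c, P, h⟩ := hF ρ d hd hρ
  refine ⟨.seq c (.set d (.lit 0) (.get a (.get d (.lit 0)))), P + 5, fun s => ?_⟩
  obtain ⟨u, t, h1, h2, h3, h4⟩ := h s
  refine ⟨_, _, .seq h1 (.set _ _ _ _), ?_, ?_, ?_⟩
  · simp [Expr.cost]; omega
  · intro b hb; rw [Memory.write_of_ne (by omega), h3 b hb]
  · refine (Memory.write_self _ _ _ _).trans ?_
    simp only [Expr.eval]
    rw [h4, h3 a (by omega)]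
    simp [Memory.visible, ha]

/-- The first result waits in array `d` while the second is computed with target `d + 1`, which
leaves all arrays below `d + 1` untouched. -/
theorem binary {F G : Memory → (ℕ → ℕ) → ℕ} (hF : PolyTime F) (hG : PolyTime G)
    (e : Expr → Expr → Expr) (op : ℕ → ℕ → ℕ)
    (he : ∀ s e₁ e₂, (e e₁ e₂).eval s = op (e₁.eval s) (e₂.eval s))
    (hc : ∀ e₁ e₂, (e e₁ e₂).cost = e₁.cost + e₂.cost + 1) :
    PolyTime fun m env => op (F m env) (G m env) := by
  intro ρ d hd hρ
  obtain ⟨c, P, h⟩ := hF ρ d hd hρ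
  obtain ⟨c', P', h'⟩ := hG ρ (d + 1) (by omega) fun i => (hρ i).trans d.lt_succ_self
  refine ⟨.seq c (.seq c' (.set d (.lit 0) (e (.get d (.lit 0)) (.get (d + 1) (.lit 0))))),
    P + P' + 7, fun s => ?_⟩
  obtain ⟨u, t, h1, h2, h3, h4⟩ := h s
  obtain ⟨u', t', h1', h2', h3', h4'⟩ := h' u
  refine ⟨_, _, .seq h1 (.seq h1' (.set _ _ _ _)), ?_, ?_, ?_⟩
  · rw [h3 0 (by omega)] at h2'
    simp [Expr.cost, hc]; omega
  · intro b hb; rw [Memory.write_of_ne (by omega), h3' b (by omega), h3 b hb]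
  · refine (Memory.write_self _ _ _ _).trans ?_
    simp only [he, Expr.eval]
    rw [h4', h3' d (by omega), h4, Memory.visible_congr hd h3]
    simp only [h3 _ (hρ _)]

theorem add {F G : Memory → (ℕ → ℕ) → ℕ} (hF : PolyTime F) (hG : PolyTime G) :
    PolyTime fun m env => F m env + G m env :=
  binary hF hG .add (· + ·) (fun _ _ _ => rfl) fun _ _ => rfl

theorem sub {F G : Memory → (ℕ → ℕ) → ℕ} (hF : PolyTime F) (hG : PolyTime G) :
    PolyTime fun m env => F m env - G m env :=
  binary hF hG .sub (· - ·) (fun _ _ _ => rfl) fun _ _ => rfl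

/-- The factor is fixed, so the product unrolls into additions in the program text. -/
theorem const_mul (x : ℕ) {F : Memory → (ℕ → ℕ) → ℕ} (hF : PolyTime F) :
    PolyTime fun m env => x * F m env := by
  induction x with
  | zero => simpa using const 0
  | succ x ih => simpa only [add_mul, one_mul] using ih.add hF

theorem ite_zero {B F G : Memory → (ℕ → ℕ) → ℕ} (hB : PolyTime B) (hF : PolyTime F)
    (hG : PolyTime G) : PolyTime fun m env => if B m env = 0 then F m env else G m env := by
  intro ρ d hd hρ
  obtain ⟨c, P, h⟩ := hB ρ d hd hρ
  obtain ⟨c', P', h'⟩ := hF ρ d hd hρ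
  obtain ⟨c'', P'', h''⟩ := hG ρ d hd hρ
  refine ⟨.seq c (.ite (.get d (.lit 0)) c'' c'), P + P' + P'' + 3, fun s => ?_⟩
  obtain ⟨u, t, h1, h2, h3, h4⟩ := h s
  have hvis := Memory.visible_congr hd h3
  by_cases h0 : B s.visible (fun i => s (ρ i) 0) = 0
  · obtain ⟨u', t', h1', h2', h3', h4'⟩ := h' u
    refine ⟨_, _, .seq h1 (.ite_false (by simpa [Expr.eval, h4] using h0) h1'), ?_, ?_, ?_⟩
    · rw [h3 0 (by omega)] at h2'
      simp [Expr.cost]; omega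
    · intro b hb; rw [h3' b hb, h3 b hb]
    · simp only [h4', hvis, h3 _ (hρ _), h0, if_true]
  · obtain ⟨u', t', h1', h2', h3', h4'⟩ := h'' u
    refine ⟨_, _, .seq h1 (.ite_true (by simpa [Expr.eval, h4] using h0) h1'), ?_, ?_, ?_⟩
    · rw [h3 0 (by omega)] at h2'
      simp [Expr.cost]; omega
    · intro b hb; rw [h3' b hb, h3 b hb]
    · simp only [h4', hvis, h3 _ (hρ _), h0, if_false]

theorem ite_le {X Y F G : Memory → (ℕ → ℕ) → ℕ} (hX : PolyTime X) (hY : PolyTime Y)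
    (hF : PolyTime F) (hG : PolyTime G) :
    PolyTime fun m env => if X m env ≤ Y m env then F m env else G m env := by
  simpa only [Nat.sub_eq_zero_iff_le] using ite_zero (hX.sub hY) hF hG

theorem ite_lt {X Y F G : Memory → (ℕ → ℕ) → ℕ} (hX : PolyTime X) (hY : PolyTime Y)
    (hF : PolyTime F) (hG : PolyTime G) :
    PolyTime fun m env => if X m env < Y m env then F m env else G m env := by
  simpa only [Nat.lt_iff_add_one_le] using ite_le (hX.add (const 1)) hY hF hG

theorem ite_eq {X Y F G : Memory → (ℕ → ℕ) → ℕ} (hX : PolyTime X) (hY : PolyTime Y)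
    (hF : PolyTime F) (hG : PolyTime G) :
    PolyTime fun m env => if X m env = Y m env then F m env else G m env := by
  have : ∀ x y : ℕ, (x - y) + (y - x) = 0 ↔ x = y := by omega
  simpa only [this] using ite_zero ((hX.sub hY).add (hY.sub hX)) hF hG

/-- The value of `F` stays in array `d` and becomes variable 0 of the continuation; the other
variables shift by one. -/
theorem bind {F : Memory → (ℕ → ℕ) → ℕ} (G : Memory → (ℕ → ℕ) → ℕ → ℕ) (hF : PolyTime F)
    (hG : PolyTime fun m env => G m (fun i => env (i + 1)) (env 0)) :
    PolyTime fun m env => G m env (F m env) := by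
  intro ρ d hd hρ
  obtain ⟨c, P, h⟩ := hF ρ d hd hρ
  obtain ⟨c', P', h'⟩ := hG (push d ρ) (d + 1) (by omega) (by
    rintro (_ | i)
    · exact d.lt_succ_self
    · exact (hρ i).trans d.lt_succ_self)
  refine ⟨.seq c (.seq c' (.set d (.lit 0) (.get (d + 1) (.lit 0)))), P + P' + 4, fun s => ?_⟩
  obtain ⟨u, t, h1, h2, h3, h4⟩ := h s
  obtain ⟨u', t', h1', h2', h3', h4'⟩ := h' u
  refine ⟨_, _, .seq h1 (.seq h1' (.set _ _ _ _)), ?_, ?_, ?_⟩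
  · rw [h3 0 (by omega)] at h2'
    simp [Expr.cost]; omega
  · intro b hb; rw [Memory.write_of_ne (by omega), h3' b (by omega), h3 b hb]
  · refine (Memory.write_self _ _ _ _).trans ?_
    simp only [Expr.eval]
    rw [h4', Memory.visible_congr hd h3]
    simp only [push, h4, h3 _ (hρ _)]

/-- Array `d` holds the accumulator and array `d + 1` the counter. The number of rounds `m 0 2` is
also the argument of the time bounds, so a loop multiplies the bound of its body, up to constants,
by `X`. -/
theorem loop {F : Memory → (ℕ → ℕ) → ℕ} (G : Memory → (ℕ → ℕ) → ℕ → ℕ → ℕ) (hF : PolyTime F)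
    (hG : PolyTime fun m env => G m (fun i => env (i + 2)) (env 0) (env 1)) :
    PolyTime fun m env => Nat.rec (F m env) (fun v acc => G m env v acc) (m 0 2) := by
  intro ρ d hd hρ
  obtain ⟨c, P, h⟩ := hF ρ d hd hρ
  obtain ⟨c', P', h'⟩ := hG (push (d + 1) (push d ρ)) (d + 2) (by omega) (by
    rintro (_ | _ | i)
    · exact Nat.lt_succ_self (d + 1)
    · simp [push]
    · exact (hρ i).trans (by omega))
  set body : Program := .seq c' (.seq (.set d (.lit 0) (.get (d + 2) (.lit 0)))
    (.set (d + 1) (.lit 0) (.add (.get (d + 1) (.lit 0)) (.lit 1)))) with hbody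
  set test : Expr := .sub (.get 0 (.lit 2)) (.get (d + 1) (.lit 0)) with htest
  refine ⟨.seq c (.seq (.set (d + 1) (.lit 0) (.lit 0)) (.loop test body)),
    P + X * (P' + 20) + 20, fun s => ?_⟩
  set R : ℕ → ℕ := fun v => Nat.rec (F s.visible fun i => s (ρ i) 0)
    (fun v acc => G s.visible (fun i => s (ρ i) 0) v acc) v with hR
  have key : ∀ r v : ℕ, v + r = s 0 2 → ∀ w : Memory, (∀ a < d, w a = s a) → w d 0 = R v →
      w (d + 1) 0 = v → ∃ u t, Exec (.loop test body) w u t ∧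
        t ≤ r * (P'.eval (s 0 2) + 20) + 6 ∧ (∀ a < d, u a = s a) ∧ u d 0 = R (s 0 2) := by
    intro r
    induction r with
    | zero =>
      intro v hv w hw1 hw2 hw3
      refine ⟨w, _, .loop_done ?_, ?_, hw1, ?_⟩
      · simp only [htest, Expr.eval]
        rw [hw1 0 (by omega), hw3]; omega
      · simp [htest, Expr.cost]
      · rw [hw2, ← hv]; simp
    | succ r ih =>
      intro v hv w hw1 hw2 hw3
      obtain ⟨u, t, h1, h2, h3, h4⟩ := h' w
      set w' := (u.write d 0 (u (d + 2) 0)) with hw'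
      set w'' := (w'.write (d + 1) 0 (v + 1)) with hw''
      have hb : Exec body w w'' (t + (5 - 1 + (7 - 1))) := by
        have e1 : Exec (.set d (.lit 0) (.get (d + 2) (.lit 0))) u w' 4 :=
          .set d (.lit 0) (.get (d + 2) (.lit 0)) u
        have e2 := Exec.set (d + 1) (.lit 0) (.add (.get (d + 1) (.lit 0)) (.lit 1)) w'
        have e3 : (Expr.add (.get (d + 1) (.lit 0)) (.lit 1)).eval w' = v + 1 := by
          simp only [Expr.eval]
          rw [hw', Memory.write_of_ne (by omega), h3 _ (by omega), hw3]
        rw [e3] at e2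
        exact .seq h1 (.seq e1 e2)
      obtain ⟨u', t', k1, k2, k3, k4⟩ := ih (v + 1) (by omega) w''
        (by
          intro a ha
          rw [hw'', Memory.write_of_ne (by omega), hw', Memory.write_of_ne (by omega),
            h3 a (by omega), hw1 a ha])
        (by
          rw [hw'', Memory.write_of_ne (by omega), hw', Memory.write_self, h4,
            Memory.visible_congr hd hw1]
          simp only [push, hw1 _ (hρ _), hw2, hw3]
          rfl)
        (Memory.write_self _ _ _ _)
      refine ⟨u', _, .loop_step ?_ hb k1, ?_, k3, k4⟩
      · simp only [htest, Expr.eval]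
        rw [hw1 0 (by omega), hw3]; omega
      · rw [hw1 0 (by omega)] at h2
        have : test.cost = 5 := rfl
        rw [this, add_mul, one_mul]
        omega
  obtain ⟨u, t, h1, h2, h3, h4⟩ := h s
  obtain ⟨u', t', k1, k2, k3, k4⟩ := key (s 0 2) 0 (by omega) (u.write (d + 1) 0 0)
    (fun a ha => by rw [Memory.write_of_ne (by omega), h3 a ha])
    (by rw [Memory.write_of_ne (by omega), h4]; rfl) (Memory.write_self _ _ _ _)
  refine ⟨u', _, .seq h1 (.seq (.set _ _ _ _) k1), ?_, k3, k4⟩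
  simp [Expr.cost]; omega

theorem sum (G : Memory → (ℕ → ℕ) → ℕ → ℕ)
    (hG : PolyTime fun m env => G m (fun i => env (i + 1)) (env 0)) :
    PolyTime fun m env => ∑ v ∈ Finset.range (m 0 2), G m env v := by
  have h := loop (F := fun _ _ => 0) (fun m env v acc => acc + G m env v) (const 0)
    ((var 1).add (hG.rename fun i => if i = 0 then 0 else i + 1))
  have e : ∀ (m : Memory) (env : ℕ → ℕ) (N : ℕ), ∑ v ∈ Finset.range N, G m env v =
      Nat.rec 0 (fun v acc => acc + G m env v) N := by
    intro m env N
    induction N with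
    | zero => rfl
    | succ N ih => rw [Finset.sum_range_succ, ih]
  simpa only [e] using h

theorem comp₁ {G : Memory → ℕ → ℕ} (hG : PolyTime fun m env => G m (env 0))
    {F : Memory → (ℕ → ℕ) → ℕ} (hF : PolyTime F) : PolyTime fun m env => G m (F m env) :=
  bind (fun m _ x => G m x) hF hG

/-- Functions of fixed arity serve as subroutines: their arguments are bound one after another, the
last one first. -/
theorem comp₂ {G : Memory → ℕ → ℕ → ℕ} (hG : PolyTime fun m env => G m (env 0) (env 1))
    {F₁ F₂ : Memory → (ℕ → ℕ) → ℕ} (h₁ : PolyTime F₁) (h₂ : PolyTime F₂) :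
    PolyTime fun m env => G m (F₁ m env) (F₂ m env) :=
  bind (fun m env x => G m (F₁ m env) x) h₂
    (bind (fun m env x => G m x (env 0)) (h₁.rename (· + 1)) hG)

theorem comp₃ {G : Memory → ℕ → ℕ → ℕ → ℕ}
    (hG : PolyTime fun m env => G m (env 0) (env 1) (env 2))
    {F₁ F₂ F₃ : Memory → (ℕ → ℕ) → ℕ} (h₁ : PolyTime F₁) (h₂ : PolyTime F₂)
    (h₃ : PolyTime F₃) : PolyTime fun m env => G m (F₁ m env) (F₂ m env) (F₃ m env) :=
  bind (fun m env x => G m (F₁ m env) (F₂ m env) x) h₃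
    (bind (fun m env x => G m (F₁ m fun i => env (i + 1)) x (env 0)) (h₂.rename (· + 1))
      (bind (fun m env x => G m x (env 0) (env 1)) (h₁.rename (· + 2)) hG))

theorem comp₄ {G : Memory → ℕ → ℕ → ℕ → ℕ → ℕ}
    (hG : PolyTime fun m env => G m (env 0) (env 1) (env 2) (env 3))
    {F₁ F₂ F₃ F₄ : Memory → (ℕ → ℕ) → ℕ} (h₁ : PolyTime F₁) (h₂ : PolyTime F₂)
    (h₃ : PolyTime F₃) (h₄ : PolyTime F₄) :
    PolyTime fun m env => G m (F₁ m env) (F₂ m env) (F₃ m env) (F₄ m env) :=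
  bind (fun m env x => G m (F₁ m env) (F₂ m env) (F₃ m env) x) h₄
    (bind (fun m env x => G m (F₁ m fun i => env (i + 1)) (F₂ m fun i => env (i + 1)) x (env 0))
      (h₃.rename (· + 1))
      (bind (fun m env x => G m (F₁ m fun i => env (i + 2)) x (env 0) (env 1)) (h₂.rename (· + 2))
        (bind (fun m env x => G m x (env 0) (env 1) (env 2)) (h₁.rename (· + 3)) hG)))

end PolyTime

theorem Memory.visible_write {s : Memory} {a i v : ℕ} (ha : a < 5) :
    (s.write a i v).visible = s.visible.write a i v := by
  funext b j
  simp only [Memory.visible, Memory.write]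
  by_cases hb : b < 5
  · simp [hb]
  · simp [hb]; omega

theorem Memory.visible_write_of_le {s : Memory} {a i v : ℕ} (ha : 5 ≤ a) :
    (s.write a i v).visible = s.visible :=
  Memory.visible_congr le_rfl fun _ hb => Memory.write_of_ne (by omega)

/-! ### The algorithm

All functions below read the visible memory `m`; loops are cut off after `m 0 2` rounds. -/

namespace Algorithm

/-- A sum over `v < x`. -/
def boundedSum (m : Memory) (x : ℕ) (f : ℕ → ℕ) : ℕ :=
  ∑ v ∈ Finset.range (m 0 2), if v < x then f v else 0

/-- The function `f`, iterated `x` times. -/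
def boundedIterate (m : Memory) (x : ℕ) (f : ℕ → ℕ) (y : ℕ) : ℕ :=
  Nat.rec y (fun v acc => if v < x then f acc else acc) (m 0 2)

/-- The product of `x` and `y`. -/
def product (m : Memory) (x y : ℕ) : ℕ := boundedSum m x fun _ => y

/-- The product of `q ^ x` and `y`. -/
def scale (q : ℕ) (m : Memory) (x y : ℕ) : ℕ := boundedIterate m x (q * ·) y

/-- The length of the binary expansion of `n + k`. -/
def bitLength (m : Memory) : ℕ :=
  ∑ v ∈ Finset.range (m 0 2), if scale 2 m v 1 ≤ m 0 0 + m 0 1 then 1 else 0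

/-- The length of the patterns. -/
def window (C : ℕ) (m : Memory) : ℕ := C * bitLength m

/-- The integer part of `x / 3`. -/
def third (m : Memory) (x : ℕ) : ℕ :=
  ∑ v ∈ Finset.range (m 0 2), if 3 * (v + 1) ≤ x then 1 else 0

/-- Digit number `l` of `b` to base three. -/
def digit (m : Memory) (b l : ℕ) : ℕ :=
  boundedIterate m l (third m) b - 3 * third m (boundedIterate m l (third m) b)

/-- Bit number `j` of trace number `t`. -/
def bit (m : Memory) (t j : ℕ) : ℕ := m 2 (product m (m 0 0) t + j)

/-- This is zero if the bit `b` fits the symbol `s`. -/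
def misfit (s b : ℕ) : ℕ := if s = b then 0 else if 2 ≤ s then 0 else 1

/-- The symbol of the estimate of entry `l`. -/
def estimateSymbol (m : Memory) (l : ℕ) : ℕ :=
  if 805 * m 4 l ≤ 1000 * m 3 l then 1
  else if 1000 * m 3 l ≤ 195 * m 4 l then 0 else 2

/-- The length of the pattern that follows entry `i`. -/
def followLength (C : ℕ) (m : Memory) (i : ℕ) : ℕ :=
  if window C m ≤ m 0 0 - 1 - i then window C m else m 0 0 - 1 - i

/-- The indicator that pattern number `b` occurs in trace `t` at position `z`. -/
def follows (C : ℕ) (m : Memory) (i b t z : ℕ) : ℕ :=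
  if z + followLength C m i ≤ m 1 t then
    if boundedSum m (followLength C m i) (fun l => misfit (digit m b l) (bit m t (z + l))) = 0
    then 1 else 0
  else 0

/-- The indicator that what precedes position `y` of trace `t` is an anchor for entry `i`. -/
def anchored (C : ℕ) (m : Memory) (i t y : ℕ) : ℕ :=
  if i < window C m then (if y = i then 1 else 0)
  else if window C m ≤ y then
    if boundedSum m (window C m)
      (fun l => misfit (estimateSymbol m (i - 1 - l)) (bit m t (y - 1 - l))) = 0 then 1 else 0
  else 0

/-- The total number of hits. -/
def hitCount (C : ℕ) (m : Memory) (i b : ℕ) : ℕ :=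
  ∑ t ∈ Finset.range (m 0 2), boundedSum m (m 1 t) fun y =>
    if anchored C m i t y = 0 then 0 else follows C m i b t (y + 1)

/-- The total number of hits with the bit `1`. -/
def oneCount (C : ℕ) (m : Memory) (i b : ℕ) : ℕ :=
  ∑ t ∈ Finset.range (m 0 2), boundedSum m (m 1 t) fun y =>
    if anchored C m i t y = 0 then 0
    else if bit m t y = 0 then 0 else follows C m i b t (y + 1)

/-- The total number of stretches. -/
def stretchCount (C : ℕ) (m : Memory) (i b : ℕ) : ℕ :=
  ∑ t ∈ Finset.range (m 0 2), boundedSum m (m 1 t) fun y => boundedSum m (m 1 t) fun z =>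
    if y < z then (if anchored C m i t y = 0 then 0 else follows C m i b t (z + 1)) else 0

/-- The indicator that pattern number `b` can be used for entry `i`. -/
def passes (C : ℕ) (m : Memory) (i b : ℕ) : ℕ :=
  if scale 882 m (window C m) (m 0 2) ≤ 4 * scale 1000 m (window C m) (hitCount C m i b) then
    if scale 100 m (window C m) (stretchCount C m i b) ≤
      2 * product m (m 0 0) (product m (m 0 0) (scale 82 m (window C m) (m 0 2))) then 1 else 0
  else 0

/-- The successor of the number of the first pattern that can be used for entry `i`. -/
def search (C : ℕ) (m : Memory) (i : ℕ) : ℕ :=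
  Nat.rec 0 (fun b acc => if acc = 0 then (if passes C m i b = 0 then 0 else b + 1) else acc)
    (m 0 2)

/-- The numerator of the estimate of entry `i`. -/
def numerator (C : ℕ) (m : Memory) (i : ℕ) : ℕ := oneCount C m i (search C m i - 1)

/-- The denominator of the estimate of entry `i`. -/
def denominator (C : ℕ) (m : Memory) (i : ℕ) : ℕ := hitCount C m i (search C m i - 1)

open PolyTime

theorem computable_boundedSum {X : Memory → (ℕ → ℕ) → ℕ} (hX : PolyTime X)
    (G : Memory → (ℕ → ℕ) → ℕ → ℕ)
    (hG : PolyTime fun m env => G m (fun i => env (i + 1)) (env 0)) :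
    PolyTime fun m env => boundedSum m (X m env) (G m env) :=
  PolyTime.sum (fun m env v => if v < X m env then G m env v else 0)
    (ite_lt (var 0) (hX.rename (· + 1)) hG (const 0))

theorem computable_boundedIterate {X Y : Memory → (ℕ → ℕ) → ℕ} (hX : PolyTime X)
    (hY : PolyTime Y) (G : Memory → ℕ → ℕ) (hG : PolyTime fun m env => G m (env 0)) :
    PolyTime fun m env => boundedIterate m (X m env) (G m) (Y m env) :=
  PolyTime.loop (fun m env v acc => if v < X m env then G m acc else acc) hY
    (ite_lt (var 0) (hX.rename (· + 2)) (comp₁ hG (var 1)) (var 1))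

variable {X Y Z W : Memory → (ℕ → ℕ) → ℕ}

theorem computable_product (hX : PolyTime X) (hY : PolyTime Y) :
    PolyTime fun m env => product m (X m env) (Y m env) :=
  computable_boundedSum hX (fun m env _ => Y m env) (hY.rename (· + 1))

theorem computable_scale (q : ℕ) (hX : PolyTime X) (hY : PolyTime Y) :
    PolyTime fun m env => scale q m (X m env) (Y m env) :=
  computable_boundedIterate hX hY (fun _ x => q * x) ((var 0).const_mul q)

theorem computable_cell (a v : ℕ) (ha : a < 5) : PolyTime fun m _ => m a v := get ha (const v)

theorem computable_window (C : ℕ) : PolyTime fun m _ => window C m :=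
  const_mul C (PolyTime.sum (fun m _ v => if scale 2 m v 1 ≤ m 0 0 + m 0 1 then 1 else 0)
    (ite_le (computable_scale 2 (var 0) (const 1))
      ((computable_cell 0 0 (by norm_num)).add (computable_cell 0 1 (by norm_num)))
      (const 1) (const 0)))

theorem computable_third (hX : PolyTime X) : PolyTime fun m env => third m (X m env) :=
  PolyTime.sum (fun m env v => if 3 * (v + 1) ≤ X m env then 1 else 0)
    (ite_le (((var 0).add (const 1)).const_mul 3) (hX.rename (· + 1)) (const 1) (const 0))

theorem computable_digit (hX : PolyTime X) (hY : PolyTime Y) :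
    PolyTime fun m env => digit m (X m env) (Y m env) := by
  have h := computable_boundedIterate hY hX third (computable_third (var 0))
  exact h.sub ((computable_third h).const_mul 3)

theorem computable_bit (hX : PolyTime X) (hY : PolyTime Y) :
    PolyTime fun m env => bit m (X m env) (Y m env) :=
  get (by norm_num) ((computable_product (computable_cell 0 0 (by norm_num)) hX).add hY)

theorem computable_misfit (hX : PolyTime X) (hY : PolyTime Y) :
    PolyTime fun m env => misfit (X m env) (Y m env) :=
  ite_eq hX hY (const 0) (ite_le (const 2) hX (const 0) (const 1))

theorem computable_estimateSymbol (hX : PolyTime X) :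
    PolyTime fun m env => estimateSymbol m (X m env) := by
  have h3 := get (a := 3) (by norm_num) hX
  have h4 := get (a := 4) (by norm_num) hX
  exact ite_le (h4.const_mul 805) (h3.const_mul 1000) (const 1)
    (ite_le (h3.const_mul 1000) (h4.const_mul 195) (const 0) (const 2))

theorem computable_followLength (C : ℕ) (hX : PolyTime X) :
    PolyTime fun m env => followLength C m (X m env) := by
  have h := ((computable_cell 0 0 (by norm_num)).sub (const 1)).sub hX
  exact ite_le (computable_window C) h (computable_window C) h

theorem computable_follows (C : ℕ) (hX : PolyTime X) (hY : PolyTime Y) (hZ : PolyTime Z)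
    (hW : PolyTime W) :
    PolyTime fun m env => follows C m (X m env) (Y m env) (Z m env) (W m env) :=
  comp₄ (G := follows C) (ite_le ((var 3).add (computable_followLength C (var 0)))
    (get (by norm_num) (var 2))
    (ite_zero (computable_boundedSum (computable_followLength C (var 0))
      (fun m env l => misfit (digit m (env 1) l) (bit m (env 2) (env 3 + l)))
      (computable_misfit (computable_digit (var 2) (var 0))
        (computable_bit (var 3) ((var 4).add (var 0))))) (const 1) (const 0)) (const 0)) hX hY hZ hW

theorem computable_anchored (C : ℕ) (hX : PolyTime X) (hY : PolyTime Y) (hZ : PolyTime Z) :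
    PolyTime fun m env => anchored C m (X m env) (Y m env) (Z m env) :=
  comp₃ (G := anchored C) (ite_lt (var 0) (computable_window C)
    (ite_eq (var 2) (var 0) (const 1) (const 0))
    (ite_le (computable_window C) (var 2)
      (ite_zero (computable_boundedSum (computable_window C)
        (fun m env l => misfit (estimateSymbol m (env 0 - 1 - l)) (bit m (env 1) (env 2 - 1 - l)))
        (computable_misfit (computable_estimateSymbol (((var 1).sub (const 1)).sub (var 0)))
          (computable_bit (var 2) (((var 3).sub (const 1)).sub (var 0))))) (const 1) (const 0))
      (const 0))) hX hY hZ

theorem computable_hitCount (C : ℕ) (hX : PolyTime X) (hY : PolyTime Y) :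
    PolyTime fun m env => hitCount C m (X m env) (Y m env) :=
  comp₂ (G := hitCount C) (PolyTime.sum (fun m env t => boundedSum m (m 1 t) fun y =>
      if anchored C m (env 0) t y = 0 then 0 else follows C m (env 0) (env 1) t (y + 1))
    (computable_boundedSum (get (by norm_num) (var 0)) (fun m env y =>
      if anchored C m (env 1) (env 0) y = 0 then 0
      else follows C m (env 1) (env 2) (env 0) (y + 1))
      (ite_zero (computable_anchored C (var 2) (var 1) (var 0)) (const 0)
        (computable_follows C (var 2) (var 3) (var 1) ((var 0).add (const 1)))))) hX hY

theorem computable_oneCount (C : ℕ) (hX : PolyTime X) (hY : PolyTime Y) :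
    PolyTime fun m env => oneCount C m (X m env) (Y m env) :=
  comp₂ (G := oneCount C) (PolyTime.sum (fun m env t => boundedSum m (m 1 t) fun y =>
      if anchored C m (env 0) t y = 0 then 0
      else if bit m t y = 0 then 0 else follows C m (env 0) (env 1) t (y + 1))
    (computable_boundedSum (get (by norm_num) (var 0)) (fun m env y =>
      if anchored C m (env 1) (env 0) y = 0 then 0
      else if bit m (env 0) y = 0 then 0 else follows C m (env 1) (env 2) (env 0) (y + 1))
      (ite_zero (computable_anchored C (var 2) (var 1) (var 0)) (const 0)
        (ite_zero (computable_bit (var 1) (var 0)) (const 0)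
          (computable_follows C (var 2) (var 3) (var 1) ((var 0).add (const 1))))))) hX hY

theorem computable_stretchCount (C : ℕ) (hX : PolyTime X) (hY : PolyTime Y) :
    PolyTime fun m env => stretchCount C m (X m env) (Y m env) :=
  comp₂ (G := stretchCount C) (PolyTime.sum (fun m env t => boundedSum m (m 1 t) fun y =>
      boundedSum m (m 1 t) fun z => if y < z then
        (if anchored C m (env 0) t y = 0 then 0 else follows C m (env 0) (env 1) t (z + 1)) else 0)
    (computable_boundedSum (get (by norm_num) (var 0)) (fun m env y =>
      boundedSum m (m 1 (env 0)) fun z => if y < z then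
        (if anchored C m (env 1) (env 0) y = 0 then 0
        else follows C m (env 1) (env 2) (env 0) (z + 1)) else 0)
      (computable_boundedSum (get (by norm_num) (var 1)) (fun m env z => if env 0 < z then
        (if anchored C m (env 2) (env 1) (env 0) = 0 then 0
        else follows C m (env 2) (env 3) (env 1) (z + 1)) else 0)
        (ite_lt (var 1) (var 0) (ite_zero (computable_anchored C (var 3) (var 2) (var 1)) (const 0)
          (computable_follows C (var 3) (var 4) (var 2) ((var 0).add (const 1)))) (const 0))))) hX hY

theorem computable_passes (C : ℕ) (hX : PolyTime X) (hY : PolyTime Y) :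
    PolyTime fun m env => passes C m (X m env) (Y m env) := by
  have hw := computable_window C
  have hN := computable_cell 0 2 (by norm_num)
  have hn := computable_cell 0 0 (by norm_num)
  exact ite_le (computable_scale 882 hw hN)
    ((computable_scale 1000 hw (computable_hitCount C hX hY)).const_mul 4)
    (ite_le (computable_scale 100 hw (computable_stretchCount C hX hY))
      ((computable_product hn (computable_product hn (computable_scale 82 hw hN))).const_mul 2)
      (const 1) (const 0)) (const 0)

theorem computable_search (C : ℕ) (hX : PolyTime X) :
    PolyTime fun m env => search C m (X m env) :=
  PolyTime.loop (fun m env b acc => if acc = 0 then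
    (if passes C m (X m env) b = 0 then 0 else b + 1) else acc) (const 0)
    (ite_zero (var 1) (ite_zero (computable_passes C (hX.rename (· + 2)) (var 0)) (const 0)
      ((var 0).add (const 1))) (var 1))

theorem computable_numerator (C : ℕ) (hX : PolyTime X) :
    PolyTime fun m env => numerator C m (X m env) :=
  computable_oneCount C hX ((computable_search C hX).sub (const 1))

theorem computable_denominator (C : ℕ) (hX : PolyTime X) :
    PolyTime fun m env => denominator C m (X m env) :=
  computable_hitCount C hX ((computable_search C hX).sub (const 1))

/-- The visible memory after the estimates of the first `j` entries. -/
def state (C : ℕ) (m : Memory) : ℕ → Memory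
  | 0 => m
  | j + 1 => ((state C m j).write 3 j (numerator C (state C m j) j)).write 4 j
      (denominator C (state C m j) j)

theorem state_of_lt (C : ℕ) (m : Memory) (j : ℕ) {a : ℕ} (ha : a < 3) : state C m j a = m a := by
  induction j with
  | zero => rfl
  | succ j ih =>
    rw [state, Memory.write_of_ne (by omega), Memory.write_of_ne (by omega), ih]

/-- There is a program that computes the estimates one after another, in polynomial time. -/
theorem exists_program (C : ℕ) : ∃ (c : Program) (P : Polynomial ℕ), ∀ s : Memory,
    s = s.visible → s 0 0 ≤ s 0 2 → ∃ (u : Memory) (t : ℕ), Exec c s u t ∧ t ≤ P.eval (s 0 2) ∧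
      u.visible = state C s (s 0 0) := by
  obtain ⟨c₁, P₁, h₁⟩ := computable_numerator C (var 0) (fun _ => 5) 6 (by norm_num)
    (fun _ => by norm_num)
  obtain ⟨c₂, P₂, h₂⟩ := computable_denominator C (var 0) (fun _ => 5) 7 (by norm_num)
    (fun _ => by norm_num)
  set cell : ℕ → Expr := fun a => .get a (.lit 0) with hcell
  set body : Program := .seq c₁ (.seq c₂ (.seq (.set 3 (cell 5) (cell 6))
    (.seq (.set 4 (cell 5) (cell 7)) (.set 5 (.lit 0) (.add (cell 5) (.lit 1)))))) with hbody
  set test : Expr := .sub (cell 0) (cell 5) with htest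
  refine ⟨.loop test body, Polynomial.X * (P₁ + P₂ + 30) + 10, fun s hs hn => ?_⟩
  have key : ∀ r j : ℕ, j + r = s 0 0 → ∀ w : Memory, w.visible = state C s j → w 5 0 = j →
      ∃ u t, Exec (.loop test body) w u t ∧
        t ≤ r * (P₁.eval (s 0 2) + P₂.eval (s 0 2) + 30) + 6 ∧ u.visible = state C s (s 0 0) := by
    intro r
    induction r with
    | zero =>
      intro j hj w hw1 hw2
      have h0 : w 0 0 = s 0 0 := by
        have := congrFun (congrFun hw1 0) 0
        rw [state_of_lt C s j (by norm_num)] at this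
        simpa [Memory.visible] using this
      refine ⟨w, _, .loop_done ?_, ?_, ?_⟩
      · simp only [htest, hcell, Expr.eval]; omega
      · simp [htest, hcell, Expr.cost]
      · rw [hw1, ← hj]; simp
    | succ r ih =>
      intro j hj w hw1 hw2
      have hcells : ∀ i, w 0 i = s 0 i := by
        intro i
        have := congrFun (congrFun hw1 0) i
        rw [state_of_lt C s j (by norm_num)] at this
        simpa [Memory.visible] using this
      obtain ⟨u₁, t₁, a1, a2, a3, a4⟩ := h₁ w
      obtain ⟨u₂, t₂, b1, b2, b3, b4⟩ := h₂ u₁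
      rw [a3 0 (by norm_num), hcells] at b2
      rw [hcells] at a2
      have hv₁ : u₁.visible = w.visible := Memory.visible_congr (by norm_num) a3
      have hv₂ : u₂.visible = u₁.visible := Memory.visible_congr (by norm_num) b3
      simp only [hw1, hw2] at a4
      simp only [hv₁, hw1, a3 5 (by norm_num), hw2] at b4
      have e5 : u₂ 5 0 = j := by rw [b3 5 (by norm_num), a3 5 (by norm_num), hw2]
      have e6 : u₂ 6 0 = numerator C (state C s j) j := by rw [b3 6 (by norm_num), a4]
      have x1 := Exec.set 3 (cell 5) (cell 6) u₂
      have x2 := Exec.set 4 (cell 5) (cell 7)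
        (u₂.write 3 ((cell 5).eval u₂) ((cell 6).eval u₂))
      have x3 := Exec.set 5 (.lit 0) (.add (cell 5) (.lit 1))
        ((u₂.write 3 ((cell 5).eval u₂) ((cell 6).eval u₂)).write 4
          ((cell 5).eval (u₂.write 3 ((cell 5).eval u₂) ((cell 6).eval u₂)))
          ((cell 7).eval (u₂.write 3 ((cell 5).eval u₂) ((cell 6).eval u₂))))
      have hb := Exec.seq a1 (.seq b1 (.seq x1 (.seq x2 x3)))
      have v1 : ∀ a, a ≠ 3 → (cell a).eval (u₂.write 3 ((cell 5).eval u₂) ((cell 6).eval u₂)) =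
          u₂ a 0 := fun a ha => by
        simp only [hcell, Expr.eval]; rw [Memory.write_of_ne ha]
      have v0 : ∀ a, (cell a).eval u₂ = u₂ a 0 := fun a => rfl
      rw [v1 5 (by norm_num), v1 7 (by norm_num), v0, v0, e5, e6, b4] at hb
      generalize hw' : (u₂.write 3 j (numerator C (state C s j) j)).write 4 j
        (denominator C (state C s j) j) = w' at hb
      have hv' : w'.visible = state C s (j + 1) := by
        rw [← hw', Memory.visible_write (by norm_num), Memory.visible_write (by norm_num), hv₂, hv₁,
          hw1]
        rfl
      have e5' : w' 5 0 = j := by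
        rw [← hw', Memory.write_of_ne (by norm_num), Memory.write_of_ne (by norm_num), e5]
      obtain ⟨u', t', k1, k2, k3⟩ := ih (j + 1) (by omega)
        (w'.write 5 ((Expr.lit 0).eval w') ((Expr.add (cell 5) (.lit 1)).eval w'))
        ((Memory.visible_write_of_le le_rfl).trans hv')
        ((Memory.write_self _ _ _ _).trans (by simp only [hcell, Expr.eval]; rw [e5']))
      refine ⟨u', _, .loop_step ?_ hb k1, ?_, k3⟩
      · simp only [htest, hcell, Expr.eval]; rw [hcells, hw2]; omega
      · have z1 : ∀ a, (cell a).cost = 2 := fun _ => rfl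
        simp only [htest, z1, Expr.cost, add_mul, one_mul]
        omega
  -- Array 5 is not visible, so `s = s.visible` makes the counter start at zero.
  by_cases h5 : s 5 0 = 0
  · obtain ⟨u, t, k1, k2, k3⟩ := key (s 0 0) 0 (by omega) s hs.symm h5
    refine ⟨u, t, k1, ?_, k3⟩
    simp only [Polynomial.eval_add, Polynomial.eval_mul, Polynomial.eval_X, Polynomial.eval_ofNat]
    have := Nat.mul_le_mul_right (P₁.eval (s 0 2) + P₂.eval (s 0 2) + 30) hn
    omega
  · exact absurd (by rw [hs]; simp [Memory.visible]) h5

end Algorithm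

/-! ### The quantities that the algorithm computes -/

namespace Algorithm

variable {m : Memory}

/-- The cut-off is harmless as soon as the number of traces is at least the intended number of
terms. -/
theorem boundedSum_eq {x : ℕ} (hx : x ≤ m 0 2) (f : ℕ → ℕ) :
    boundedSum m x f = ∑ v ∈ Finset.range x, f v := by
  rw [boundedSum, ← Finset.sum_filter]
  refine Finset.sum_congr ?_ fun _ _ => rfl
  ext v
  simp only [Finset.mem_filter, Finset.mem_range]
  omega

theorem boundedIterate_eq {x : ℕ} (hx : x ≤ m 0 2) (f : ℕ → ℕ) (y : ℕ) :
    boundedIterate m x f y = f^[x] y := by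
  have key : ∀ N : ℕ, (Nat.rec y (fun v acc => if v < x then f acc else acc) N : ℕ) =
      f^[min x N] y := by
    intro N
    induction N with
    | zero => simp
    | succ N ih =>
      simp only [ih]
      split_ifs with h
      · rw [min_eq_right h.le, min_eq_right h, Function.iterate_succ_apply']
      · rw [min_eq_left (by omega), min_eq_left (by omega)]
  rw [boundedIterate, key, min_eq_left hx]

theorem product_eq {x : ℕ} (hx : x ≤ m 0 2) (y : ℕ) : product m x y = x * y := by
  simp [product, boundedSum_eq hx]

theorem scale_eq {x : ℕ} (hx : x ≤ m 0 2) (q y : ℕ) : scale q m x y = q ^ x * y := by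
  rw [scale, boundedIterate_eq hx, mul_left_iterate]

theorem count_lt {x N : ℕ} (hx : x ≤ N) :
    (∑ v ∈ Finset.range N, if v < x then 1 else 0) = x := by
  rw [← Finset.sum_filter, Finset.sum_const, smul_eq_mul, mul_one]
  conv_rhs => rw [← Finset.card_range x]
  congr 1
  ext v
  simp only [Finset.mem_filter, Finset.mem_range]
  omega

theorem bitLength_eq (h : Nat.size (m 0 0 + m 0 1) ≤ m 0 2) :
    bitLength m = Nat.size (m 0 0 + m 0 1) := by
  conv_rhs => rw [← count_lt h]
  refine Finset.sum_congr rfl fun v hv => ?_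
  rw [scale_eq (Finset.mem_range.1 hv).le, mul_one]
  simp only [Nat.lt_size]

theorem third_eq {x : ℕ} (hx : x ≤ m 0 2) : third m x = x / 3 := by
  conv_rhs => rw [← count_lt ((Nat.div_le_self x 3).trans hx)]
  refine Finset.sum_congr rfl fun v _ => ?_
  have : 3 * (v + 1) ≤ x ↔ v < x / 3 := by omega
  simp only [this]

theorem digit_eq {b l : ℕ} (hb : b ≤ m 0 2) (hl : l ≤ m 0 2) : digit m b l = b / 3 ^ l % 3 := by
  have key : ∀ l, (third m)^[l] b = b / 3 ^ l := by
    intro l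
    induction l with
    | zero => simp
    | succ l ih =>
      rw [Function.iterate_succ_apply', ih, third_eq ((Nat.div_le_self _ _).trans hb),
        Nat.div_div_eq_div_mul, pow_succ]
  rw [digit, boundedIterate_eq hl, key, third_eq ((Nat.div_le_self _ _).trans hb)]
  omega

/-- Patterns are words in three symbols, hence base-three expansions with the least significant
digit first; looping over numbers below `3 ^ h` exhausts them. -/
theorem exists_digits (B : List ℕ) (hB : ∀ s ∈ B, s < 3) :
    ∃ b < 3 ^ B.length, ∀ l < B.length, b / 3 ^ l % 3 = B.getD l 0 := by
  induction B with
  | nil => exact ⟨0, by simp, by simp⟩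
  | cons s B ih =>
    obtain ⟨b, hb, h⟩ := ih fun x hx => hB x (List.mem_cons_of_mem _ hx)
    have hs := hB s List.mem_cons_self
    refine ⟨s + 3 * b, ?_, ?_⟩
    · rw [List.length_cons, pow_succ]; omega
    · intro l hl
      cases l with
      | zero => simp; omega
      | succ l =>
        rw [pow_succ', ← Nat.div_div_eq_div_mul, show (s + 3 * b) / 3 = b by omega]
        simpa using h l (by simpa using hl)

theorem misfit_eq_zero {s : ℕ} {b : Bool} : misfit s b.toNat = 0 ↔ Fits s b := by
  unfold misfit Fits
  split_ifs with h1 h2 <;> simp_all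

/-- The accumulator is zero until the first success `b` and then stays `b + 1`; the shift separates
pattern number 0 from no success. -/
theorem search_spec {C i b : ℕ} (hb : b < m 0 2) (h : passes C m i b ≠ 0) :
    search C m i - 1 < m 0 2 ∧ passes C m i (search C m i - 1) ≠ 0 := by
  have key : ∀ N : ℕ, let r : ℕ := Nat.rec 0 (fun b acc => if acc = 0 then
      (if passes C m i b = 0 then 0 else b + 1) else acc) N
      (r = 0 ∧ ∀ b < N, passes C m i b = 0) ∨ (0 < r ∧ r ≤ N ∧ passes C m i (r - 1) ≠ 0) := by
    intro N
    induction N with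
    | zero => simp
    | succ N ih =>
      simp only at ih ⊢
      rcases ih with ⟨h0, h1⟩ | ⟨h0, h1, h2⟩
      · rw [if_pos h0]
        by_cases hN : passes C m i N = 0
        · left
          refine ⟨if_pos hN, fun b hb => ?_⟩
          rcases Nat.lt_succ_iff_lt_or_eq.1 hb with hb | rfl
          · exact h1 b hb
          · exact hN
        · right
          rw [if_neg hN]
          exact ⟨by omega, le_rfl, by simpa using hN⟩
      · right
        rw [if_neg (by omega)]
        exact ⟨h0, by omega, h2⟩
  rcases key (m 0 2) with ⟨-, h1⟩ | ⟨h0, h1, h2⟩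
  · exact absurd (h1 b hb) h
  · change 0 < search C m i at h0
    change search C m i ≤ _ at h1
    exact ⟨by omega, h2⟩

/-- The memory holds the input `n`, `k` and `X`. -/
structure Holds (n k : ℕ) (X : List (List Bool)) (m : Memory) : Prop where
  size : m 0 0 = n
  accuracy : m 0 1 = k
  number : m 0 2 = X.length
  length : ∀ t, m 1 t = (X.getD t []).length
  bits : ∀ t j, j < n → m 2 (n * t + j) = ((X.getD t []).getD j false).toNat

theorem holds_inputMemory (n k : ℕ) (X : List (List Bool)) : Holds n k X (inputMemory n k X) where
  size := rfl
  accuracy := rfl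
  number := rfl
  length t := rfl
  bits t j hj := by
    have e1 : (n * t + j) / n = t := by
      rw [Nat.mul_add_div (by omega), Nat.div_eq_of_lt hj, add_zero]
    have e2 : (n * t + j) % n = j := by rw [Nat.mul_add_mod, Nat.mod_eq_of_lt hj]
    simp only [inputMemory, e1, e2]

theorem Holds.state {n k : ℕ} {X : List (List Bool)} (hm : Holds n k X m) (C j : ℕ) :
    Holds n k X (state C m j) := by
  constructor
  all_goals simp only [state_of_lt C m j (a := 0) (by norm_num),
    state_of_lt C m j (a := 1) (by norm_num), state_of_lt C m j (a := 2) (by norm_num)]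
  exacts [hm.size, hm.accuracy, hm.number, hm.length, hm.bits]

/-- The pattern that is read from the estimates of the entries before entry `i`. -/
def precedingPattern (m : Memory) (h i : ℕ) : List ℕ :=
  (List.range h).map fun l => estimateSymbol m (i - 1 - l)

/-- The pattern with number `b`. -/
def followingPattern (m : Memory) (h b : ℕ) : List ℕ := (List.range h).map (digit m b)

theorem anchored_eq_one {C i t y : ℕ} (h : anchored C m i t y ≠ 0) : anchored C m i t y = 1 := by
  unfold anchored at h ⊢
  split_ifs at h ⊢ <;> simp_all

section holds

variable {n k C : ℕ} {X : List (List Bool)} (hm : Holds n k X m)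
  (hX : ∀ t, (X.getD t []).length ≤ n) (hn : n ≤ X.length) (hh : window C m ≤ X.length)
include hm

theorem followLength_eq (i : ℕ) : followLength C m i = min (window C m) (n - 1 - i) := by
  rw [followLength, hm.size]
  split_ifs <;> omega

theorem bit_eq (hn : n ≤ X.length) {t j : ℕ} (hj : j < n) :
    bit m t j = ((X.getD t []).getD j false).toNat := by
  rw [bit, product_eq (by rw [hm.size, hm.number]; exact hn), hm.size, hm.bits _ _ hj]

include hn hh

/-- The machine compares the powers of 882/1000 and 82/100 with denominators cleared. -/
theorem passes_iff (i b : ℕ) : passes C m i b ≠ 0 ↔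
    (882 : ℝ) ^ window C m * X.length ≤ 4 * (1000 ^ window C m * hitCount C m i b) ∧
    (100 : ℝ) ^ window C m * stretchCount C m i b ≤
      2 * (n * (n * (82 ^ window C m * X.length))) := by
  have h1 : window C m ≤ m 0 2 := by rw [hm.number]; exact hh
  have h2 : n ≤ m 0 2 := by rw [hm.number]; exact hn
  unfold passes
  simp only [hm.size, scale_eq h1, product_eq h2, hm.number]
  constructor
  · intro h
    split_ifs at h with a1 a2
    · exact ⟨by exact_mod_cast a1, by exact_mod_cast a2⟩
    all_goals simp at h
  · rintro ⟨a1, a2⟩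
    rw [if_pos (by exact_mod_cast a1), if_pos (by exact_mod_cast a2)]
    norm_num

include hX

theorem follows_eq (i b t : ℕ) {z : ℕ} (hz : z ≤ (X.getD t []).length) :
    (follows C m i b t z : ℝ) =
      matchInd (followingPattern m (followLength C m i) b) ((X.getD t []).drop z) := by
  have hf : followLength C m i ≤ m 0 2 := by
    rw [followLength_eq hm, hm.number]; exact (min_le_left _ _).trans hh
  have hT := hX t
  have hlen := hm.length t
  set T := X.getD t [] with hTdef
  have e : Matches (followingPattern m (followLength C m i) b) (T.drop z) ↔
      z + followLength C m i ≤ m 1 t ∧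
      boundedSum m (followLength C m i) (fun l => misfit (digit m b l) (bit m t (z + l))) = 0 := by
    rw [matches_iff, boundedSum_eq hf, Finset.sum_eq_zero_iff, hlen]
    simp only [followingPattern, List.length_map, List.length_range, List.length_drop,
      Finset.mem_range]
    have e1 : followLength C m i ≤ T.length - z ↔ z + followLength C m i ≤ T.length := by omega
    rw [e1]
    refine and_congr_right fun h1 => forall₂_congr fun l hl => ?_
    rw [bit_eq hm hn (by omega), misfit_eq_zero, ← hTdef]
    simp [List.getD_eq_getElem?_getD, hl, List.getElem?_drop]
  unfold follows matchInd
  simp only [e]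
  by_cases h1 : z + followLength C m i ≤ m 1 t
  · simp only [h1, true_and, if_true]
    split_ifs <;> simp
  · simp [h1]

theorem anchored_eq (i t : ℕ) {y : ℕ} (hy : y ≤ (X.getD t []).length) :
    (anchored C m i t y : ℝ) =
      anchor (window C m) i (precedingPattern m (window C m) i) ((X.getD t []).take y) := by
  have hT := hX t
  set T := X.getD t [] with hTdef
  have hl : (T.take y).length = y := by rw [List.length_take]; omega
  unfold anchored anchor
  rw [hl]
  by_cases hi : i < window C m
  · simp [hi]
  rw [if_neg hi, if_neg hi]
  have e : Matches (precedingPattern m (window C m) i) (T.take y).reverse ↔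
      window C m ≤ y ∧ boundedSum m (window C m)
        (fun l => misfit (estimateSymbol m (i - 1 - l)) (bit m t (y - 1 - l))) = 0 := by
    rw [matches_iff, boundedSum_eq (by rw [hm.number]; exact hh), Finset.sum_eq_zero_iff]
    simp only [precedingPattern, List.length_map, List.length_range, List.length_reverse, hl,
      Finset.mem_range]
    refine and_congr_right fun h1 => forall₂_congr fun l hl => ?_
    rw [bit_eq hm hn (by omega), misfit_eq_zero, ← hTdef]
    have e2 : (T.take y).reverse.getD l false = T.getD (y - 1 - l) false := by
      rw [List.getD_eq_getElem?_getD, List.getElem?_reverse (by omega), List.getD_eq_getElem?_getD,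
        List.getElem?_take, ‹(T.take y).length = y›, if_pos (by omega)]
    rw [e2]
    simp [List.getD_eq_getElem?_getD, hl]
  unfold matchInd
  simp only [e]
  split_ifs <;> simp_all

theorem hitCount_eq (i b : ℕ) : (hitCount C m i b : ℝ) =
    ∑ t ∈ Finset.range X.length, hits (window C m) i (precedingPattern m (window C m) i)
      (followingPattern m (followLength C m i) b) (X.getD t []) := by
  rw [hitCount, hm.number, Nat.cast_sum]
  refine Finset.sum_congr rfl fun t _ => ?_
  rw [hm.length, boundedSum_eq (by rw [hm.number]; exact (hX t).trans hn), Nat.cast_sum, hits,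
    splitSum]
  refine Finset.sum_congr rfl fun y hy => ?_
  have hy := Finset.mem_range.1 hy
  rw [← anchored_eq hm hX hn hh i t hy.le, ← follows_eq hm hX hn hh i b t hy]
  split_ifs with h0 <;> simp only [h0, Nat.cast_zero, zero_mul, mul_one]
  rw [anchored_eq_one h0, Nat.cast_one, one_mul]

theorem oneCount_eq (i b : ℕ) : (oneCount C m i b : ℝ) =
    ∑ t ∈ Finset.range X.length, ones (window C m) i (precedingPattern m (window C m) i)
      (followingPattern m (followLength C m i) b) (X.getD t []) := by
  rw [oneCount, hm.number, Nat.cast_sum]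
  refine Finset.sum_congr rfl fun t _ => ?_
  rw [hm.length, boundedSum_eq (by rw [hm.number]; exact (hX t).trans hn), Nat.cast_sum, ones,
    splitSum]
  refine Finset.sum_congr rfl fun y hy => ?_
  have hy := Finset.mem_range.1 hy
  rw [← anchored_eq hm hX hn hh i t hy.le, ← follows_eq hm hX hn hh i b t hy,
    bit_eq hm hn (hy.trans_le (hX t))]
  split_ifs with h0 h1 h1 <;> simp_all [anchored_eq_one]

theorem stretchCount_eq (i b : ℕ) : (stretchCount C m i b : ℝ) =
    ∑ t ∈ Finset.range X.length, stretches n (window C m) i (precedingPattern m (window C m) i)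
      (followingPattern m (followLength C m i) b) (X.getD t []) := by
  rw [stretchCount, hm.number, Nat.cast_sum]
  refine Finset.sum_congr rfl fun t _ => ?_
  have hT := hX t
  have hTN : (X.getD t []).length ≤ m 0 2 := by rw [hm.number]; exact hT.trans hn
  rw [hm.length, boundedSum_eq hTN, Nat.cast_sum, stretches]
  simp only [splitSum]
  rw [Finset.sum_comm]
  refine Finset.sum_congr rfl fun y hy => ?_
  have hy := Finset.mem_range.1 hy
  rw [boundedSum_eq hTN, Nat.cast_sum, ← anchored_eq hm hX hn hh i t hy.le, mul_one,
    ← Finset.mul_sum]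
  have e1 : ∀ z ∈ Finset.range (X.getD t []).length,
      ((if y < z then (if anchored C m i t y = 0 then 0 else follows C m i b t (z + 1)) else 0 : ℕ) : ℝ)
        = anchored C m i t y * if y < z then matchInd (followingPattern m (followLength C m i) b)
          ((X.getD t []).drop (z + 1)) else 0 := by
    intro z hz
    rw [← follows_eq hm hX hn hh i b t (Finset.mem_range.1 hz)]
    split_ifs <;> simp_all [anchored_eq_one]
  rw [Finset.sum_congr rfl e1, ← Finset.mul_sum]
  congr 1
  set T := X.getD t []
  set B := followingPattern m (followLength C m i) b
  -- The wildcard demands only that the bit at `y + 1 + d` exists.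
  have e2 : ∀ d, matchInd (2 :: B) ((T.drop (y + 1)).drop d) =
      if y + 1 + d < T.length then matchInd B (T.drop (y + 1 + d + 1)) else 0 := by
    intro d
    rw [List.drop_drop]
    split_ifs with h
    · have h2 : Fits 2 T[y + 1 + d] := Or.inr le_rfl
      rw [List.drop_eq_getElem_cons h, matchInd_cons, if_pos h2, one_mul]
    · rw [List.drop_of_length_le (by omega)]
      simp [matchInd, Matches]
  simp only [e2]
  rw [← Finset.sum_filter, ← Finset.sum_filter]
  -- The program sums over the place `z` of the wildcard, the statistic over the gap `d`, with `z =
  -- y + 1 + d`.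
  refine Finset.sum_bij' (fun z _ => z - (y + 1)) (fun d _ => y + 1 + d) ?_ ?_ ?_ ?_ ?_
  all_goals simp only [Finset.mem_filter, Finset.mem_range]
  · intro z hz; omega
  · intro d hd; omega
  · intro z hz; omega
  · intro d hd; omega
  · intro z hz; rw [Nat.add_sub_cancel' (by omega : y + 1 ≤ z)]

end holds

end Algorithm

/-! ### Correctness on typical traces -/

/-- All empirical means of the statistics are close to their expectations. -/
def Typical (δ : ℝ) (h : ℕ) (S : List ℝ) (X : List (List Bool)) : Prop :=
  ∀ i < S.length, ∀ A B : List ℕ, A.length = h → (∀ s ∈ A, s < 3) →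
    B.length = min h (S.length - 1 - i) → (∀ s ∈ B, s < 3) →
    ∀ φ ∈ [hits h i A B, ones h i A B, stretches S.length h i A B],
      |(∑ t ∈ Finset.range X.length, φ (X.getD t [])) / X.length - traceMean δ S φ| ≤ (82 / 100) ^ h

namespace Algorithm

variable {n k C : ℕ} {X : List (List Bool)} {m : Memory}

theorem Holds.window_eq (hm : Holds n k X m) (hs : Nat.size (n + k) ≤ X.length) :
    window C m = C * Nat.size (n + k) := by
  rw [window, bitLength_eq (by rw [hm.size, hm.accuracy, hm.number]; exact hs), hm.size, hm.accuracy]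

theorem estimateSymbol_lt (m : Memory) (l : ℕ) : estimateSymbol m l < 3 := by
  unfold estimateSymbol; split_ifs <;> norm_num

/-- The estimate of an entry is close to it if the preceding pattern is compatible. -/
theorem abs_numerator_div_denominator_sub_le {δ : ℝ} (h0 : 0 ≤ δ) (h1 : δ ≤ 1 / 10 ^ 7)
    {S : List ℝ} (hS : IsProb S) {h i : ℕ} (hgood : Good δ h S) (hgood' : Good δ h S.reverse)
    (hm : Holds S.length k X m) (hX : ∀ t, (X.getD t []).length ≤ S.length)
    (hn : S.length ≤ X.length) (hw : window C m = h) (hN : 3 ^ h ≤ X.length)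
    (hh : (82 / 100 : ℝ) ^ h ≤ (882 / 1000) ^ h / 4)
    (htyp : Typical δ h S X) (hi : i < S.length)
    (hA : h ≤ i → Compatible h i S (precedingPattern m h i)) :
    0 < denominator C m i ∧
      |(numerator C m i : ℝ) / denominator C m i - S.getD i 0| ≤
        32 * (S.length : ℝ) ^ 3 * (99 / 100) ^ h := by
  have hhX : h ≤ X.length := (Nat.lt_pow_self (by norm_num)).le.trans hN
  have hwX : window C m ≤ X.length := hw.trans_le hhX
  have hN0 : (0 : ℝ) < X.length := by exact_mod_cast (show 0 < X.length by omega)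
  have hn1 : (1 : ℝ) ≤ S.length := by exact_mod_cast (show 1 ≤ S.length by omega)
  have hf : followLength C m i = min h (S.length - 1 - i) := by rw [followLength_eq hm, hw]
  have hAl : (precedingPattern m h i).length = h := by simp [precedingPattern]
  have hA3 : ∀ s ∈ precedingPattern m h i, s < 3 := by
    intro s hs
    obtain ⟨l, -, rfl⟩ := List.mem_map.1 hs
    exact estimateSymbol_lt m _
  -- `Typical` holds for all patterns at once, in particular for the anchor read from estimates made
  -- with the same traces.
  have stats : ∀ b < X.length, ∀ B, B = followingPattern m (followLength C m i) b →
      |(hitCount C m i b : ℝ) / X.length - traceMean δ S (hits h i (precedingPattern m h i) B)|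
        ≤ (82 / 100) ^ h ∧
      |(oneCount C m i b : ℝ) / X.length - traceMean δ S (ones h i (precedingPattern m h i) B)|
        ≤ (82 / 100) ^ h ∧
      |(stretchCount C m i b : ℝ) / X.length -
        traceMean δ S (stretches S.length h i (precedingPattern m h i) B)| ≤ (82 / 100) ^ h := by
    rintro b hb B rfl
    have hB : ∀ s ∈ followingPattern m (followLength C m i) b, s < 3 := by
      intro s hs
      obtain ⟨l, hl, rfl⟩ := List.mem_map.1 hs
      have hl := List.mem_range.1 hl
      rw [digit_eq (by rw [hm.number]; exact hb.le) (by rw [hm.number]; omega)]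
      exact Nat.mod_lt _ (by norm_num)
    have key := htyp i hi _ (followingPattern m (followLength C m i) b) hAl hA3
      (by simp [followingPattern, hf]) hB
    have e1 := hitCount_eq hm hX hn hwX i b
    have e2 := oneCount_eq hm hX hn hwX i b
    have e3 := stretchCount_eq hm hX hn hwX i b
    rw [hw] at e1 e2 e3
    rw [e1, e2, e3]
    exact ⟨key _ (by simp), key _ (by simp), key _ (by simp)⟩
  have hpass : ∀ b, passes C m i b ≠ 0 ↔
      (882 / 1000 : ℝ) ^ h / 4 ≤ hitCount C m i b / X.length ∧
      (stretchCount C m i b : ℝ) / X.length ≤ 2 * (S.length : ℝ) ^ 2 * (82 / 100) ^ h := by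
    intro b
    rw [passes_iff hm hn hwX, hw]
    refine and_congr ?_ ?_
    · rw [div_pow, div_div, div_le_div_iff₀ (by positivity) hN0]
      constructor <;> intro h <;> linarith
    · rw [div_pow, mul_div_assoc', div_le_div_iff₀ hN0 (by positivity)]
      constructor <;> intro h <;> linarith
  -- The true following pattern passes, so the search ends with some passing pattern. It may be a
  -- different one, and nothing but the test is used about it.
  obtain ⟨B, hB1, hB2, hB3, hB4⟩ := traceMean_following_pattern h0 h1 hS hi hgood hgood' hA
  obtain ⟨b, hb1, hb2⟩ := exists_digits B hB2
  have hbX : b < X.length := by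
    refine hb1.trans_le (le_trans (Nat.pow_le_pow_right (by norm_num) ?_) hN)
    rw [hB1]; exact min_le_left _ _
  have hBb : B = followingPattern m (followLength C m i) b := by
    refine List.ext_getElem (by simp [followingPattern, hf, hB1]) fun l hl hl' => ?_
    have hl2 : l ≤ X.length := by rw [hB1] at hl; omega
    have hd := digit_eq (m := m) (b := b) (l := l) (by rw [hm.number]; exact hbX.le)
      (by rw [hm.number]; exact hl2)
    have := hb2 l hl
    rw [List.getD_eq_getElem _ _ hl] at this
    simp only [followingPattern, List.getElem_map, List.getElem_range]
    rw [hd, this]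
  have hpb : passes C m i b ≠ 0 := by
    obtain ⟨s1, -, s3⟩ := stats b hbX B hBb
    rw [abs_le] at s1 s3
    have hτ : (0 : ℝ) < (82 / 100) ^ h := by positivity
    refine (hpass b).2 ⟨by linarith [s1.1], ?_⟩
    have : (1 : ℝ) ≤ (S.length : ℝ) ^ 2 := one_le_pow₀ hn1
    nlinarith [s3.2]
  obtain ⟨c1, c2⟩ := search_spec (by rw [hm.number]; exact hbX) hpb
  rw [hm.number] at c1
  obtain ⟨s1, s2, s3⟩ := stats _ c1 _ rfl
  obtain ⟨p1, p2⟩ := (hpass _).1 c2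
  have key := estimate_error h0 h1 hS hi hgood' hA s1 s2 s3 p1 p2
  rw [div_div_div_cancel_right₀ hN0.ne'] at key
  refine ⟨?_, key⟩
  have h3 : (0 : ℝ) < (882 / 1000) ^ h / 4 := by positivity
  have h4 := h3.trans_le p1
  rw [lt_div_iff₀ hN0, zero_mul] at h4
  exact_mod_cast h4

theorem state_of_le (C : ℕ) (m : Memory) {l j : ℕ} (h : l < j) :
    state C m j 3 l = numerator C (state C m l) l ∧
      state C m j 4 l = denominator C (state C m l) l := by
  induction j with
  | zero => omega
  | succ j ih =>
    rcases Nat.lt_succ_iff_lt_or_eq.1 h with hl | rfl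
    · rw [← (ih hl).1, ← (ih hl).2]
      have : l ≠ j := hl.ne
      simp [state, Memory.write, this]
    · simp [state, Memory.write]

/-- The thresholds 0.805 and 0.195 lie midway between those of `symbol` (0.81, 0.19) and those of
`confidence` (0.8, 0.2). With an error of at most 1/200, every confident entry gets its true symbol,
and an entry gets the symbol 1 or 0 only if it is at least 0.8 or at most 0.2. -/
theorem compatible_precedingPattern {S : List ℝ} {h i : ℕ} (hh : h ≤ i) (hi : i ≤ S.length)
    (hest : ∀ l < i, 0 < m 4 l ∧ |(m 3 l : ℝ) / m 4 l - S.getD l 0| ≤ 1 / 200) :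
    Compatible h i S (precedingPattern m h i) := by
  have key : ∀ l < i, confidence (S.getD l 0) ≤ fitProb (S.getD l 0) (estimateSymbol m l) ∧
      (estimateSymbol m l = symbol (S.getD l 0) ∨ 2 ≤ symbol (S.getD l 0)) := by
    intro l hl
    obtain ⟨a1, a2⟩ := hest l hl
    have h4 : (0 : ℝ) < m 4 l := by exact_mod_cast a1
    set p := S.getD l 0
    set x : ℝ := (m 3 l : ℝ) / m 4 l with hx
    have c1 : 805 * m 4 l ≤ 1000 * m 3 l ↔ 805 / 1000 ≤ x := by
      rw [hx, div_le_div_iff₀ (by norm_num) h4, ← Nat.cast_le (α := ℝ)]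
      push_cast
      constructor <;> intro h <;> linarith
    have c2 : 1000 * m 3 l ≤ 195 * m 4 l ↔ x ≤ 195 / 1000 := by
      rw [hx, div_le_div_iff₀ h4 (by norm_num), ← Nat.cast_le (α := ℝ)]
      push_cast
      constructor <;> intro h <;> linarith
    rw [abs_le] at a2
    unfold estimateSymbol confidence symbol
    simp only [c1, c2]
    split_ifs <;> simp only [fitProb_one, fitProb_zero, fitProb_of_two_le _ le_rfl] <;>
      constructor <;> first | linarith | norm_num
  have hlen : ((S.take i).reverse.take h).length = h := by simp; omega
  have hlen' : (precedingPattern m h i).length = h := by simp [precedingPattern]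
  have hget : ∀ l (hl : l < h), ((S.take i).reverse.take h)[l]'(by omega) = S.getD (i - 1 - l) 0 := by
    intro l hl
    have : i - 1 - l < S.length := by omega
    rw [List.getElem_take, List.getElem_reverse, List.getElem_take, List.getD_eq_getElem _ _ this]
    congr 1
    simp; omega
  have hget' : ∀ l (hl : l < h), (precedingPattern m h i)[l]'(by omega) =
      estimateSymbol m (i - 1 - l) := fun l hl => by simp [precedingPattern]
  constructor
  · refine List.forall₂_iff_get.2 ⟨by omega, fun l h1 h2 => ?_⟩
    have hl : l < h := by omega
    simp only [List.get_eq_getElem, hget l hl, hget' l hl]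
    exact (key _ (by omega)).1
  · refine List.forall₂_iff_get.2 ⟨by omega, fun l h1 h2 => ?_⟩
    have hl : l < h := by omega
    simp only [List.get_eq_getElem, hget l hl, hget' l hl]
    exact (key _ (by omega)).2

/-- All estimates are close to the entries. -/
theorem abs_state_sub_le {δ : ℝ} (h0 : 0 ≤ δ) (h1 : δ ≤ 1 / 10 ^ 7)
    {S : List ℝ} (hS : IsProb S) {h : ℕ} (hgood : Good δ h S) (hgood' : Good δ h S.reverse)
    (hm : Holds S.length k X m) (hX : ∀ t, (X.getD t []).length ≤ S.length)
    (hn : S.length ≤ X.length) (hs : Nat.size (S.length + k) ≤ X.length)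
    (hw : C * Nat.size (S.length + k) = h) (hN : 3 ^ h ≤ X.length)
    (hh : (82 / 100 : ℝ) ^ h ≤ (882 / 1000) ^ h / 4)
    (herr : 32 * (S.length : ℝ) ^ 3 * (99 / 100) ^ h ≤ 1 / 200)
    (htyp : Typical δ h S X) {i : ℕ} (hi : i < S.length) :
    |(state C m S.length 3 i : ℝ) / state C m S.length 4 i - S.getD i 0| ≤
      32 * (S.length : ℝ) ^ 3 * (99 / 100) ^ h := by
  have key : ∀ i < S.length, 0 < denominator C (state C m i) i ∧
      |(numerator C (state C m i) i : ℝ) / denominator C (state C m i) i - S.getD i 0| ≤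
        32 * (S.length : ℝ) ^ 3 * (99 / 100) ^ h := by
    intro i
    -- Earlier estimates enter only through their rounded symbols, so every new estimate obeys the
    -- same bound as the earlier ones.
    induction i using Nat.strong_induction_on with
    | _ i ih =>
      intro hi
      have hmi := hm.state C i
      refine abs_numerator_div_denominator_sub_le h0 h1 hS hgood hgood' hmi hX hn
        (by rw [hmi.window_eq hs, hw]) hN hh htyp hi fun hhi => ?_
      refine compatible_precedingPattern hhi hi.le fun l hl => ?_
      obtain ⟨b1, b2⟩ := ih l hl (hl.trans hi)
      rw [(state_of_le C m hl).1, (state_of_le C m hl).2]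
      exact ⟨b1, b2.trans herr⟩
  rw [(state_of_le C m hi).1, (state_of_le C m hi).2]
  exact (key i hi).2

end Algorithm

/-! ### Concentration of the empirical means -/

theorem sum_traces {n N : ℕ} (ω : Fin N → Flips n) (φ : List Bool → ℝ) :
    ∑ t ∈ Finset.range (traces ω).length, φ ((traces ω).getD t []) = ∑ t, φ (trace (ω t)) := by
  have hl : (traces ω).length = N := List.length_ofFn
  rw [hl, Finset.sum_range]
  refine Finset.sum_congr rfl fun t _ => ?_
  rw [List.getD_eq_getElem _ _ (by rw [hl]; exact t.2)]
  simp [traces]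

theorem exists_ofFn {h : ℕ} {A : List ℕ} (hA : A.length ≤ h) (hA3 : ∀ s ∈ A, s < 3) :
    ∃ f : Fin h → Fin 3, A = (List.ofFn fun l => (f l : ℕ)).take A.length := by
  refine ⟨fun l => ⟨A.getD l 0, ?_⟩, List.ext_getElem (by simp [hA]) fun l h1 h2 => ?_⟩
  · by_cases hl : (l : ℕ) < A.length
    · rw [List.getD_eq_getElem _ _ hl]; exact hA3 _ (List.getElem_mem hl)
    · rw [List.getD_eq_default _ _ (by omega)]; norm_num
  · simp [h1]

/-- Chebyshev's inequality for each of at most `3 * n * 9 ^ h` statistics, all bounded by `n ^ 2`.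
The union bound covers all patterns because the anchors actually used are functions of the traces.
-/
theorem sampleLaw_not_typical_le (δ : unitInterval) {n : ℕ} (p : Fin n → unitInterval) {N : ℕ}
    (hN : 0 < N) (h : ℕ) :
    sampleLaw δ p N {ω | ¬Typical δ h (entries p) (traces ω)} ≤
      ENNReal.ofReal (3 * (n : ℝ) ^ 5 * 16 ^ h / N) := by
  have hlen : (entries p).length = n := List.length_ofFn
  have hN0 : (0 : ℝ) < N := by exact_mod_cast hN
  set τ : ℝ := (82 / 100) ^ h with hτ
  have hτ0 : 0 < τ := by positivity
  let pat : (Fin h → Fin 3) → List ℕ := fun f => List.ofFn fun l => (f l : ℕ)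
  let Φ : Fin n × (Fin h → Fin 3) × (Fin h → Fin 3) × Fin 3 → List Bool → ℝ := fun x =>
    ![hits h x.1 (pat x.2.1) ((pat x.2.2.1).take (min h (n - 1 - x.1))),
      ones h x.1 (pat x.2.1) ((pat x.2.2.1).take (min h (n - 1 - x.1))),
      stretches n h x.1 (pat x.2.1) ((pat x.2.2.1).take (min h (n - 1 - x.1)))] x.2.2.2
  have hΦ : ∀ x, ∀ T : List Bool, T.length ≤ n → 0 ≤ Φ x T ∧ Φ x T ≤ (n : ℝ) ^ 2 := by
    rintro ⟨i, f, g, c⟩ T hT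
    have hn : (n : ℝ) ≤ (n : ℝ) ^ 2 := by
      have := i.pos
      exact_mod_cast Nat.le_self_pow (by norm_num) n
    fin_cases c
    · exact ⟨(hits_mem _ _ _ _ hT).1, (hits_mem _ _ _ _ hT).2.trans hn⟩
    · exact ⟨(ones_mem _ _ _ _ hT).1, (ones_mem _ _ _ _ hT).2.trans hn⟩
    · exact stretches_mem _ _ _ _ hT
  have hsub : {ω : Fin N → Flips n | ¬Typical δ h (entries p) (traces ω)} ⊆
      ⋃ x, {ω | N * τ ≤ |∑ t, Φ x (trace (ω t)) - N * traceMean δ (entries p) (Φ x)|} := by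
    intro ω hω
    by_contra hcon
    simp only [Set.mem_iUnion, Set.mem_ofPred_eq, not_exists, not_le] at hcon
    refine hω fun i hi A B hA hA3 hB hB3 φ hφ => ?_
    rw [hlen] at hi hB hφ
    obtain ⟨f, hf⟩ := exists_ofFn hA.le hA3
    obtain ⟨g, hg⟩ := exists_ofFn (h := h) (by rw [hB]; exact min_le_left _ _) hB3
    rw [hA, List.take_of_length_le (by simp)] at hf
    rw [hB] at hg
    obtain ⟨c, hc⟩ : ∃ c, φ = Φ (⟨i, hi⟩, f, g, c) := by
      simp only [List.mem_cons, List.not_mem_nil, or_false] at hφ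
      rcases hφ with rfl | rfl | rfl
      · exact ⟨0, by simp only [Φ, pat, ← hf, ← hg]; rfl⟩
      · exact ⟨1, by simp only [Φ, pat, ← hf, ← hg]; rfl⟩
      · exact ⟨2, by simp only [Φ, pat, ← hf, ← hg]; rfl⟩
    have key := hcon (⟨i, hi⟩, f, g, c)
    rw [← hc] at key
    rw [sum_traces, show (traces ω).length = N from List.length_ofFn]
    have e : (∑ t, φ (trace (ω t))) / N - traceMean δ (entries p) φ =
        (∑ t, φ (trace (ω t)) - N * traceMean δ (entries p) φ) / N := by
      field_simp
    rw [e, abs_div, abs_of_pos hN0, div_le_iff₀ hN0]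
    rw [mul_comm _ (N : ℝ)]
    exact key.le
  refine (measure_mono hsub).trans ((measure_iUnion_fintype_le _ _).trans ?_)
  refine (Finset.sum_le_sum fun x _ => sampleLaw_deviation δ p (Φ x) hτ0 hN (hΦ x)).trans ?_
  rw [Finset.sum_const, nsmul_eq_mul, ← ENNReal.ofReal_natCast, ← ENNReal.ofReal_mul (by positivity)]
  refine ENNReal.ofReal_le_ofReal ?_
  simp only [Finset.card_univ, Fintype.card_prod, Fintype.card_fun, Fintype.card_fin]
  push_cast
  -- This is `9 ≤ 16 * 0.82 ^ 2`: the number of pairs of patterns against the squared accuracy.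
  have h9 : (3 : ℝ) ^ h * 3 ^ h ≤ 16 ^ h * τ ^ 2 := by
    rw [hτ, ← pow_mul, mul_comm h 2, pow_mul, ← mul_pow, ← mul_pow]
    exact pow_le_pow_left₀ (by norm_num) (by norm_num) h
  rw [mul_div_assoc', div_le_div_iff₀ (by positivity) hN0]
  calc (n : ℝ) * (3 ^ h * (3 ^ h * 3)) * ((n : ℝ) ^ 2) ^ 2 * N
      = 3 * (n : ℝ) ^ 5 * N * (3 ^ h * 3 ^ h) := by ring
    _ ≤ 3 * (n : ℝ) ^ 5 * N * (16 ^ h * τ ^ 2) := mul_le_mul_of_nonneg_left h9 (by positivity)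
    _ = _ := by ring

namespace Algorithm

theorem inputMemory_visible (n k : ℕ) (X : List (List Bool)) :
    (inputMemory n k X).visible = inputMemory n k X := by
  funext a i
  unfold Memory.visible
  split_ifs with h
  · rfl
  · match a, h with
    | a + 3, _ => rfl

/-- A program that leaves the states of the algorithm recovers the entries from typical traces. -/
theorem recovers {δ : unitInterval} (h1 : (δ : ℝ) ≤ 1 / 10 ^ 7) {C h n k : ℕ} {ε : ℝ}
    {p : Fin n → unitInterval} (hgood : Good δ h (entries p)) (hgood' : Good δ h (entries p).reverse)
    {N : ℕ} {ω : Fin N → Flips n} (hn : n ≤ N) (hs : Nat.size (n + k) ≤ N)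
    (hw : C * Nat.size (n + k) = h) (hN : 3 ^ h ≤ N)
    (hh : (82 / 100 : ℝ) ^ h ≤ (882 / 1000) ^ h / 4)
    (herr : 32 * (n : ℝ) ^ 3 * (99 / 100) ^ h ≤ 1 / 200)
    (hε : n * (32 * (n : ℝ) ^ 3 * (99 / 100) ^ h) ≤ ε)
    (htyp : Typical δ h (entries p) (traces ω)) {c : Program} {u : Memory} {t : ℕ}
    (hc : Exec c (inputMemory n k (traces ω)) u t)
    (hu : u.visible = state C (inputMemory n k (traces ω)) n) :
    Recovers c k ε p (traces ω) := by
  refine ⟨u, t, hc, le_trans (Finset.sum_le_sum (g := fun _ =>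
    32 * (n : ℝ) ^ 3 * (99 / 100) ^ h) fun i _ => ?_) (by simpa using hε)⟩
  have hlen : (entries p).length = n := List.length_ofFn
  have hl : (traces ω).length = N := List.length_ofFn
  have hX : ∀ t, ((traces ω).getD t []).length ≤ n := by
    intro t
    by_cases ht : t < N
    · rw [List.getD_eq_getElem _ _ (by rw [hl]; exact ht)]
      simp only [traces, List.getElem_ofFn]
      exact length_trace_le _
    · rw [List.getD_eq_default _ _ (by omega)]; simp
  have key := abs_state_sub_le (C := C) (k := k) (i := i) δ.2.1 h1 (isProb_entries p) hgood hgood'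
    (m := inputMemory n k (traces ω)) (X := traces ω)
    (by rw [hlen]; exact holds_inputMemory _ _ _) (by rw [hlen]; exact hX) (by rw [hlen, hl]; exact hn)
    (by rw [hlen, hl]; exact hs) (by rw [hlen]; exact hw) (by rw [hl]; exact hN) hh
    (by rw [hlen]; exact herr) htyp (by rw [hlen]; exact i.2)
  rw [hlen, ← hu, List.getD_eq_getElem _ _ (by rw [hlen]; exact i.2)] at key
  simpa [Memory.visible, entries, output] using key

end Algorithm

/-! ### Success probability and choice of parameters -/

theorem le_successProb {c : Program} {δ : unitInterval} {n k N : ℕ} {ε β η : ℝ}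
    (hβ0 : 0 ≤ β) (hη0 : 0 ≤ η) (hη1 : η ≤ 1)
    {G : (Fin n → unitInterval) → Prop} (hG : volume {p | ¬G p} ≤ ENNReal.ofReal β)
    (hω : ∀ p, G p → sampleLaw δ p N {ω | ¬Recovers c k ε p (traces ω)} ≤ ENNReal.ofReal η) :
    ENNReal.ofReal (1 - β - η) ≤ successProb c δ n k N ε := by
  -- The set of good strings is not assumed measurable. The complement of a measurable hull of the
  -- bad ones supplies a measurable lower bound for the integrand.
  set M := (toMeasurable volume {p : Fin n → unitInterval | ¬G p})ᶜ with hM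
  have hMm : MeasurableSet M := (measurableSet_toMeasurable _ _).compl
  have hMv : ENNReal.ofReal (1 - β) ≤ volume M := by
    rw [hM, prob_compl_eq_one_sub (measurableSet_toMeasurable _ _), measure_toMeasurable,
      ENNReal.ofReal_sub _ hβ0, ENNReal.ofReal_one]
    exact tsub_le_tsub_left hG 1
  have hf : ∀ p ∈ M, ENNReal.ofReal (1 - η) ≤ sampleLaw δ p N {ω | Recovers c k ε p (traces ω)} := by
    intro p hp
    have hGp : G p := by
      by_contra hcon
      exact hp (subset_toMeasurable _ _ hcon)
    rw [ENNReal.ofReal_sub _ hη0, ENNReal.ofReal_one, tsub_le_iff_right]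
    have h1 : (1 : ℝ≥0∞) = sampleLaw δ p N Set.univ := measure_univ.symm
    rw [h1]
    refine le_trans (measure_mono ?_) ((measure_union_le _ _).trans (add_le_add_right (hω p hGp) _))
    intro ω _
    exact em (Recovers c k ε p (traces ω))
  calc ENNReal.ofReal (1 - β - η) ≤ ENNReal.ofReal ((1 - η) * (1 - β)) :=
        ENNReal.ofReal_le_ofReal (by nlinarith)
    _ = ENNReal.ofReal (1 - η) * ENNReal.ofReal (1 - β) := ENNReal.ofReal_mul (by linarith)
    _ ≤ ENNReal.ofReal (1 - η) * volume M := by gcongr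
    _ = ∫⁻ p, M.indicator (fun _ => ENNReal.ofReal (1 - η)) p := by
        rw [lintegral_indicator hMm, setLIntegral_const]
    _ ≤ _ := by
        refine lintegral_mono fun p => ?_
        by_cases hp : p ∈ M
        · simpa [hp] using hf p hp
        · simp [hp]

/-- The numerical facts about the length of the patterns and the number of traces. -/
theorem parameter_bounds {a n k Q C h N : ℕ} (hn : 1 ≤ n) (hk : 1 ≤ k) (hQ : n + k = Q)
    (hC : C = 100 * (a + 20)) (hh : C * Nat.size Q = h) (hN : (2 * Q) ^ (4 * C + a + 8) = N) :
    n ≤ N ∧ Nat.size Q ≤ N ∧ 3 ^ h ≤ N ∧ (82 / 100 : ℝ) ^ h ≤ (882 / 1000) ^ h / 4 ∧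
      32 * (n : ℝ) ^ 3 * (99 / 100) ^ h ≤ 1 / 200 ∧
      n * (32 * (n : ℝ) ^ 3 * (99 / 100) ^ h) ≤ 1 / k ∧
      2 * (3 * ((n : ℝ) + 1) ^ 2 * (99 / 100) ^ h) ≤ 1 / (n : ℝ) ^ a / 2 ∧
      3 * (n : ℝ) ^ 5 * 16 ^ h / N ≤ 1 / (n : ℝ) ^ a / 2 := by
  have hQ2 : 2 ≤ Q := by omega
  have hsize : Q < 2 ^ Nat.size Q := Nat.lt_size_self Q
  have hsize0 : 0 < Nat.size Q := Nat.size_pos.2 (by omega)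
  have hsize2 : 2 ^ Nat.size Q ≤ 2 * Q := by
    have : 2 ^ (Nat.size Q - 1) ≤ Q := Nat.lt_size.1 (by omega)
    calc 2 ^ Nat.size Q = 2 * 2 ^ (Nat.size Q - 1) := by rw [← pow_succ', Nat.sub_add_cancel hsize0]
      _ ≤ 2 * Q := by omega
  -- The exponent `4 * C` of `N` comes from here: `2 ^ Nat.size Q ≤ 2 * Q` bounds `16 ^ h` by a
  -- power of `2 * Q`.
  have h16 : 16 ^ h * (2 * Q) ^ (a + 8) ≤ N := by
    rw [← hN, add_assoc, pow_add _ (4 * C)]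
    refine Nat.mul_le_mul_right _ ?_
    calc 16 ^ h = (2 ^ Nat.size Q) ^ (4 * C) := by
          rw [← hh, ← pow_mul, show (16 : ℕ) = 2 ^ 4 by norm_num, ← pow_mul]; ring_nf
      _ ≤ _ := Nat.pow_le_pow_left hsize2 _
  have hQN : 2 * Q ≤ N := by
    rw [← hN]; exact Nat.le_self_pow (by omega) _
  have hqN : Nat.size Q ≤ N := by
    refine le_trans (Nat.size_le.2 ?_) ((show Q ≤ 2 * Q by omega).trans hQN)
    exact Nat.lt_two_pow_self
  have hQR : (2 : ℝ) ≤ Q := by exact_mod_cast hQ2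
  have hQ0 : (0 : ℝ) < Q := by linarith
  have hnQ : (n : ℝ) + 1 ≤ Q := by exact_mod_cast (show n + 1 ≤ Q by omega)
  have hkQ : (k : ℝ) ≤ Q := by exact_mod_cast (show k ≤ Q by omega)
  have hn0 : (0 : ℝ) < n := by exact_mod_cast hn
  have hk0 : (0 : ℝ) < k := by exact_mod_cast hk
  -- Since `(99 / 100) ^ 100 ≤ 1 / 2` and `Q ≤ 2 ^ Nat.size Q`, the factor 100 in `C` makes the
  -- error beat `Q ^ (a + 20)`.
  have h99 : (99 / 100 : ℝ) ^ h * (Q : ℝ) ^ (a + 20) ≤ 1 := by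
    have e1 : (99 / 100 : ℝ) ^ h = ((99 / 100) ^ 100) ^ (Nat.size Q * (a + 20)) := by
      rw [← pow_mul, ← hh, hC]; ring_nf
    have e2 : (Q : ℝ) ^ (a + 20) ≤ 2 ^ (Nat.size Q * (a + 20)) := by
      rw [pow_mul]
      exact pow_le_pow_left₀ hQ0.le (by exact_mod_cast hsize.le) _
    calc (99 / 100 : ℝ) ^ h * (Q : ℝ) ^ (a + 20)
        ≤ (1 / 2) ^ (Nat.size Q * (a + 20)) * 2 ^ (Nat.size Q * (a + 20)) := by
          rw [e1]
          exact mul_le_mul (pow_le_pow_left₀ (by positivity) (by norm_num) _) e2 (by positivity)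
            (by positivity)
      _ = 1 := by rw [← mul_pow]; norm_num
  set r : ℝ := (99 / 100) ^ h with hr
  have hr0 : 0 < r := by positivity
  have hsmall : ∀ b ≤ a + 20, r * (Q : ℝ) ^ b ≤ 1 := fun b hb =>
    (mul_le_mul_of_nonneg_left (pow_le_pow_right₀ (by linarith) hb) hr0.le).trans h99
  -- As `2 ≤ Q`, numerical constants are absorbed into powers of `Q`.
  have hpow : ∀ b c : ℕ, (2 : ℝ) ^ b * (n : ℝ) ^ c ≤ (Q : ℝ) ^ (b + c) := fun b c => by
    rw [pow_add]
    exact mul_le_mul (pow_le_pow_left₀ (by norm_num) hQR _)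
      (pow_le_pow_left₀ hn0.le (by linarith) _) (by positivity) (by positivity)
  have hN0 : (0 : ℝ) < N := by exact_mod_cast (show 0 < N by omega)
  refine ⟨by omega, hqN, ?_, ?_, ?_, ?_, ?_, ?_⟩
  · calc 3 ^ h ≤ 16 ^ h * 1 := by rw [mul_one]; exact Nat.pow_le_pow_left (by norm_num) h
      _ ≤ 16 ^ h * (2 * Q) ^ (a + 8) := Nat.mul_le_mul_left _ (Nat.one_le_pow _ _ (by omega))
      _ ≤ N := h16
  · have h4 : r ≤ 1 / 4 := by
      have := hsmall 2 (by omega)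
      have h2 : (4 : ℝ) ≤ (Q : ℝ) ^ 2 := by nlinarith
      have := mul_le_mul_of_nonneg_left h2 hr0.le
      linarith
    calc (82 / 100 : ℝ) ^ h ≤ (99 / 100 * (882 / 1000)) ^ h :=
          pow_le_pow_left₀ (by norm_num) (by norm_num) h
      _ = r * (882 / 1000) ^ h := mul_pow _ _ _
      _ ≤ 1 / 4 * (882 / 1000) ^ h := mul_le_mul_of_nonneg_right h4 (by positivity)
      _ = _ := by ring
  -- The exponent is chosen for `32 * 200 ≤ 2 ^ 13`.
  · have e1 := hpow 13 3
    have e2 := hsmall (13 + 3) (by omega)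
    have e3 := mul_le_mul_of_nonneg_left e1 hr0.le
    norm_num at e1 e2 e3 ⊢
    nlinarith
  · rw [le_div_iff₀ hk0]
    have e1 := mul_le_mul (hpow 5 4) hkQ hk0.le (by positivity)
    rw [← pow_succ] at e1
    have e2 := hsmall (5 + 4 + 1) (by omega)
    have e3 := mul_le_mul_of_nonneg_left e1 hr0.le
    norm_num at e2 e3 ⊢
    linarith
  · rw [div_div, le_div_iff₀ (by positivity)]
    have e1 : ((n : ℝ) + 1) ^ 2 ≤ (Q : ℝ) ^ 2 := pow_le_pow_left₀ (by positivity) hnQ 2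
    have e2 := mul_le_mul e1 (hpow 4 a) (by positivity) (by positivity)
    rw [← pow_add] at e2
    have e3 := hsmall (2 + (4 + a)) (by omega)
    have e4 := mul_le_mul_of_nonneg_left e2 hr0.le
    have e5 : 0 ≤ r * (((n : ℝ) + 1) ^ 2 * (n : ℝ) ^ a) := by positivity
    norm_num at e4 e3
    linarith
  · rw [div_div, div_le_div_iff₀ hN0 (by positivity), one_mul]
    have e1 : (16 : ℝ) ^ h * (2 * Q) ^ (a + 8) ≤ N := by exact_mod_cast h16
    refine le_trans ?_ e1
    have e2 : 6 * (n : ℝ) ^ (a + 5) ≤ (2 * Q) ^ (a + 8) := by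
      rw [show a + 8 = (a + 5) + 3 by ring, pow_add (2 * (Q : ℝ))]
      rw [mul_comm]
      refine mul_le_mul (pow_le_pow_left₀ hn0.le (by linarith) _) ?_ (by norm_num) (by positivity)
      calc (6 : ℝ) ≤ 4 ^ 3 := by norm_num
        _ ≤ _ := pow_le_pow_left₀ (by norm_num) (by linarith) _
    calc 3 * (n : ℝ) ^ 5 * 16 ^ h * ((n : ℝ) ^ a * 2) = 16 ^ h * (6 * (n : ℝ) ^ (a + 5)) := by ring
      _ ≤ _ := mul_le_mul_of_nonneg_left e2 (by positivity)

end TraceReconstruction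

open TraceReconstruction MeasureTheory

theorem theorem2 (δ : unitInterval) (hδ_pos : 0 < (δ : ℝ)) (hδ : (δ : ℝ) ≤ 1 / 10 ^ 7) (a : ℕ) :
    ∃ (c : TraceReconstruction.Program) (numTraces time : Polynomial ℕ),
      ∀ n : ℕ, 1 ≤ n → ∀ ε : ℝ, 0 < ε →
        (∀ X : List (List Bool), X.length = numTraces.eval (n + ⌈1 / ε⌉₊) →
          (∀ x ∈ X, x.length ≤ n) →
          ∃ (u : TraceReconstruction.Memory) (t : ℕ),
            TraceReconstruction.Exec c (TraceReconstruction.inputMemory n ⌈1 / ε⌉₊ X) u t ∧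
              t ≤ time.eval (n + ⌈1 / ε⌉₊)) ∧
        ENNReal.ofReal (1 - 1 / (n : ℝ) ^ a) ≤
          TraceReconstruction.successProb c δ n ⌈1 / ε⌉₊ (numTraces.eval (n + ⌈1 / ε⌉₊)) ε := by
  obtain ⟨c, P, hc⟩ := Algorithm.exists_program (100 * (a + 20))
  refine ⟨c, (2 * Polynomial.X) ^ (4 * (100 * (a + 20)) + a + 8),
    -- The running time is bounded by `P` in the number of traces, which is itself a polynomial in
    -- `n + k`.
    P.comp ((2 * Polynomial.X) ^ (4 * (100 * (a + 20)) + a + 8)), fun n hn ε hε => ?_⟩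
  have hk : 1 ≤ ⌈1 / ε⌉₊ := Nat.one_le_ceil_iff.2 (by positivity)
  have hkε : 1 / ε ≤ ⌈1 / ε⌉₊ := Nat.le_ceil _
  set k := ⌈1 / ε⌉₊ with hk_def
  have heval : ((2 * Polynomial.X : Polynomial ℕ) ^ (4 * (100 * (a + 20)) + a + 8)).eval (n + k) =
      (2 * (n + k)) ^ (4 * (100 * (a + 20)) + a + 8) := by simp
  rw [Polynomial.eval_comp, heval]
  obtain ⟨b1, b2, b3, b4, b5, b6, b7, b8⟩ := parameter_bounds (a := a) hn hk rfl rfl rfl rfl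
  set N := (2 * (n + k)) ^ (4 * (100 * (a + 20)) + a + 8) with hN
  set h := 100 * (a + 20) * Nat.size (n + k) with hh
  have run : ∀ X : List (List Bool), X.length = N → ∃ u t, Exec c (inputMemory n k X) u t ∧
      t ≤ P.eval N ∧ u.visible = Algorithm.state (100 * (a + 20)) (inputMemory n k X) n := by
    intro X hX
    obtain ⟨u, t, e1, e2, e3⟩ := hc (inputMemory n k X) (Algorithm.inputMemory_visible n k X).symm
      (by simpa [inputMemory, hX] using b1)
    exact ⟨u, t, e1, by simpa [inputMemory, hX] using e2, e3⟩
  refine ⟨fun X hX _ => ?_, ?_⟩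
  · obtain ⟨u, t, e1, e2, -⟩ := run X hX
    exact ⟨u, t, e1, e2⟩
  have hn0 : (0 : ℝ) < n := by exact_mod_cast hn
  have hx0 : 0 ≤ 1 / (n : ℝ) ^ a / 2 := by positivity
  have hx1 : 1 / (n : ℝ) ^ a / 2 ≤ 1 := by
    have : 1 / (n : ℝ) ^ a ≤ 1 := div_le_one_of_le₀ (one_le_pow₀ (by exact_mod_cast hn)) (by positivity)
    linarith
  -- Bad strings and atypical traces each get half of the failure probability `1 / n ^ a`.
  have key := le_successProb (c := c) (δ := δ) (n := n) (k := k) (N := N) (ε := ε) hx0 hx0 hx1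
    (G := fun p => Good δ h (entries p) ∧ Good δ h (entries p).reverse) ?_ ?_
  · refine le_trans (ENNReal.ofReal_le_ofReal (le_of_eq ?_)) key
    ring
  · have e : {p : Fin n → unitInterval | ¬(Good δ h (entries p) ∧ Good δ h (entries p).reverse)} ⊆
        {p | ¬Good δ h (entries p)} ∪ {p | ¬Good δ h (entries p).reverse} := fun p hp =>
      not_and_or.1 hp
    refine (measure_mono e).trans ((measure_union_le _ _).trans ?_)
    refine (add_le_add (volume_not_good_le hδ_pos.le hδ n h)
      (volume_not_good_reverse_le hδ_pos.le hδ n h)).trans ?_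
    rw [← ENNReal.ofReal_add (by positivity) (by positivity)]
    exact ENNReal.ofReal_le_ofReal (by linarith)
  · rintro p ⟨g1, g2⟩
    refine le_trans (measure_mono ?_) ((sampleLaw_not_typical_le δ p (by omega : 0 < N) h).trans
      (ENNReal.ofReal_le_ofReal b8))
    intro ω hω htyp
    obtain ⟨u, t, e1, -, e3⟩ := run (traces ω) List.length_ofFn
    refine hω (Algorithm.recovers hδ g1 g2 b1 b2 hh.symm b3 b4 b5 (b6.trans ?_) htyp e1 e3)
    -- The error bound `1 / k` is at most `ε` because `k = ⌈1 / ε⌉₊`.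
    rw [div_le_iff₀ (by positivity)]
    rw [div_le_iff₀ hε] at hkε
    linarith
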